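/- Let $k$ be a field and let $S=k[x_1,\dots,x_t;\delta_2,\dots,\delta_t]\neq 0$ be an iterated Ore extension with identity automorphisms: writing $S_j$ for the subalgebra generated by $x_1,\dots,x_j$ (so $S_0=k$, $S_1=k[x_1]$, $S_t=S$), for each $j$ there is a $k$-linear derivation $\delta_j$ of $S_{j-1}$ (with $\delta_1=0$) such that $S_j=S_{j-1}[x_j;1,\delta_j]$, i.e. $x_jr=rx_j+\delta_j(r)$ for $r\in S_{j-1}$ and $S_j$ is a free left $S_{j-1}$-module on $1,x_j,x_j^2,\dots$. Assume that the derivations are filtered: $\delta_j(x_i)\in k\oplus\mathrm{span}_k\{x_1,\dots,x_{j-1}\}$ for $i<j$. Let $V=\mathrm{span}_k\{x_1,\dots,x_t\}$ and let $\bar\delta_j(x_i)\in V$ be the image of $\delta_j(x_i)$ under the projection $k\oplus V\to V$. Then the following hold. (1) The $S$-bimodules $K_n=S\otimes\bigwedge^nV\otimes S$, with the multiplication map $K_0=S\otimes S\to S$ as augmentation and with the bimodule maps $d_n:K_n\to K_{n-1}$ given for $1\le l_1<\dots<l_n\le t$ by $$\begin{aligned} d_n(1\otimes x_{l_1}\wedge\cdots\wedge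 x_{l_n}\otimes 1) ={}&\sum_{1\le i\le n}(-1)^{i+1}\big(x_{l_i}\otimes x_{l_1}\wedge\cdots\wedge\hat x_{l_i}\wedge\cdots\wedge x_{l_n}\otimes 1-1\otimes x_{l_1}\wedge\cdots\wedge\hat x_{l_i}\wedge\cdots\wedge x_{l_n}\otimes x_{l_i}\big)\\ &+\sum_{1\le i<j\le n}(-1)^{j}\,1\otimes x_{l_1}\wedge\cdots\wedge x_{l_{i-1}}\wedge\bar\delta_{l_j}(x_{l_i})\wedge x_{l_{i+1}}\wedge\cdots\wedge\hat x_{l_j}\wedge\cdots\wedge x_{l_n}\otimes 1, \end{aligned}$$ form a free resolution of $S$ as a bimodule over itself. (2) The bimodule maps $\phi_n:K_n\to S^{\otimes(n+2)}$ with $$\phi_n(1\otimes x_{l_1}\wedge\cdots\wedge x_{l_n}\otimes 1)=\sum_{\sigma\in\mathrm{Sym}_n}\mathrm{sgn}(\sigma)\,1\otimes x_{l_{\sigma(1)}}\otimes\cdots\otimes x_{l_{\sigma(n)}}\otimes 1,$$ composed with the quotient maps $S^{\otimes(n+2)}\to S\otimes(S/k)^{\otimes n}\otimes S$, form an injective chain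 map $\bar\phi$ from $K_\bullet$ to the reduced bar resolution of $S$. (3) $K_\bullet$ is an iterated twisted product resolution. That is, for every $0\le m<t$, let $A=S_m$, let $B=k[x_{m+1}]$, let $K_\bullet(A)$ be the complex (1) for $A$, and let $K_\bullet(B)$ be the Koszul resolution $0\to B\otimes\mathrm{span}_k\{x_{m+1}\}\otimes B\to B\otimes B\to B\to 0$, with $1\otimes x_{m+1}\otimes1\mapsto x_{m+1}\otimes1-1\otimes x_{m+1}$. Both are free bimodule resolutions, and: (a) there is a twisting map $\tau:B\otimes A\to A\otimes B$ (a bijective linear map with $\tau(1\otimes a)=a\otimes 1$ and $\tau(b\otimes1)=1\otimes b$ that is compatible with the multiplications of $A$ and $B$) such that $\tau(x_{m+1}\otimes a)=a\otimes x_{m+1}+\delta_{m+1}(a)\otimes1$ for all $a\in A$, and $a\otimes b\mapsto ab$ is an algebra isomorphism $A\otimes_\tau B\to S_{m+1}$, where $A\otimes_\tau B$ is $A\otimes B$ with the multiplication $(m_A\otimes m_B)(1\otimes\tau\otimes1)$; (b) the maps $B\otimes A^{\otimes(n+2)}\to A^{\otimes(n+2)}\otimes B$ obtained by applying $\tau$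 successively induce maps $B\otimes\overline{\mathrm{Bar}}_n(A)\to\overline{\mathrm{Bar}}_n(A)\otimes B$ on the reduced bar resolution of $A$, and these restrict along the embedding $\bar\phi$ of (2) for $A$ to maps $\tau_{B,n}:B\otimes K_n(A)\to K_n(A)\otimes B$; (c) $K_\bullet(A)$ is compatible with $\tau$ via the maps $\tau_{B,n}$, and $K_\bullet(B)$ is compatible with $\tau$ via maps $\tau_{n,A}:K_n(B)\otimes A\to A\otimes K_n(B)$ with $\tau_{n,A}((1\otimes w\otimes1)\otimes a)=a\otimes(1\otimes w\otimes1)$. Here compatible means that these maps are bijective chain maps lifting $\tau$ and that, as identities of linear maps, with $\rho$ the bimodule structure maps, $P_n=K_n(A)$ and $Q_n=K_n(B)$, $$\tau_{B,n}(m_B\otimes1)=(1\otimes m_B)(\tau_{B,n}\otimes1)(1\otimes\tau_{B,n}),\qquad \tau_{B,n}(1\otimes\rho_{P_n})=(\rho_{P_n}\otimes1)(1\otimes1\otimes\tau)(1\otimes\tau_{B,n}\otimes1)(\tau\otimes1\otimes1),$$ $$\tau_{n,A}(1\otimes m_A)=(m_A\otimes1)(1\otimes\tau_{n,A})(\tau_{n,A}\otimes1),\qquad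 \tau_{n,A}(\rho_{Q_n}\otimes1)=(1\otimes\rho_{Q_n})(\tau\otimes1\otimes1)(1\otimes\tau_{n,A}\otimes1)(1\otimes1\otimes\tau);$$ (d) the twisted product complex, with terms $\bigoplus_{i+j=n}K_i(A)\otimes K_j(B)$, differential $d\otimes1+(-1)^i\otimes d$ on $K_i(A)\otimes K_j(B)$, and $A\otimes_\tau B$-bimodule structure $(\rho\otimes\rho)(1\otimes1\otimes\tau\otimes1\otimes1)(1\otimes\tau_{B,i}\otimes\tau_{j,A}\otimes1)$, is isomorphic, as an augmented complex of $S_{m+1}$-bimodules, to the complex (1) for $S_{m+1}$, by an isomorphism sending, for $l_1,\dots,l_i\le m$, $$(1\otimes x_{l_1}\wedge\cdots\wedge x_{l_i}\otimes1)\otimes(1\otimes1)\mapsto1\otimes x_{l_1}\wedge\cdots\wedge x_{l_i}\otimes1,$$ $$(1\otimes x_{l_1}\wedge\cdots\wedge x_{l_i}\otimes1)\otimes(1\otimes x_{m+1}\otimes1)\mapsto1\otimes x_{l_1}\wedge\cdots\wedge x_{l_i}\wedge x_{m+1}\otimes1.$$ -/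

import Mathlib

open scoped TensorProduct DirectSum

namespace TwistedOre

universe u v w

/-! ### Bimodules, complexes and resolutions -/

section Bimodules

variable (k : Type u) [Field k] (A : Type v) [Ring A] [Algebra k A]

/-- The enveloping algebra `Aᵉ = A ⊗ Aᵒᵖ`; an `A`-bimodule is a left `Aᵉ`-module, with
`a · m · a' = (a ⊗ a') • m`. -/
abbrev Env : Type v := A ⊗[k] Aᵐᵒᵖ

/-- The bimodule structure map `ρ : A ⊗ M ⊗ A → M`, `a ⊗ m ⊗ a' ↦ (a ⊗ a') • m`. -/
noncomputable def bimodAct (M : Type w) [AddCommGroup M] [Module k M] [Module (Env k A) M]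
    [IsScalarTower k (Env k A) M] : A ⊗[k] (M ⊗[k] A) →ₗ[k] M :=
  TensorProduct.lift (Algebra.lsmul k k M : Env k A →ₐ[k] Module.End k M).toLinearMap ∘ₗ
    ((MulOpposite.opLinearEquiv k : A ≃ₗ[k] Aᵐᵒᵖ).toLinearMap.lTensor A).rTensor M ∘ₗ
    (TensorProduct.assoc k A A M).symm.toLinearMap ∘ₗ
    (TensorProduct.comm k M A).toLinearMap.lTensor A

theorem bimodAct_tmul (M : Type w) [AddCommGroup M] [Module k M] [Module (Env k A) M]
    [IsScalarTower k (Env k A) M] (a : A) (m : M) (a' : A) :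
    bimodAct k A M (a ⊗ₜ (m ⊗ₜ a')) = (a ⊗ₜ[k] MulOpposite.op a' : Env k A) • m := by
  simp [bimodAct]

variable {k A}

/-- `⋯ → P 2 → P 1 → P 0 → A → 0` is a free resolution of `A` as a bimodule over itself. The
field `aug_act` says that the augmentation `ε` is a map of bimodules. -/
structure IsFreeResolution {P : ℕ → Type w} [∀ n, AddCommGroup (P n)] [∀ n, Module k (P n)]
    [∀ n, Module (Env k A) (P n)] (d : ∀ n, P (n + 1) →ₗ[Env k A] P n)
    (ε : P 0 →ₗ[k] A) : Prop where
  aug_act : ∀ (a a' : A) (z : P 0),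
    ε ((a ⊗ₜ[k] MulOpposite.op a' : Env k A) • z) = a * ε z * a'
  free : ∀ n, Module.Free (Env k A) (P n)
  exact_succ : ∀ n, Function.Exact (d (n + 1)) (d n)
  exact_zero : Function.Exact (d 0) ε
  surjective : Function.Surjective ε

end Bimodules

/-! ### The complex `S ⊗ ⋀ⁿ V ⊗ S` -/

section Koszul

variable (k : Type u) [Field k] (A : Type v) [Ring A] [Algebra k A] {m : ℕ}

/-- The free bimodule `A ⊗ W ⊗ A` on a vector space `W`, written as the left `Aᵉ`-module
`Aᵉ ⊗ W`. -/
def FreeBimod (W : Type w) [AddCommGroup W] [Module k W] : Type (max v w) := Env k A ⊗[k] W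

section FreeBimod

variable (W : Type w) [AddCommGroup W] [Module k W]

noncomputable instance : AddCommGroup (FreeBimod k A W) :=
  (inferInstance : AddCommGroup (Env k A ⊗[k] W))

noncomputable instance : Module (Env k A) (FreeBimod k A W) :=
  (inferInstance : Module (Env k A) (Env k A ⊗[k] W))

noncomputable instance : Module k (FreeBimod k A W) :=
  (inferInstance : Module k (Env k A ⊗[k] W))

instance : IsScalarTower k (Env k A) (FreeBimod k A W) where
  smul_assoc r e z := smul_assoc (α := Env k A ⊗[k] W) r e z

variable {W}

/-- The element `1 ⊗ w ⊗ 1` of `A ⊗ W ⊗ A`. -/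
noncomputable def inner (w : W) : FreeBimod k A W :=
  ((1 : Env k A) ⊗ₜ[k] w : Env k A ⊗[k] W)

/-- The basis of `A ⊗ W ⊗ A` given by the elements `1 ⊗ b_i ⊗ 1`. -/
noncomputable def innerBasis {I : Type*} (b : Module.Basis I k W) :
    Module.Basis I (Env k A) (FreeBimod k A W) :=
  (Algebra.TensorProduct.basis (Env k A) b :
    Module.Basis I (Env k A) (Env k A ⊗[k] W))

theorem innerBasis_apply {I : Type*} (b : Module.Basis I k W) (i : I) :
    innerBasis k A b i = inner k A (b i) :=
  Algebra.TensorProduct.basis_apply b i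

end FreeBimod

/-- The free bimodule `A ⊗ ⋀ⁿ V ⊗ A`, where `V` is the vector space with basis `x₁, …, x_m`. -/
abbrev Kos (m n : ℕ) : Type (max u v) := FreeBimod k A (⋀[k]^n (Fin m → k))

/-- The element `1 ⊗ v₁ ∧ ⋯ ∧ v_n ⊗ 1`. -/
noncomputable def wedge {n : ℕ} (v : Fin n → (Fin m → k)) : Kos k A m n :=
  inner k A (exteriorPower.ιMulti k n v)

/-- The basis vector `x_i` of `V`. -/
def vec (m : ℕ) (i : Fin m) : Fin m → k := Pi.single i 1

/-- The element `1 ⊗ x_{l₁} ∧ ⋯ ∧ x_{l_n} ⊗ 1`. -/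
noncomputable def gen {n : ℕ} (l : Fin n → Fin m) : Kos k A m n :=
  wedge k A (fun p => vec k m (l p))

variable {k A}

/-- The right-hand side of the formula for
`d (1 ⊗ x_{l₁} ∧ ⋯ ∧ x_{l_{n+1}} ⊗ 1)`, where `x i` is the image of `x_i` in `A` and
`c j i ∈ V` is the vector `δ̄_j(x_i)`. (Indices start from `0`, so the signs `(-1)^{i+1}` and
`(-1)^j` of the one-based formula read `(-1)^i` and `(-1)^{j+1}`.) -/
noncomputable def koszulFormula (x : Fin m → A) (c : Fin m → Fin m → (Fin m → k)) (n : ℕ)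
    (l : Fin (n + 1) → Fin m) : Kos k A m n :=
  (∑ i : Fin (n + 1), (-1 : k) ^ (i : ℕ) •
    ((x (l i) ⊗ₜ[k] (1 : Aᵐᵒᵖ) : Env k A) • gen k A (fun p => l (i.succAbove p)) -
      ((1 : A) ⊗ₜ[k] MulOpposite.op (x (l i)) : Env k A) •
        gen k A (fun p => l (i.succAbove p)))) +
  ∑ i : Fin (n + 1), ∑ j : Fin (n + 1), if i < j then
    (-1 : k) ^ ((j : ℕ) + 1) • wedge k A (fun p =>
      Function.update (fun q => vec k m (l q)) i (c (l j) (l i)) (j.succAbove p))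
  else 0

variable (k A) in
/-- The `Aᵉ`-basis of `A ⊗ ⋀ⁿ V ⊗ A` given by the elements `1 ⊗ x_{l₁} ∧ ⋯ ∧ x_{l_n} ⊗ 1`
with `l₁ < ⋯ < l_n`. -/
noncomputable def kosBasis (m n : ℕ) :
    Module.Basis (Set.powersetCard (Fin m) n) (Env k A) (Kos k A m n) :=
  innerBasis k A ((Pi.basisFun k (Fin m)).exteriorPower n)

/-- The differential `A ⊗ ⋀ⁿ⁺¹ V ⊗ A → A ⊗ ⋀ⁿ V ⊗ A`: the bimodule map given on the basis by the
formula. -/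
noncomputable def koszulD (x : Fin m → A) (c : Fin m → Fin m → (Fin m → k)) (n : ℕ) :
    Kos k A m (n + 1) →ₗ[Env k A] Kos k A m n :=
  (kosBasis k A m (n + 1)).constr ℕ
    (fun s => koszulFormula x c n (Set.powersetCard.ofFinEmbEquiv.symm s))

theorem koszulD_gen (x : Fin m → A) (c : Fin m → Fin m → (Fin m → k)) (n : ℕ)
    (l : Fin (n + 1) → Fin m) (hl : StrictMono l) :
    koszulD x c n (gen k A l) = koszulFormula x c n l := by
  obtain ⟨s, hs⟩ := (Set.powersetCard.ofFinEmbEquiv (n := n + 1) (I := Fin m)).symm.surjective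
    (OrderEmbedding.ofStrictMono l hl)
  have hl' : ⇑(Set.powersetCard.ofFinEmbEquiv.symm s) = l := by rw [hs]; rfl
  have hg : gen k A l = kosBasis k A m (n + 1) s := by
    rw [kosBasis, innerBasis_apply, exteriorPower.basis_apply, exteriorPower.ιMulti_family]
    simp only [gen, wedge, vec, ← hl']
    congr 2
    funext p
    simp [Pi.basisFun_apply]
  rw [hg, koszulD, Module.Basis.constr_basis, hl']

variable (k A) in
/-- The augmentation `A ⊗ A → A`, `a ⊗ a' ↦ a a'`. -/
noncomputable def koszulAug (m : ℕ) : Kos k A m 0 →ₗ[k] A :=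
  (LinearMap.applyₗ (1 : A) ∘ₗ (AlgHom.mulLeftRight k A).toLinearMap ∘ₗ
    (TensorProduct.rid k (Env k A)).toLinearMap ∘ₗ
    (exteriorPower.zeroEquiv k (Fin m → k)).toLinearMap.lTensor (Env k A) :
    Env k A ⊗[k] (⋀[k]^0 (Fin m → k)) →ₗ[k] A)

theorem koszulAug_smul_wedge (a b : A) (v : Fin 0 → (Fin m → k)) :
    koszulAug k A m ((a ⊗ₜ[k] MulOpposite.op b : Env k A) • wedge k A v) = a * b := by
  have h : ∀ (e : Env k A) (w : ⋀[k]^0 (Fin m → k)), koszulAug k A m (e • inner k A w) =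
      AlgHom.mulLeftRight k A (exteriorPower.zeroEquiv k (Fin m → k) w • e) 1 := by
    intro e w
    have h' : e • inner k A w = (e ⊗ₜ[k] w : Env k A ⊗[k] (⋀[k]^0 (Fin m → k))) := by
      change e • ((1 : Env k A) ⊗ₜ[k] w) = _
      rw [TensorProduct.smul_tmul', smul_eq_mul, mul_one]
    rw [h']
    rfl
  rw [wedge, h]
  simp

end Koszul

/-! ### The reduced bar resolution -/

section Bar

variable (k : Type u) [Field k] (A : Type v) [Ring A] [Algebra k A]

/-- The bar resolution in degree `n`: `A^{⊗(n+2)}`. -/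
abbrev Bar (n : ℕ) : Type (max u v) := ⨂[k]^(n + 2) A

theorem contractNth_update {n : ℕ} (i : Fin (n + 1)) (a : Fin (n + 2) → A) (q : Fin (n + 2)) :
    ∃ (p : Fin (n + 1)) (f : A →ₗ[k] A), ∀ x : A,
      i.castSucc.contractNth (· * ·) (Function.update a q x) =
        Function.update (i.castSucc.contractNth (· * ·) a) p (f x) := by
  rcases lt_trichotomy (q : ℕ) i with h | h | h
  · refine ⟨⟨q, by omega⟩, LinearMap.id, fun x => ?_⟩
    funext j
    simp only [Fin.contractNth, Function.update_apply, Fin.ext_iff, Fin.val_castSucc, Fin.val_succ,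
      LinearMap.id_apply]
    split_ifs <;> first | rfl | (exfalso; omega)
  · refine ⟨i, LinearMap.mulRight k (a i.succ), fun x => ?_⟩
    funext j
    simp only [Fin.contractNth, Function.update_apply, Fin.ext_iff, Fin.val_castSucc, Fin.val_succ,
      LinearMap.mulRight_apply]
    split_ifs <;> first | rfl | (exfalso; omega) | skip
    rw [show j = i from Fin.ext (by omega)]
  · by_cases h' : (q : ℕ) = i + 1
    · refine ⟨i, LinearMap.mulLeft k (a i.castSucc), fun x => ?_⟩
      funext j
      simp only [Fin.contractNth, Function.update_apply, Fin.ext_iff, Fin.val_castSucc,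
        Fin.val_succ, LinearMap.mulLeft_apply]
      split_ifs <;> first | rfl | (exfalso; omega) | skip
      rw [show j = i from Fin.ext (by omega)]
    · refine ⟨⟨(q : ℕ) - 1, by omega⟩, LinearMap.id, fun x => ?_⟩
      funext j
      simp only [Fin.contractNth, Function.update_apply, Fin.ext_iff, Fin.val_castSucc,
        Fin.val_succ, LinearMap.id_apply]
      split_ifs <;> first | rfl | (exfalso; omega)

/-- The multilinear map
`(a₀, …, a_{n+1}) ↦ a₀ ⊗ ⋯ ⊗ a_i a_{i+1} ⊗ ⋯ ⊗ a_{n+1}`. -/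
noncomputable def barFaceMultilinear (n : ℕ) (i : Fin (n + 1)) :
    MultilinearMap k (fun _ : Fin (n + 2) => A) (⨂[k]^(n + 1) A) where
  toFun a := PiTensorProduct.tprod k (i.castSucc.contractNth (· * ·) a)
  map_update_add' a q x y := by
    obtain ⟨p, f, h⟩ := contractNth_update k A i a q
    have h' : ∀ x : A, i.castSucc.contractNth (· * ·) (Function.update a q x) =
        Function.update (i.castSucc.contractNth (· * ·) a) p (f x) := by
      intro x; rw [← h x]; congr!
    rw [h', h', h', map_add, MultilinearMap.map_update_add]
  map_update_smul' a q c x := by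
    obtain ⟨p, f, h⟩ := contractNth_update k A i a q
    have h' : ∀ x : A, i.castSucc.contractNth (· * ·) (Function.update a q x) =
        Function.update (i.castSucc.contractNth (· * ·) a) p (f x) := by
      intro x; rw [← h x]; congr!
    rw [h', h', map_smul, MultilinearMap.map_update_smul]

/-- `a₀ ⊗ ⋯ ⊗ a_{n+1} ↦ a₀ ⊗ ⋯ ⊗ a_i a_{i+1} ⊗ ⋯ ⊗ a_{n+1}`. -/
noncomputable def barFace (n : ℕ) (i : Fin (n + 1)) : (⨂[k]^(n + 2) A) →ₗ[k] ⨂[k]^(n + 1) A :=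
  PiTensorProduct.lift (barFaceMultilinear k A n i)

/-- The bar differential from degree `n + 1` to degree `n`. -/
noncomputable def barD (n : ℕ) : Bar k A (n + 1) →ₗ[k] Bar k A n :=
  ∑ i : Fin (n + 2), (-1 : k) ^ (i : ℕ) • barFace k A (n + 1) i

/-- The kernel of `A ⊗ A^{⊗n} ⊗ A → A ⊗ Ā^{⊗n} ⊗ A`, where `Ā = A / k1`: it is spanned by the
tensors with some inner factor equal to `1`. -/
def barDegenerate (n : ℕ) : Submodule k (Bar k A n) :=
  Submodule.span k {z | ∃ (a : Fin (n + 2) → A) (i : Fin n),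
    a i.succ.castSucc = 1 ∧ z = PiTensorProduct.tprod k a}

/-- The reduced bar resolution in degree `n`: `A ⊗ Ā^{⊗n} ⊗ A`. -/
abbrev RBar (n : ℕ) : Type (max u v) := Bar k A n ⧸ barDegenerate k A n

theorem barFace_tprod (n : ℕ) (i : Fin (n + 1)) (a : Fin (n + 2) → A) :
    barFace k A n i (PiTensorProduct.tprod k a) =
      PiTensorProduct.tprod k (i.castSucc.contractNth (· * ·) a) :=
  PiTensorProduct.lift.tprod a

theorem barD_degenerate (n : ℕ) :
    barDegenerate k A (n + 1) ≤ (barDegenerate k A n).comap (barD k A n) := by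
  refine Submodule.span_le.2 ?_
  rintro _ ⟨a, q, hq, rfl⟩
  -- the faces `q` and `q + 1` cancel, and all others are degenerate
  have key : ∀ i : Fin (n + 2), i ≠ q.castSucc → i ≠ q.succ →
      barFace k A (n + 1) i (PiTensorProduct.tprod k a) ∈ barDegenerate k A n := by
    intro i h1 h2
    rw [barFace_tprod]
    have h1' : (i : ℕ) ≠ q := fun h => h1 (Fin.ext (by simpa using h))
    have h2' : (i : ℕ) ≠ q + 1 := fun h => h2 (Fin.ext (by simpa using h))
    rcases lt_or_ge (i : ℕ) q with h | h
    · refine Submodule.subset_span ⟨_, ⟨(q : ℕ) - 1, by omega⟩, ?_, rfl⟩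
      rw [Fin.contractNth_apply_of_gt _ _ _ _ (by simp; omega), ← hq]
      congr 1
      ext
      simp
      omega
    · refine Submodule.subset_span ⟨_, ⟨(q : ℕ), by omega⟩, ?_, rfl⟩
      rw [Fin.contractNth_apply_of_lt _ _ _ _ (by simp; omega), ← hq]
      congr 1
  have cancel : barFace k A (n + 1) q.castSucc (PiTensorProduct.tprod k a) =
      barFace k A (n + 1) q.succ (PiTensorProduct.tprod k a) := by
    rw [barFace_tprod, barFace_tprod]
    congr 1
    funext j
    rcases lt_trichotomy (j : ℕ) q with h | h | h
    · rw [Fin.contractNth_apply_of_lt _ _ _ _ (by simpa using h),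
        Fin.contractNth_apply_of_lt _ _ _ _ (by simp; omega)]
    · rw [Fin.contractNth_apply_of_eq _ _ _ _ (by simpa using h),
        Fin.contractNth_apply_of_lt _ _ _ _ (by simp; omega),
        show j.succ = q.succ.castSucc from Fin.ext (by simpa using h), hq, mul_one]
    · rw [Fin.contractNth_apply_of_gt _ _ _ _ (by simpa using h)]
      by_cases h' : (j : ℕ) = q + 1
      · rw [Fin.contractNth_apply_of_eq _ _ _ _ (by simpa using h'),
          show j.castSucc = q.succ.castSucc from Fin.ext (by simpa using h'), hq, one_mul]
      · rw [Fin.contractNth_apply_of_gt _ _ _ _ (by simp; omega)]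
  have hne : q.castSucc ≠ q.succ := (Fin.castSucc_lt_succ).ne
  change barD k A n (PiTensorProduct.tprod k a) ∈ barDegenerate k A n
  rw [barD, LinearMap.sum_apply, ← Finset.add_sum_erase _ _ (Finset.mem_univ q.castSucc),
    ← Finset.add_sum_erase _ _ (Finset.mem_erase.2 ⟨hne.symm, Finset.mem_univ q.succ⟩), ← add_assoc]
  refine Submodule.add_mem _ ?_ (Submodule.sum_mem _ fun i hi => ?_)
  · simp only [LinearMap.smul_apply, cancel, Fin.val_castSucc, Fin.val_succ, pow_succ]
    simp
  · simp only [Finset.mem_erase, Finset.mem_univ, and_true] at hi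
    rw [LinearMap.smul_apply]
    exact Submodule.smul_mem _ _ (key i hi.2 hi.1)

/-- The reduced bar differential from degree `n + 1` to degree `n`. -/
noncomputable def rbarD (n : ℕ) : RBar k A (n + 1) →ₗ[k] RBar k A n :=
  (barDegenerate k A (n + 1)).mapQ (barDegenerate k A n) (barD k A n) (barD_degenerate k A n)

/-- The projection from the bar resolution to the reduced bar resolution, in degree `n`. -/
abbrev toRBar (n : ℕ) : Bar k A n →ₗ[k] RBar k A n := (barDegenerate k A n).mkQ

variable {k A}

/-- `φ` is the symmetrization map
`a ⊗ x_{l₁} ∧ ⋯ ∧ x_{l_n} ⊗ b ↦ ∑_σ sgn(σ) a ⊗ x_{l_{σ(1)}} ⊗ ⋯ ⊗ x_{l_{σ(n)}} ⊗ b`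
for `l₁ < ⋯ < l_n`. -/
def IsSymmetrization {m : ℕ} (x : Fin m → A) (φ : ∀ n, Kos k A m n →ₗ[k] Bar k A n) : Prop :=
  ∀ (n : ℕ) (l : Fin n → Fin m), StrictMono l → ∀ a b : A,
    φ n ((a ⊗ₜ[k] MulOpposite.op b : Env k A) • gen k A l) =
      ∑ σ : Equiv.Perm (Fin n), ((Equiv.Perm.sign σ : ℤ) : k) • PiTensorProduct.tprod k
        (Fin.cons a (Fin.snoc (fun p => x (l (σ p))) b : Fin (n + 1) → A) : Fin (n + 2) → A)

/-- `φ` is the symmetrization map and its composite `φ̄` with the projection to the reduced bar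
resolution is an injective chain map. -/
structure IsSymmetrizationEmbedding {m : ℕ} (x : Fin m → A) (c : Fin m → Fin m → (Fin m → k))
    (φ : ∀ n, Kos k A m n →ₗ[k] Bar k A n) : Prop where
  symm : IsSymmetrization x φ
  chain : ∀ n z, rbarD k A n (toRBar k A (n + 1) (φ (n + 1) z)) = toRBar k A n (φ n (koszulD x c n z))
  injective : ∀ n, Function.Injective (fun z => toRBar k A n (φ n z))

end Bar

/-! ### Twisted tensor products -/

section Twisting

section Mid

variable {k : Type u} [Field k] {X Y Z W Y' Z' : Type*}
  [AddCommGroup X] [Module k X] [AddCommGroup Y] [Module k Y] [AddCommGroup Z] [Module k Z]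
  [AddCommGroup W] [Module k W] [AddCommGroup Y'] [Module k Y'] [AddCommGroup Z'] [Module k Z']

/-- `1 ⊗ f ⊗ 1`, applied to the two inner factors. -/
noncomputable def mid (f : Y ⊗[k] Z →ₗ[k] Y' ⊗[k] Z') :
    (X ⊗[k] Y) ⊗[k] (Z ⊗[k] W) →ₗ[k] (X ⊗[k] Y') ⊗[k] (Z' ⊗[k] W) :=
  (TensorProduct.assoc k X Y' (Z' ⊗[k] W)).symm.toLinearMap ∘ₗ
    ((TensorProduct.assoc k Y' Z' W).toLinearMap ∘ₗ f.rTensor W ∘ₗ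
      (TensorProduct.assoc k Y Z W).symm.toLinearMap).lTensor X ∘ₗ
    (TensorProduct.assoc k X Y (Z ⊗[k] W)).toLinearMap

/-- `f ⊗ 1` on `X ⊗ (Y ⊗ W)`. -/
noncomputable def onLeft (f : X ⊗[k] Y →ₗ[k] Y' ⊗[k] Z') :
    X ⊗[k] (Y ⊗[k] W) →ₗ[k] Y' ⊗[k] (Z' ⊗[k] W) :=
  (TensorProduct.assoc k Y' Z' W).toLinearMap ∘ₗ f.rTensor W ∘ₗ
    (TensorProduct.assoc k X Y W).symm.toLinearMap

end Mid

variable {k : Type u} [Field k] {A : Type v} [Ring A] [Algebra k A] {B : Type w} [Ring B]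
  [Algebra k B]

/-- `τ : B ⊗ A → A ⊗ B` is a twisting map. -/
structure IsTwistingMap (τ : B ⊗[k] A →ₗ[k] A ⊗[k] B) : Prop where
  bijective : Function.Bijective τ
  one_left : ∀ a : A, τ (1 ⊗ₜ a) = a ⊗ₜ 1
  one_right : ∀ b : B, τ (b ⊗ₜ 1) = 1 ⊗ₜ b
  mul : τ ∘ₗ TensorProduct.map (LinearMap.mul' k B) (LinearMap.mul' k A) =
    TensorProduct.map (LinearMap.mul' k A) (LinearMap.mul' k B) ∘ₗ mid τ ∘ₗ
      TensorProduct.map τ τ ∘ₗ mid τ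

/-- The multiplication `m_τ = (m_A ⊗ m_B)(1 ⊗ τ ⊗ 1)` of `A ⊗_τ B`. -/
noncomputable def twistMul (τ : B ⊗[k] A →ₗ[k] A ⊗[k] B) :
    (A ⊗[k] B) ⊗[k] (A ⊗[k] B) →ₗ[k] A ⊗[k] B :=
  TensorProduct.map (LinearMap.mul' k A) (LinearMap.mul' k B) ∘ₗ mid τ

/-- The `A`-bimodule `M` is compatible with `τ` via `τM = τ_{B,M}`:
`τM (m_B ⊗ 1) = (1 ⊗ m_B)(τM ⊗ 1)(1 ⊗ τM)` and
`τM (1 ⊗ ρ) = (ρ ⊗ 1)(1 ⊗ 1 ⊗ τ)(1 ⊗ τM ⊗ 1)(τ ⊗ 1 ⊗ 1)`. -/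
structure IsCompatibleLeft (τ : B ⊗[k] A →ₗ[k] A ⊗[k] B) {M : Type*} [AddCommGroup M] [Module k M]
    [Module (Env k A) M] [IsScalarTower k (Env k A) M] (τM : B ⊗[k] M →ₗ[k] M ⊗[k] B) : Prop where
  bijective : Function.Bijective τM
  mul : τM ∘ₗ (LinearMap.mul' k B).rTensor M ∘ₗ (TensorProduct.assoc k B B M).symm.toLinearMap =
    (LinearMap.mul' k B).lTensor M ∘ₗ onLeft τM ∘ₗ τM.lTensor B
  act : τM ∘ₗ (bimodAct k A M).lTensor B =
    (bimodAct k A M).rTensor B ∘ₗ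
      ((TensorProduct.assoc k A (M ⊗[k] A) B).symm.toLinearMap ∘ₗ
        ((TensorProduct.assoc k M A B).symm.toLinearMap).lTensor A) ∘ₗ
      (τ.lTensor M).lTensor A ∘ₗ (onLeft τM).lTensor A ∘ₗ onLeft τ

/-- The `B`-bimodule `N` is compatible with `τ` via `τN = τ_{N,A}`:
`τN (1 ⊗ m_A) = (m_A ⊗ 1)(1 ⊗ τN)(τN ⊗ 1)` and
`τN (ρ ⊗ 1) = (1 ⊗ ρ)(τ ⊗ 1 ⊗ 1)(1 ⊗ τN ⊗ 1)(1 ⊗ 1 ⊗ τ)`. -/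
structure IsCompatibleRight (τ : B ⊗[k] A →ₗ[k] A ⊗[k] B) {N : Type*} [AddCommGroup N] [Module k N]
    [Module (Env k B) N] [IsScalarTower k (Env k B) N] (τN : N ⊗[k] A →ₗ[k] A ⊗[k] N) : Prop where
  bijective : Function.Bijective τN
  mul : τN ∘ₗ (LinearMap.mul' k A).lTensor N =
    (LinearMap.mul' k A).rTensor N ∘ₗ (TensorProduct.assoc k A A N).symm.toLinearMap ∘ₗ
      τN.lTensor A ∘ₗ onLeft τN
  act : τN ∘ₗ (bimodAct k B N).rTensor A ∘ₗ
      (TensorProduct.assoc k B (N ⊗[k] B) A).symm.toLinearMap ∘ₗ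
        ((TensorProduct.assoc k N B A).symm.toLinearMap).lTensor B =
    (bimodAct k B N).lTensor A ∘ₗ onLeft τ ∘ₗ (onLeft τN).lTensor B ∘ₗ (τ.lTensor N).lTensor B

/-- The `A`-bimodule resolution `P → A` is compatible with `τ` via the chain map
`τP i = τ_{B,i}` lifting `τ`. -/
structure IsCompatibleResolutionLeft (τ : B ⊗[k] A →ₗ[k] A ⊗[k] B) {P : ℕ → Type*}
    [∀ i, AddCommGroup (P i)] [∀ i, Module k (P i)] [∀ i, Module (Env k A) (P i)]
    [∀ i, IsScalarTower k (Env k A) (P i)] (d : ∀ i, P (i + 1) →ₗ[Env k A] P i)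
    (ε : P 0 →ₗ[k] A)
    (τP : ∀ i, B ⊗[k] P i →ₗ[k] P i ⊗[k] B) : Prop where
  compatible : ∀ i, IsCompatibleLeft τ (τP i)
  chain : ∀ i, ((d i).restrictScalars k).rTensor B ∘ₗ τP (i + 1) =
    τP i ∘ₗ ((d i).restrictScalars k).lTensor B
  lift : ε.rTensor B ∘ₗ τP 0 = τ ∘ₗ ε.lTensor B

/-- The `B`-bimodule resolution `Q → B` is compatible with `τ` via the chain map
`τQ j = τ_{j,A}` lifting `τ`. -/
structure IsCompatibleResolutionRight (τ : B ⊗[k] A →ₗ[k] A ⊗[k] B) {Q : ℕ → Type*}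
    [∀ i, AddCommGroup (Q i)] [∀ i, Module k (Q i)] [∀ i, Module (Env k B) (Q i)]
    [∀ i, IsScalarTower k (Env k B) (Q i)] (d : ∀ i, Q (i + 1) →ₗ[Env k B] Q i)
    (ε : Q 0 →ₗ[k] B)
    (τQ : ∀ i, Q i ⊗[k] A →ₗ[k] A ⊗[k] Q i) : Prop where
  compatible : ∀ i, IsCompatibleRight τ (τQ i)
  chain : ∀ i, ((d i).restrictScalars k).lTensor A ∘ₗ τQ (i + 1) =
    τQ i ∘ₗ ((d i).restrictScalars k).rTensor A
  lift : ε.lTensor A ∘ₗ τQ 0 = τ ∘ₗ ε.rTensor A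

/-- The two-sided action of `A ⊗_τ B` on `M ⊗ N`, as the composite
`(ρ_A ⊗ ρ_B)(1 ⊗ 1 ⊗ τ ⊗ 1 ⊗ 1)(1 ⊗ τ_{B,M} ⊗ τ_{N,A} ⊗ 1)` on
`A ⊗ B ⊗ M ⊗ N ⊗ A ⊗ B`. -/
noncomputable def twistedAct (τ : B ⊗[k] A →ₗ[k] A ⊗[k] B) {M N : Type*}
    [AddCommGroup M] [Module k M] [Module (Env k A) M] [IsScalarTower k (Env k A) M]
    [AddCommGroup N] [Module k N] [Module (Env k B) N] [IsScalarTower k (Env k B) N]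
    (τM : B ⊗[k] M →ₗ[k] M ⊗[k] B) (τN : N ⊗[k] A →ₗ[k] A ⊗[k] N) :
    (A ⊗[k] B) ⊗[k] ((M ⊗[k] N) ⊗[k] (A ⊗[k] B)) →ₗ[k] M ⊗[k] N :=
  TensorProduct.map (bimodAct k A M) (bimodAct k B N) ∘ₗ
    (TensorProduct.assoc k A (M ⊗[k] A) (B ⊗[k] (N ⊗[k] B))).symm.toLinearMap ∘ₗ
    ((TensorProduct.assoc k M A (B ⊗[k] (N ⊗[k] B))).symm.toLinearMap ∘ₗ
      (onLeft τ ∘ₗ (TensorProduct.assoc k A N B).toLinearMap.lTensor B).lTensor M ∘ₗ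
      (TensorProduct.assoc k M B ((A ⊗[k] N) ⊗[k] B)).toLinearMap ∘ₗ
      TensorProduct.map τM (τN.rTensor B) ∘ₗ
      (TensorProduct.assoc k B M ((N ⊗[k] A) ⊗[k] B)).symm.toLinearMap ∘ₗ
      (((TensorProduct.assoc k N A B).symm.toLinearMap.lTensor M ∘ₗ
        (TensorProduct.assoc k M N (A ⊗[k] B)).toLinearMap).lTensor B)).lTensor A ∘ₗ
    (TensorProduct.assoc k A B ((M ⊗[k] N) ⊗[k] (A ⊗[k] B))).toLinearMap

/-- The iterated twisting `B ⊗ A^{⊗n} → A^{⊗n} ⊗ B`: apply `τ` to `B` and the first factor `A`, then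
to `B` and the second factor, and so on. -/
noncomputable def twistPow (τ : B ⊗[k] A →ₗ[k] A ⊗[k] B) :
    ∀ n : ℕ, B ⊗[k] (⨂[k]^n A) →ₗ[k] (⨂[k]^n A) ⊗[k] B
  | 0 => (TensorProduct.comm k B (⨂[k]^0 A)).toLinearMap
  | n + 1 =>
    let s : (⨂[k]^n A) ⊗[k] A ≃ₗ[k] ⨂[k]^(n + 1) A :=
      (PiTensorProduct.subsingletonEquiv (R := k) (s := fun _ : Fin 1 => A) 0).symm.lTensor
        (⨂[k]^n A) ≪≫ₗ TensorPower.mulEquiv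
    s.toLinearMap.rTensor B ∘ₗ (TensorProduct.assoc k (⨂[k]^n A) A B).symm.toLinearMap ∘ₗ
      τ.lTensor (⨂[k]^n A) ∘ₗ onLeft (twistPow τ n) ∘ₗ s.symm.toLinearMap.lTensor B

/-! ### The twisted product complex -/

/-- The term `⨁_{i+j=n} P_i ⊗ Q_j` of the total complex. -/
abbrev Tot (k : Type u) [Field k] (P : ℕ → Type v) (Q : ℕ → Type w) [∀ i, AddCommGroup (P i)]
    [∀ i, Module k (P i)] [∀ i, AddCommGroup (Q i)] [∀ i, Module k (Q i)] (n : ℕ) :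
    Type (max v w) :=
  ⨁ p : {p : ℕ × ℕ // p.1 + p.2 = n}, P p.1.1 ⊗[k] Q p.1.2

section Tot

variable {P : ℕ → Type*} {Q : ℕ → Type*} [∀ i, AddCommGroup (P i)] [∀ i, Module k (P i)]
  [∀ i, AddCommGroup (Q i)] [∀ i, Module k (Q i)]

/-- The inclusion `P_i ⊗ Q_j → ⨁_{i+j=n} P_i ⊗ Q_j`. -/
noncomputable def totIncl (i j : ℕ) {n : ℕ} (h : i + j = n) : P i ⊗[k] Q j →ₗ[k] Tot k P Q n :=
  DirectSum.lof k {p : ℕ × ℕ // p.1 + p.2 = n} (fun p => P p.1.1 ⊗[k] Q p.1.2) ⟨(i, j), h⟩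

/-- The restriction `d_i ⊗ 1 + (-1)^i ⊗ d_j` of the total differential to `P_i ⊗ Q_j`. -/
noncomputable def totDComponent (dP : ∀ i, P (i + 1) →ₗ[k] P i) (dQ : ∀ j, Q (j + 1) →ₗ[k] Q j)
    (n : ℕ) : ∀ i j : ℕ, i + j = n + 1 → (P i ⊗[k] Q j →ₗ[k] Tot k P Q n)
  | 0, 0, _ => 0
  | i + 1, 0, h => totIncl i 0 (by omega) ∘ₗ (dP i).rTensor (Q 0)
  | 0, j + 1, h => totIncl 0 j (by omega) ∘ₗ (dQ j).lTensor (P 0)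
  | i + 1, j + 1, h => totIncl i (j + 1) (by omega) ∘ₗ (dP i).rTensor (Q (j + 1)) +
      (-1 : k) ^ (i + 1) • (totIncl (i + 1) j (by omega) ∘ₗ (dQ j).lTensor (P (i + 1)))

/-- The differential of the total complex. -/
noncomputable def totD (dP : ∀ i, P (i + 1) →ₗ[k] P i) (dQ : ∀ j, Q (j + 1) →ₗ[k] Q j) (n : ℕ) :
    Tot k P Q (n + 1) →ₗ[k] Tot k P Q n :=
  DirectSum.toModule k {p : ℕ × ℕ // p.1 + p.2 = n + 1} (Tot k P Q n)
    (fun p => totDComponent dP dQ n p.1.1 p.1.2 p.2)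

end Tot

/-- `e` is an isomorphism from the twisted product complex of the resolutions `P → A` and `Q → B`
(with the action of `A ⊗_τ B` determined by `τP` and `τQ`) to the augmented complex `X → S` of
bimodules over `S`, where `A ⊗_τ B` is identified with `S` by `μ`. -/
structure IsTwistedProductIso (τ : B ⊗[k] A →ₗ[k] A ⊗[k] B) {S : Type*} [Ring S] [Algebra k S]
    (μ : A ⊗[k] B ≃ₗ[k] S) {P Q X : ℕ → Type*}
    [∀ i, AddCommGroup (P i)] [∀ i, Module k (P i)] [∀ i, Module (Env k A) (P i)]
    [∀ i, IsScalarTower k (Env k A) (P i)]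
    [∀ i, AddCommGroup (Q i)] [∀ i, Module k (Q i)] [∀ i, Module (Env k B) (Q i)]
    [∀ i, IsScalarTower k (Env k B) (Q i)]
    [∀ i, AddCommGroup (X i)] [∀ i, Module k (X i)] [∀ i, Module (Env k S) (X i)]
    (dP : ∀ i, P (i + 1) →ₗ[Env k A] P i) (εP : P 0 →ₗ[k] A)
    (dQ : ∀ i, Q (i + 1) →ₗ[Env k B] Q i) (εQ : Q 0 →ₗ[k] B)
    (dX : ∀ i, X (i + 1) →ₗ[Env k S] X i) (εX : X 0 →ₗ[k] S)
    (τP : ∀ i, B ⊗[k] P i →ₗ[k] P i ⊗[k] B) (τQ : ∀ i, Q i ⊗[k] A →ₗ[k] A ⊗[k] Q i)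
    (e : ∀ n, Tot k P Q n ≃ₗ[k] X n) : Prop where
  /-- `μ` is an isomorphism of algebras. -/
  map_mul : ∀ u v : A ⊗[k] B, μ (twistMul τ (u ⊗ₜ v)) = μ u * μ v
  map_one : μ (1 ⊗ₜ 1) = 1
  /-- `e` is an isomorphism of bimodules. -/
  act : ∀ (i j n : ℕ) (h : i + j = n) (u v : A ⊗[k] B) (z : P i ⊗[k] Q j),
    e n (totIncl i j h (twistedAct τ (τP i) (τQ j) (u ⊗ₜ (z ⊗ₜ v)))) =
      (μ u ⊗ₜ[k] MulOpposite.op (μ v) : Env k S) • e n (totIncl i j h z)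
  /-- `e` is a chain map. -/
  chain : ∀ n z, e n (totD (fun i => (dP i).restrictScalars k) (fun j => (dQ j).restrictScalars k) n z) =
    dX n (e (n + 1) z)
  /-- `e` commutes with the augmentations. -/
  aug : ∀ z, εX (e 0 (totIncl 0 0 rfl z)) = μ (TensorProduct.map εP εQ z)

end Twisting

/-! ### Iterated Ore extensions -/

section Ore

/-- `T = R[x; 1, δ]`: `δ` is a derivation of `R`, `x r = r x + δ(r)` for `r ∈ R`, and `T` is a free
left `R`-module on the powers of `x`. Here `R` is contained in `T` via `ι`. -/
structure IsOreExtension {k : Type u} [Field k] {R T : Type v} [Ring R] [Algebra k R] [Ring T]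
    [Algebra k T] (ι : R →ₐ[k] T) (x : T) (δ : R →ₗ[k] R) : Prop where
  leibniz : ∀ r s : R, δ (r * s) = δ r * s + r * δ s
  commute : ∀ r : R, x * ι r = ι r * x + ι (δ r)
  basis : Function.Bijective (fun f : ℕ →₀ R => f.sum (fun n r => ι r * x ^ n))

variable {k : Type u} [Field k] {S : Type v} [Ring S] [Algebra k S]

/-- The subalgebra of `S` generated by `x₁, …, x_m`. -/
def stage {t : ℕ} (k : Type u) [Field k] {S : Type v} [Ring S] [Algebra k S] (x : Fin t → S)
    (m : ℕ) : Subalgebra k S :=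
  Algebra.adjoin k (x '' {i | (i : ℕ) < m})

theorem stage_mono {t : ℕ} (x : Fin t → S) {m n : ℕ} (h : m ≤ n) : stage k x m ≤ stage k x n :=
  Algebra.adjoin_mono (Set.image_mono fun _ hi => lt_of_lt_of_le hi h)

theorem mem_stage {t : ℕ} (x : Fin t → S) {m : ℕ} (i : Fin t) (h : (i : ℕ) < m) :
    x i ∈ stage k x m :=
  Algebra.subset_adjoin ⟨i, h, rfl⟩

variable (k S) in
/-- The structure of an iterated Ore extension `k[x₁, …, x_t; δ₂, …, δ_t]` with identity
automorphisms on the algebra `S`. With `S_j` the subalgebra generated by `x₁, …, x_j`, each `S_j` is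
the Ore extension `S_{j-1}[x_j; 1, δ_j]`, and `S = S_t`. (For `j = 1` one has `S₀ = k` and `δ₁ = 0`,
so `S₁ = k[x₁]` is the polynomial ring.) -/
structure IteratedOreExtension (t : ℕ) where
  x : Fin t → S
  δ : ∀ j : Fin t, stage k x j →ₗ[k] stage k x j
  isOre : ∀ j : Fin t, IsOreExtension
    (Subalgebra.inclusion (stage_mono x (Nat.le_succ j)) :
      stage k x j →ₐ[k] stage k x (j + 1))
    ⟨x j, mem_stage x j (Nat.lt_succ_self j)⟩ (δ j)
  top : stage k x t = ⊤

namespace IteratedOreExtension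

variable {t : ℕ} (O : IteratedOreExtension k S t)

/-- The element `δ_j(x_i)` of `S`, for `i < j`. -/
def deltaX (j i : Fin t) (h : i < j) : S := (O.δ j ⟨O.x i, mem_stage O.x i h⟩ : stage k O.x j)

/-- The derivations are filtered: `δ_j(x_i) ∈ k ⊕ span {x₁, …, x_{j-1}}` for `i < j`. -/
def IsFiltered : Prop :=
  ∀ (j i : Fin t) (h : i < j),
    O.deltaX j i h ∈ Submodule.span k {(1 : S)} ⊔ Submodule.span k (O.x '' {l | l < j})

open Classical in
/-- The projection `k ⊕ V → V` of an element of `k ⊕ V ⊆ S`, in coordinates with respect to the basis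
`x₁, …, x_t` of `V`. -/
noncomputable def linearPart (s : S) : Fin t → k :=
  if h : ∃ v : Fin t → k, s - ∑ l, v l • O.x l ∈ Submodule.span k {(1 : S)} then h.choose else 0

/-- `δ̄_j(x_i) ∈ V`, for `i < j`. -/
noncomputable def deltaBar (j i : Fin t) : Fin t → k :=
  if h : i < j then O.linearPart (O.deltaX j i h) else 0

variable {m : ℕ} (hm : m ≤ t)

/-- The generators `x₁, …, x_m` of `S_m`. -/
def stageX (i : Fin m) : stage k O.x m :=
  ⟨O.x (Fin.castLE hm i), mem_stage O.x (Fin.castLE hm i) i.isLt⟩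

/-- `δ̄_j(x_i)`, for `i < j ≤ m`, as a vector in the span `V_m` of `x₁, …, x_m`. -/
noncomputable def stageDeltaBar (j i l : Fin m) : k :=
  O.deltaBar (Fin.castLE hm j) (Fin.castLE hm i) (Fin.castLE hm l)

end IteratedOreExtension

/-- The polynomial ring in one variable. -/
abbrev Poly (k : Type u) [Field k] : Type u := Polynomial k

/-- The differential of the Koszul resolution
`0 → k[X] ⊗ span {X} ⊗ k[X] → k[X] ⊗ k[X]`, `1 ⊗ X ⊗ 1 ↦ X ⊗ 1 - 1 ⊗ X`. -/
noncomputable def polyD (k : Type u) [Field k] (n : ℕ) :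
    Kos k (Poly k) 1 (n + 1) →ₗ[Env k (Poly k)] Kos k (Poly k) 1 n :=
  koszulD (fun _ => Polynomial.X) (fun _ _ => 0) n

/-- The complex of `T = A[y; 1, δ]` attached to the generators `(ι x₁, …, ι x_m, y)` is the twisted
product of the complex of `A` attached to `x₁, …, x_m` and the Koszul resolution of the polynomial
ring `k[X]`, where the twisting of the complex of `A` is the restriction of the iterated twisting of
the reduced bar resolution of `A` along the symmetrization embedding. -/
def IsTwistedProductStep {A T : Type v} [Ring A] [Algebra k A] [Ring T] [Algebra k T] {m : ℕ}
    (ι : A →ₐ[k] T) (δ : A →ₗ[k] A)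
    (x : Fin m → A) (c : Fin m → Fin m → (Fin m → k))
    (x' : Fin (m + 1) → T) (c' : Fin (m + 1) → Fin (m + 1) → (Fin (m + 1) → k)) : Prop :=
  IsFreeResolution (P := Kos k A m) (koszulD x c) (koszulAug k A m) ∧
  IsFreeResolution (P := Kos k (Poly k) 1) (polyD k) (koszulAug k (Poly k) 1) ∧
  ∃ (τ : Poly k ⊗[k] A →ₗ[k] A ⊗[k] Poly k) (μ : A ⊗[k] Poly k ≃ₗ[k] T)
    (φ : ∀ n, Kos k A m n →ₗ[k] Bar k A n)
    (τbar : ∀ n, Poly k ⊗[k] RBar k A n →ₗ[k] RBar k A n ⊗[k] Poly k)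
    (τA : ∀ n, Poly k ⊗[k] Kos k A m n →ₗ[k] Kos k A m n ⊗[k] Poly k)
    (τB : ∀ n, Kos k (Poly k) 1 n ⊗[k] A →ₗ[k] A ⊗[k] Kos k (Poly k) 1 n)
    (e : ∀ n, Tot k (Kos k A m) (Kos k (Poly k) 1) n ≃ₗ[k] Kos k T (m + 1) n),
    -- the twisting map with `T = A ⊗_τ B`
    IsTwistingMap τ ∧
    (∀ a, τ (Polynomial.X ⊗ₜ a) = a ⊗ₜ Polynomial.X + δ a ⊗ₜ 1) ∧
    (∀ a p, μ (a ⊗ₜ p) = ι a * Polynomial.aeval (x' (Fin.last m)) p) ∧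
    -- the embedding into the reduced bar resolution, and the restricted twisting
    IsSymmetrizationEmbedding x c φ ∧
    (∀ n, τbar n ∘ₗ (toRBar k A n).lTensor (Poly k) = (toRBar k A n).rTensor (Poly k) ∘ₗ twistPow τ (n + 2)) ∧
    (∀ n, (toRBar k A n ∘ₗ φ n).rTensor (Poly k) ∘ₗ τA n = τbar n ∘ₗ (toRBar k A n ∘ₗ φ n).lTensor (Poly k)) ∧
    -- compatibility on both sides
    IsCompatibleResolutionLeft (P := Kos k A m) τ (koszulD x c) (koszulAug k A m) τA ∧
    IsCompatibleResolutionRight (Q := Kos k (Poly k) 1) τ (polyD k)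
      (koszulAug k (Poly k) 1) τB ∧
    (∀ n (w : ⋀[k]^n (Fin 1 → k)) (a : A),
      τB n (inner k (Poly k) w ⊗ₜ a) = a ⊗ₜ inner k (Poly k) w) ∧
    -- the twisted product complex
    IsTwistedProductIso (P := Kos k A m) (Q := Kos k (Poly k) 1) (X := Kos k T (m + 1)) τ μ
      (koszulD x c) (koszulAug k A m) (polyD k) (koszulAug k (Poly k) 1)
      (koszulD x' c') (koszulAug k T (m + 1)) τA τB e ∧
    ∀ (i j n : ℕ) (h : i + j = n) (l : Fin i → Fin m) (l' : Fin j → Fin 1),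
      e n (totIncl i j h (gen k A l ⊗ₜ gen k (Poly k) l')) =
        gen k T (fun p => Fin.append (fun q => (l q).castSucc) (fun _ => Fin.last m)
          (Fin.cast h.symm p))

end Ore

end TwistedOre

open TwistedOre

open scoped TensorProduct DirectSum

/-! Everything is governed by derivations. For a vector space M with an endomorphism D, let X act on
M ⊗ k[X] by D ⊗ 1 + 1 ⊗ X; then `twist D` sends p ⊗ m to p(X) applied to m ⊗ 1. This twisting is
natural for maps commuting with the endomorphisms (`twist_natural`), and on M ⊗ N with D ⊗ 1 + 1 ⊗
D' it is the twisting past M followed by the twisting past N (`twist_lTensor_tensor`). Its inverse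
is, up to flips, the twisting by -D. Hence each compatibility on the A-side reduces to the statement
that a structure map commutes with derivations: the Leibniz rule makes `twist δ` a twisting map and
makes bimodules compatible, and the iterated twisting of a tensor power is the twisting by the total
derivation (`twistPow_twist`). The k[X]-side is treated in the same way by `rtwist`.

Symmetrization is a chain map because the bar differential of an antisymmetrized tensor consists of
the outer Koszul terms and of terms containing a commutator (`barD_sum_barInner`). Modulo constants
the commutator of x_j and x_i is the linear part of δ_j(x_i), and constants in inner positions
vanish in the reduced bar resolution. Symmetrization is injective because there are coordinate
functionals that vanish on 1 and are dual to the generators. Let δ be a derivation of A whose values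
on the generators have linear parts e_i. It acts on the reduced bar resolution and, through the e_i,
on the Koszul complex, and the embedding intertwines the two actions. Since it is injective, the
Koszul differential commutes with the action (`koszulD_kosDer`), with no direct computation. Thus
the twisting of the bar resolution restricts to the Koszul complex, by chain maps.

For T = A[y; 1, δ] the isomorphisms A ⊗ k[X] ≅ T ≅ k[X] ⊗ A, the twisting of the left-hand factor
and ⋀(V ⊕ ky) ≅ ⋀V ⊗ ⋀(ky) identify the terms of the twisted product with those of the complex of T
(`totEquiv`). Maps obeying the rules of `IsTwistedBimodMap` are determined by their values on
generators. Therefore the chain property follows by splitting the formula for the differential of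
x_{l_1} ∧ ⋯ ∧ x_{l_n} ∧ y into the terms that involve the last factor and those that do not.

Because the Koszul complex of k[X] has only two nonzero terms, the complex of T is the total complex
of two columns. A diagram chase over the field k shows that it is a resolution whenever the complex
of A is one. Induction along the stages, starting from S_0 = k, gives the theorem. The same
induction extends the coordinate functionals, and these show that the coefficients of the linear
part of δ_j(x_i) vanish outside x_1, …, x_{j-1}. -/

namespace TwistedOre

universe u v w

/-! Shortcuts that speed up the search for additive structures on tensor products. -/

namespace InstanceShortcuts

variable {R M N : Type*} [CommSemiring R] [AddCommMonoid M] [AddCommMonoid N] [Module R M]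
  [Module R N]

scoped instance tensorAddCommMonoid : AddCommMonoid (M ⊗[R] N) := TensorProduct.addCommMonoid

scoped instance tensorAddMonoid : AddMonoid (M ⊗[R] N) :=
  TensorProduct.addCommMonoid.toAddMonoid

scoped instance tensorAddZeroClass : AddZeroClass (M ⊗[R] N) :=
  TensorProduct.addCommMonoid.toAddMonoid.toAddZeroClass

scoped instance linearMapZeroHomClass : ZeroHomClass (M →ₗ[R] N) M N :=
  AddMonoidHomClass.toZeroHomClass

scoped instance linearMapAddHomClass : AddHomClass (M →ₗ[R] N) M N :=
  AddMonoidHomClass.toAddHomClass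

scoped instance linearEquivZeroHomClass : ZeroHomClass (M ≃ₗ[R] N) M N :=
  AddMonoidHomClass.toZeroHomClass

scoped instance linearEquivAddHomClass : AddHomClass (M ≃ₗ[R] N) M N :=
  AddMonoidHomClass.toAddHomClass

section

variable {k : Type*} [Field k] {A : Type*} [Ring A] [Algebra k A] {W : Type*} [AddCommGroup W]
  [Module k W]

noncomputable scoped instance freeBimodAddCommMonoid : AddCommMonoid (FreeBimod k A W) :=
  AddCommGroup.toAddCommMonoid

noncomputable scoped instance freeBimodAddMonoid : AddMonoid (FreeBimod k A W) :=
  AddCommGroup.toAddCommMonoid.toAddMonoid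

noncomputable scoped instance freeBimodAddZeroClass : AddZeroClass (FreeBimod k A W) :=
  AddCommGroup.toAddCommMonoid.toAddMonoid.toAddZeroClass

end

end InstanceShortcuts

open scoped InstanceShortcuts

/-! ### The twisting of k[X] past a vector space with an endomorphism -/

section Twist

variable {k : Type u} [Field k] {M N : Type*} [AddCommGroup M] [Module k M]
  [AddCommGroup N] [Module k N]

theorem poly_induction {P : Poly k → Prop} (p : Poly k) (one : P 1)
    (add : ∀ p q, P p → P q → P (p + q)) (smul : ∀ (c : k) p, P p → P (c • p))
    (X_mul : ∀ p, P p → P (Polynomial.X * p)) : P p := by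
  induction p using Polynomial.induction_on' with
  | add p q hp hq => exact add p q hp hq
  | monomial n c =>
    have h : ∀ n : ℕ, P ((Polynomial.X : Poly k) ^ n) := by
      intro n
      induction n with
      | zero => simpa using one
      | succ n ih => rw [pow_succ']; exact X_mul _ ih
    rw [← mul_one c, ← smul_eq_mul, ← Polynomial.smul_monomial, ← Polynomial.X_pow_eq_monomial]
    exact smul c _ (h n)

/-- The action of `X` on `M ⊗ k[X]` twisted by the endomorphism `D` of `M`. -/
noncomputable def shift (D : M →ₗ[k] M) : Module.End k (M ⊗[k] Poly k) :=
  D.rTensor (Poly k) + (LinearMap.mulLeft k (Polynomial.X : Poly k)).lTensor M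

@[simp]
theorem shift_tmul (D : M →ₗ[k] M) (m : M) (p : Poly k) :
    shift D (m ⊗ₜ p) = D m ⊗ₜ p + m ⊗ₜ (Polynomial.X * p) := by
  simp [shift]

/-- The twisting `k[X] ⊗ M → M ⊗ k[X]` determined by
`X p ⊗ m ↦ (D ⊗ 1 + 1 ⊗ X) (p ⊗ m)`. -/
noncomputable def twist (D : M →ₗ[k] M) : Poly k ⊗[k] M →ₗ[k] M ⊗[k] Poly k :=
  TensorProduct.lift
    (LinearMap.lcomp k (M ⊗[k] Poly k) ((TensorProduct.mk k M (Poly k)).flip 1) ∘ₗ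
      (Polynomial.aeval (shift D)).toLinearMap)

theorem twist_tmul (D : M →ₗ[k] M) (p : Poly k) (m : M) :
    twist D (p ⊗ₜ m) = Polynomial.aeval (shift D) p (m ⊗ₜ 1) := rfl

@[simp]
theorem twist_one (D : M →ₗ[k] M) (m : M) : twist D (1 ⊗ₜ m) = m ⊗ₜ 1 := by
  simp [twist_tmul]

theorem twist_X_mul (D : M →ₗ[k] M) (p : Poly k) (m : M) :
    twist D ((Polynomial.X * p) ⊗ₜ m) = shift D (twist D (p ⊗ₜ m)) := by
  simp [twist_tmul]

theorem twist_X (D : M →ₗ[k] M) (m : M) :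
    twist D (Polynomial.X ⊗ₜ m) = m ⊗ₜ Polynomial.X + D m ⊗ₜ 1 := by
  rw [← mul_one Polynomial.X, twist_X_mul, twist_one, shift_tmul, add_comm]

/-- Since k[X] is generated from 1 by multiplication by X, a linear map on k[X] ⊗ M is determined by
its values on 1 ⊗ M and a recursion under X. Identities between twistings are proved by exhibiting
the common recursion operator `U`. -/
theorem polyTensor_ext {Z : Type*} [AddCommGroup Z] [Module k Z]
    {F G : Poly k ⊗[k] M →ₗ[k] Z} (U : Z →ₗ[k] Z) (one : ∀ m, F (1 ⊗ₜ m) = G (1 ⊗ₜ m))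
    (hF : ∀ p m, F ((Polynomial.X * p) ⊗ₜ m) = U (F (p ⊗ₜ m)))
    (hG : ∀ p m, G ((Polynomial.X * p) ⊗ₜ m) = U (G (p ⊗ₜ m))) : F = G := by
  refine TensorProduct.ext' fun p m => ?_
  induction p using poly_induction with
  | one => exact one m
  | add p q hp hq => simp only [TensorProduct.add_tmul, map_add, hp, hq]
  | smul c p hp => simp only [← TensorProduct.smul_tmul', map_smul, hp]
  | X_mul p hp => rw [hF, hG, hp]

/-- If `f` intertwines the endomorphisms, it intertwines the operators `shift D` and `shift D'`,
hence all polynomials in them. This turns equivariance under derivations into compatibility with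
twistings. -/
theorem twist_natural {D : M →ₗ[k] M} {D' : N →ₗ[k] N} (f : M →ₗ[k] N)
    (h : f ∘ₗ D = D' ∘ₗ f) : twist D' ∘ₗ f.lTensor (Poly k) = f.rTensor (Poly k) ∘ₗ twist D := by
  have hs : ∀ z, f.rTensor (Poly k) (shift D z) = shift D' (f.rTensor (Poly k) z) := by
    intro z
    induction z with
    | zero => simp
    | add x y hx hy => simp only [map_add, hx, hy]
    | tmul m p => simp [show f (D m) = D' (f m) from LinearMap.congr_fun h m]
  refine polyTensor_ext (shift D') ?_ ?_ ?_ <;> intros <;> simp [twist_X_mul, hs]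

theorem twist_natural_apply {D : M →ₗ[k] M} {D' : N →ₗ[k] N} (f : M →ₗ[k] N)
    (h : ∀ m, f (D m) = D' (f m)) (z : Poly k ⊗[k] M) :
    twist D' (f.lTensor (Poly k) z) = f.rTensor (Poly k) (twist D z) :=
  LinearMap.congr_fun (twist_natural f (LinearMap.ext h)) z

theorem twist_zero : twist (0 : M →ₗ[k] M) = (TensorProduct.comm k (Poly k) M).toLinearMap :=
  polyTensor_ext (shift 0) (by simp) (by simp [twist_X_mul]) (by simp)

/-- When X crosses M and then N, it either survives or is absorbed by one of the factors as D or D'.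
Both sides therefore obey the recursion of the endomorphism D ⊗ 1 + 1 ⊗ D'. -/
theorem twist_lTensor_tensor (D : M →ₗ[k] M) (D' : N →ₗ[k] N) :
    twist (D.rTensor N + D'.lTensor M) =
      (TensorProduct.assoc k M N (Poly k)).symm.toLinearMap ∘ₗ (twist D').lTensor M ∘ₗ
        onLeft (twist D) := by
  refine polyTensor_ext (shift (D.rTensor N + D'.lTensor M)) ?_ ?_ ?_
  · intro z
    induction z with
    | zero => simp
    | add x y hx hy => simp only [TensorProduct.tmul_add, map_add, hx, hy]
    | tmul m n => simp [onLeft]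
  · intros; simp [twist_X_mul]
  · intro p z
    have key : ∀ (y : M ⊗[k] Poly k) (n : N),
        (TensorProduct.assoc k M N (Poly k)).symm ((twist D').lTensor M
          (TensorProduct.assoc k M (Poly k) N (shift D y ⊗ₜ n))) =
        shift (D.rTensor N + D'.lTensor M) ((TensorProduct.assoc k M N (Poly k)).symm
          ((twist D').lTensor M (TensorProduct.assoc k M (Poly k) N (y ⊗ₜ n)))) := by
      intro y n
      induction y with
      | zero => simp
      | add x y hx hy => simp only [map_add, TensorProduct.add_tmul, hx, hy]
      | tmul m q =>
        simp only [shift_tmul, TensorProduct.add_tmul, map_add, TensorProduct.assoc_tmul,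
          LinearMap.lTensor_tmul, twist_X_mul]
        generalize twist D' (q ⊗ₜ[k] n) = x
        induction x with
        | zero => simp
        | add x y hx hy =>
          simp only [map_add, TensorProduct.tmul_add]
          rw [← hx, ← hy]; abel
        | tmul n q => simp [TensorProduct.add_tmul, TensorProduct.tmul_add]; abel
    induction z with
    | zero => simp
    | add x y hx hy => simp only [TensorProduct.tmul_add, map_add, hx, hy]
    | tmul m n => simp [onLeft, twist_X_mul, key]

/-- A product pq acts as q followed by p, since both act through polynomials in the single operator
`shift D`, which commutes with right multiplication on k[X]. Nothing is required of `D`. -/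
theorem twist_comp_mul (D : M →ₗ[k] M) :
    twist D ∘ₗ (LinearMap.mul' k (Poly k)).rTensor M ∘ₗ
        (TensorProduct.assoc k (Poly k) (Poly k) M).symm.toLinearMap =
      (LinearMap.mul' k (Poly k)).lTensor M ∘ₗ onLeft (twist D) ∘ₗ (twist D).lTensor (Poly k) := by
  have key : ∀ y : (M ⊗[k] Poly k) ⊗[k] Poly k, (LinearMap.mul' k (Poly k)).lTensor M
      (TensorProduct.assoc k M (Poly k) (Poly k) ((shift D).rTensor (Poly k) y)) =
      shift D ((LinearMap.mul' k (Poly k)).lTensor M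
        (TensorProduct.assoc k M (Poly k) (Poly k) y)) := by
    intro y
    induction y with
    | zero => simp
    | add x y hx hy => simp only [map_add, hx, hy]
    | tmul y q =>
      induction y with
      | zero => simp
      | add x y hx hy => simp only [map_add, TensorProduct.add_tmul, hx, hy]
      | tmul m p => simp [TensorProduct.add_tmul, mul_assoc]
  refine polyTensor_ext (shift D) ?_ ?_ ?_
  · intro z
    induction z with
    | zero => simp
    | add x y hx hy => simp only [TensorProduct.tmul_add, map_add, hx, hy]
    | tmul p m =>
      simp only [LinearMap.comp_apply, LinearEquiv.coe_coe, TensorProduct.assoc_symm_tmul,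
        LinearMap.rTensor_tmul, LinearMap.mul'_apply, one_mul, LinearMap.lTensor_tmul]
      generalize twist D (p ⊗ₜ[k] m) = x
      induction x with
      | zero => simp
      | add x y hx hy => simp only [TensorProduct.tmul_add, map_add, ← hx, ← hy]
      | tmul m q => simp [onLeft]
  · intro p z
    induction z with
    | zero => simp
    | add x y hx hy => simp only [TensorProduct.tmul_add, map_add, hx, hy]
    | tmul q m => simp [mul_assoc, twist_X_mul]
  · intro p z
    simp only [LinearMap.comp_apply, LinearMap.lTensor_tmul, onLeft, LinearEquiv.coe_coe]
    rw [← key]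
    congr 2
    generalize twist D z = x
    induction x with
    | zero => simp
    | add x y hx hy => simp only [TensorProduct.tmul_add, map_add, hx, hy]
    | tmul q m => simp [twist_X_mul]

/-- The recursion contributes D from the inner twisting and -D from the outer one. These cancel and
leave multiplication by X, which is the recursion of the flip. -/
theorem twist_neg_twist (D : M →ₗ[k] M) :
    (twist (-D) ∘ₗ (TensorProduct.comm k M (Poly k)).toLinearMap) ∘ₗ twist D =
      (TensorProduct.comm k (Poly k) M).toLinearMap := by
  refine polyTensor_ext ((LinearMap.mulLeft k (Polynomial.X : Poly k)).lTensor M)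
    (by simp) ?_ (by simp)
  intro p m
  simp only [LinearMap.comp_apply, twist_X_mul, LinearEquiv.coe_coe]
  generalize twist D (p ⊗ₜ[k] m) = z
  induction z with
  | zero => simp
  | add x y hx hy => simp only [map_add, hx, hy]
  | tmul m p =>
    -- `D` commutes with `-D`, so it can be pulled out of the twisting by `-D`.
    have h := twist_natural_apply D (D := -D) (D' := -D) (fun m => by simp) (p ⊗ₜ m)
    simp only [LinearMap.lTensor_tmul] at h
    simp only [shift_tmul, map_add, TensorProduct.comm_tmul, twist_X_mul, h]
    rw [shift]
    simp [LinearMap.rTensor_neg]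

/-- The twisting `k[X] ⊗ M ≃ M ⊗ k[X]`. -/
noncomputable def twistEquiv (D : M →ₗ[k] M) : Poly k ⊗[k] M ≃ₗ[k] M ⊗[k] Poly k :=
  LinearEquiv.ofLinearMap (twist D)
    ((TensorProduct.comm k M (Poly k)).toLinearMap ∘ₗ twist (-D) ∘ₗ
      (TensorProduct.comm k M (Poly k)).toLinearMap)
    (by
      ext1
      refine LinearMap.ext fun m => LinearMap.ext fun p => ?_
      have h := LinearMap.congr_fun (twist_neg_twist (-D)) (p ⊗ₜ m)
      simpa using h)
    (by
      refine LinearMap.ext fun z => ?_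
      have h := LinearMap.congr_fun (twist_neg_twist D) z
      simp only [LinearMap.comp_apply, LinearEquiv.coe_coe] at h ⊢
      rw [h]
      exact (TensorProduct.comm k (Poly k) M).symm_apply_apply z)

@[simp]
theorem twistEquiv_apply (D : M →ₗ[k] M) (z) : twistEquiv D z = twist D z := rfl

theorem twist_bijective (D : M →ₗ[k] M) : Function.Bijective (twist D) :=
  (twistEquiv D).bijective

theorem twistEquiv_symm_one (D : M →ₗ[k] M) (m : M) :
    (twistEquiv D).symm (m ⊗ₜ 1) = 1 ⊗ₜ m := by
  rw [LinearEquiv.symm_apply_eq, twistEquiv_apply, twist_one]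

/-- The commutation rule m X = X m - D(m), by which polynomials are moved back to the left. -/
theorem twistEquiv_symm_X_mul (D : M →ₗ[k] M) (m : M) (p : Poly k) :
    (twistEquiv D).symm (m ⊗ₜ (Polynomial.X * p)) =
      (LinearMap.mulLeft k (Polynomial.X : Poly k)).rTensor M ((twistEquiv D).symm (m ⊗ₜ p)) -
        (twistEquiv D).symm (D m ⊗ₜ p) := by
  obtain ⟨z, hz⟩ := (twistEquiv D).surjective (m ⊗ₜ p)
  have h : ∀ z, twist D ((LinearMap.mulLeft k (Polynomial.X : Poly k)).rTensor M z) =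
      shift D (twist D z) := by
    intro z
    induction z with
    | zero => simp
    | add x y hx hy => simp only [map_add, hx, hy]
    | tmul p m => simp [twist_X_mul]
  rw [LinearEquiv.symm_apply_eq, map_sub, LinearEquiv.apply_symm_apply, ← hz,
    LinearEquiv.symm_apply_apply, twistEquiv_apply, h, ← twistEquiv_apply, hz, shift_tmul]
  abel

section TwistingMapMul

variable {A : Type*} [Ring A] [Algebra k A] {B : Type*} [Ring B] [Algebra k B]

theorem twisting_mul_aux (τ : B ⊗[k] A →ₗ[k] A ⊗[k] B) (b : B) (a a' : A) (q' : B)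
    (hn : ∀ p (x y : A), τ (p ⊗ₜ (x * y)) = (LinearMap.mul' k A).rTensor B
        ((TensorProduct.assoc k A A B).symm (τ.lTensor A
          (TensorProduct.assoc k A B A (τ (p ⊗ₜ x) ⊗ₜ y))))) :
    (LinearMap.mul' k B).lTensor A (TensorProduct.assoc k A B B (τ (b ⊗ₜ (a * a')) ⊗ₜ q')) =
      TensorProduct.map (LinearMap.mul' k A) (LinearMap.mul' k B)
        (mid τ (τ (b ⊗ₜ a) ⊗ₜ (a' ⊗ₜ q'))) := by
  rw [hn]
  generalize τ (b ⊗ₜ[k] a) = z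
  induction z with
  | zero => simp only [TensorProduct.zero_tmul, map_zero]
  | add x y hx hy => simp only [map_add, TensorProduct.add_tmul, hx, hy]
  | tmul a r =>
    simp only [mid, TensorProduct.assoc_tmul, LinearMap.lTensor_tmul, LinearMap.comp_apply,
      LinearEquiv.coe_coe, TensorProduct.assoc_symm_tmul, LinearMap.rTensor_tmul]
    generalize τ (r ⊗ₜ[k] a') = z
    induction z with
    | zero => simp only [TensorProduct.zero_tmul, TensorProduct.tmul_zero, map_zero]
    | add x y hx hy =>
      simp only [map_add, TensorProduct.add_tmul, TensorProduct.tmul_add, hx, hy]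
    | tmul a' r =>
      simp only [TensorProduct.assoc_tmul, TensorProduct.assoc_symm_tmul,
        LinearMap.rTensor_tmul, LinearMap.lTensor_tmul, LinearMap.mul'_apply,
        TensorProduct.map_tmul]

/-- Moving b b' past a a' takes four elementary crossings. `hm` separates those of b from those of
b', and `hn` separates those with a from those with a'; together they allow the order prescribed by
the axiom, which begins with b' past a. -/
theorem twisting_mul_of_left_right (τ : B ⊗[k] A →ₗ[k] A ⊗[k] B)
    (hn : ∀ p (x y : A), τ (p ⊗ₜ (x * y)) = (LinearMap.mul' k A).rTensor B
        ((TensorProduct.assoc k A A B).symm (τ.lTensor A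
          (TensorProduct.assoc k A B A (τ (p ⊗ₜ x) ⊗ₜ y)))))
    (hm : ∀ p q (x : A), τ ((p * q) ⊗ₜ x) = (LinearMap.mul' k B).lTensor A
        (TensorProduct.assoc k A B B (τ.rTensor B
          ((TensorProduct.assoc k B A B).symm (p ⊗ₜ τ (q ⊗ₜ x)))))) :
    τ ∘ₗ TensorProduct.map (LinearMap.mul' k B) (LinearMap.mul' k A) =
      TensorProduct.map (LinearMap.mul' k A) (LinearMap.mul' k B) ∘ₗ mid τ ∘ₗ
        TensorProduct.map τ τ ∘ₗ mid τ := by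
  ext1
  refine TensorProduct.ext' fun b b' => ?_
  refine TensorProduct.ext' fun a a' => ?_
  change τ ((b * b') ⊗ₜ (a * a')) = TensorProduct.map _ _ (mid τ
    (TensorProduct.map τ τ (mid τ ((b ⊗ₜ b') ⊗ₜ (a ⊗ₜ a')))))
  have e1 : mid τ ((b ⊗ₜ[k] b') ⊗ₜ[k] (a ⊗ₜ[k] a')) =
      (TensorProduct.assoc k B A (B ⊗[k] A)).symm
        (b ⊗ₜ (TensorProduct.assoc k A B A (τ (b' ⊗ₜ a) ⊗ₜ a'))) := by
    simp only [mid, TensorProduct.assoc_tmul, LinearMap.lTensor_tmul, LinearMap.comp_apply,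
      LinearEquiv.coe_coe, TensorProduct.assoc_symm_tmul, LinearMap.rTensor_tmul]
  rw [e1, hm, hn]
  generalize τ (b' ⊗ₜ[k] a) = z
  induction z with
  | zero => simp only [TensorProduct.zero_tmul, TensorProduct.tmul_zero, map_zero]
  | add x y hx hy => simp only [map_add, TensorProduct.tmul_add, TensorProduct.add_tmul, hx, hy]
  | tmul a q =>
    simp only [TensorProduct.assoc_tmul, LinearMap.lTensor_tmul, TensorProduct.assoc_symm_tmul,
      TensorProduct.map_tmul]
    generalize τ (q ⊗ₜ[k] a') = z
    induction z with
    | zero => simp only [TensorProduct.tmul_zero, map_zero]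
    | add x y hx hy => simp only [map_add, TensorProduct.tmul_add, hx, hy]
    | tmul a' q' =>
      simp only [TensorProduct.assoc_symm_tmul, LinearMap.rTensor_tmul, LinearMap.mul'_apply]
      exact twisting_mul_aux τ b a a' q' hn

end TwistingMapMul

/-- The twisting map of an algebra with a derivation. -/
theorem isTwistingMap_twist {A : Type*} [Ring A] [Algebra k A] (δ : A →ₗ[k] A)
    (h : ∀ r s : A, δ (r * s) = δ r * s + r * δ s) : IsTwistingMap (twist δ) where
  bijective := twist_bijective δ
  one_left := twist_one δ
  one_right b := by
    have h1 : δ 1 = 0 := by simpa using h 1 1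
    induction b using poly_induction with
    | one => simp
    | add p q hp hq => simp only [TensorProduct.add_tmul, map_add, hp, hq, TensorProduct.tmul_add]
    | smul c p hp =>
      rw [← TensorProduct.smul_tmul', map_smul, hp, TensorProduct.tmul_smul]
    | X_mul p hp => rw [twist_X_mul, hp, shift_tmul, h1]; simp
  mul := by
    -- The Leibniz rule says that multiplication intertwines δ ⊗ 1 + 1 ⊗ δ with δ, so naturality
    -- gives multiplicativity in `A`.
    have hn := twist_natural (D := δ.rTensor A + δ.lTensor A) (D' := δ) (LinearMap.mul' k A)
      (TensorProduct.ext' fun a b => by simp [h])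
    rw [twist_lTensor_tensor] at hn
    have hm := twist_comp_mul δ
    refine twisting_mul_of_left_right _ (fun p x y => ?_) (fun p q x => ?_)
    · simpa [onLeft] using LinearMap.congr_fun hn (p ⊗ₜ (x ⊗ₜ y))
    · simpa [onLeft] using LinearMap.congr_fun hm (p ⊗ₜ (q ⊗ₜ x))

end Twist

/-! ### Free bimodules, their derivations and compatibility on the left -/

section FreeBimodMaps

variable {k : Type u} [Field k] {A : Type v} [Ring A] [Algebra k A]
  {W W' : Type*} [AddCommGroup W] [Module k W] [AddCommGroup W'] [Module k W']

theorem smul_inner (e : Env k A) (w : W) :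
    e • inner k A w = (e ⊗ₜ[k] w : Env k A ⊗[k] W) := by
  change e • ((1 : Env k A) ⊗ₜ[k] w) = _
  rw [TensorProduct.smul_tmul', smul_eq_mul, mul_one]

variable (k A W) in
/-- The linear map `w ↦ 1 ⊗ w ⊗ 1`. -/
noncomputable def innerₗ : W →ₗ[k] FreeBimod k A W :=
  (TensorProduct.mk k (Env k A) W 1 : W →ₗ[k] Env k A ⊗[k] W)

@[simp]
theorem innerₗ_apply (w : W) : innerₗ k A W w = inner k A w := rfl

theorem FreeBimod.induction {P : FreeBimod k A W → Prop} (z : FreeBimod k A W) (zero : P 0)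
    (add : ∀ x y, P x → P y → P (x + y))
    (smul_inner : ∀ (a b : A) (w : W), P ((a ⊗ₜ[k] MulOpposite.op b : Env k A) • inner k A w)) :
    P z := by
  induction z using TensorProduct.induction_on with
  | zero => exact zero
  | add x y hx hy => exact add x y hx hy
  | tmul e w =>
    rw [← TwistedOre.smul_inner e w]
    induction e using TensorProduct.induction_on with
    | zero => convert zero; exact zero_smul (Env k A) (inner k A w)
    | add x y hx hy => rw [add_smul]; exact add _ _ hx hy
    | tmul a b => exact smul_inner a b.unop w

theorem FreeBimod.hom_ext {Z : Type*} [AddCommGroup Z] [Module k Z]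
    {F G : FreeBimod k A W →ₗ[k] Z}
    (h : ∀ (a b : A) (w : W), F ((a ⊗ₜ[k] MulOpposite.op b : Env k A) • inner k A w) =
      G ((a ⊗ₜ[k] MulOpposite.op b : Env k A) • inner k A w)) : F = G := by
  refine LinearMap.ext fun z => ?_
  induction z using FreeBimod.induction with
  | zero => simp
  | add x y hx hy => simp [hx, hy]
  | smul_inner a b w => exact h a b w

/-- The linear endomorphism `z ↦ a z b` of a bimodule. -/
noncomputable def sandwich (k : Type u) [Field k] {A : Type v} [Ring A] [Algebra k A] {M : Type*}
    [AddCommGroup M] [Module k M]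
    [Module (Env k A) M] [IsScalarTower k (Env k A) M] (a b : A) : M →ₗ[k] M :=
  Algebra.lsmul k k M (a ⊗ₜ[k] MulOpposite.op b : Env k A)

@[simp]
theorem sandwich_apply {M : Type*} [AddCommGroup M] [Module k M]
    [Module (Env k A) M] [IsScalarTower k (Env k A) M] (a b : A) (m : M) :
    sandwich k a b m = (a ⊗ₜ[k] MulOpposite.op b : Env k A) • m := rfl

theorem sandwich_smul_left {M : Type*} [AddCommGroup M] [Module k M]
    [Module (Env k A) M] [IsScalarTower k (Env k A) M] (c : k) (a b : A) (m : M) :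
    sandwich k (c • a) b m = c • sandwich k a b m := by
  rw [sandwich_apply, ← TensorProduct.smul_tmul', smul_assoc, sandwich_apply]

theorem sandwich_smul_right {M : Type*} [AddCommGroup M] [Module k M]
    [Module (Env k A) M] [IsScalarTower k (Env k A) M] (c : k) (a b : A) (m : M) :
    sandwich k a (c • b) m = c • sandwich k a b m := by
  rw [sandwich_apply, MulOpposite.op_smul, TensorProduct.tmul_smul, smul_assoc, sandwich_apply]

theorem FreeBimod.hom_ext_basis {I : Type*} (bas : Module.Basis I k W)
    {Z : Type*} [AddCommGroup Z] [Module k Z] {F G : FreeBimod k A W →ₗ[k] Z}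
    (h : ∀ (a b : A) (i : I), F ((a ⊗ₜ[k] MulOpposite.op b : Env k A) • inner k A (bas i)) =
      G ((a ⊗ₜ[k] MulOpposite.op b : Env k A) • inner k A (bas i))) : F = G := by
  refine FreeBimod.hom_ext fun a b w => ?_
  have : (F ∘ₗ sandwich k a b) ∘ₗ innerₗ k A W = (G ∘ₗ sandwich k a b) ∘ₗ innerₗ k A W :=
    bas.ext fun i => h a b i
  exact LinearMap.congr_fun this w

theorem tmul_op_smul_smul {M : Type*} [AddCommGroup M] [Module (Env k A) M] (a b c d : A) (z : M) :
    (a ⊗ₜ[k] MulOpposite.op b : Env k A) • (c ⊗ₜ[k] MulOpposite.op d : Env k A) • z =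
      ((a * c) ⊗ₜ[k] MulOpposite.op (d * b) : Env k A) • z := by
  rw [smul_smul, Algebra.TensorProduct.tmul_mul_tmul, MulOpposite.op_mul]

theorem one_tmul_op_one_smul {M : Type*} [AddCommGroup M] [Module (Env k A) M] (z : M) :
    ((1 : A) ⊗ₜ[k] MulOpposite.op (1 : A) : Env k A) • z = z := by
  rw [MulOpposite.op_one, ← Algebra.TensorProduct.one_def, one_smul]

theorem zero_tmul_smul {M : Type*} [AddCommGroup M] [Module (Env k A) M] (b : Aᵐᵒᵖ) (z : M) :
    ((0 : A) ⊗ₜ[k] b : Env k A) • z = 0 := by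
  rw [TensorProduct.zero_tmul]; exact zero_smul (Env k A) z

theorem tmul_zero_smul {M : Type*} [AddCommGroup M] [Module (Env k A) M] (a : A) (z : M) :
    (a ⊗ₜ[k] (0 : Aᵐᵒᵖ) : Env k A) • z = 0 := by
  rw [TensorProduct.tmul_zero]; exact zero_smul (Env k A) z

/-- The derivation of `Aᵉ` induced by a derivation of `A`. -/
noncomputable def envDer (δ : A →ₗ[k] A) : Env k A →ₗ[k] Env k A :=
  δ.rTensor Aᵐᵒᵖ + ((MulOpposite.opLinearEquiv k).toLinearMap ∘ₗ δ ∘ₗ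
    (MulOpposite.opLinearEquiv k).symm.toLinearMap).lTensor A

/-- The endomorphism `a ⊗ w ⊗ b ↦ δ(a) ⊗ w ⊗ b + a ⊗ E(w) ⊗ b + a ⊗ w ⊗ δ(b)` of
`A ⊗ W ⊗ A`. -/
noncomputable def bimodDer (δ : A →ₗ[k] A) (E : W →ₗ[k] W) :
    FreeBimod k A W →ₗ[k] FreeBimod k A W :=
  ((envDer δ).rTensor W + E.lTensor (Env k A) : Env k A ⊗[k] W →ₗ[k] Env k A ⊗[k] W)

theorem bimodDer_smul_inner (δ : A →ₗ[k] A) (E : W →ₗ[k] W) (a b : A) (w : W) :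
    bimodDer δ E ((a ⊗ₜ[k] MulOpposite.op b : Env k A) • inner k A w) =
      (δ a ⊗ₜ[k] MulOpposite.op b : Env k A) • inner k A w +
      (a ⊗ₜ[k] MulOpposite.op (δ b) : Env k A) • inner k A w +
      (a ⊗ₜ[k] MulOpposite.op b : Env k A) • inner k A (E w) := by
  have h : ∀ (e : Env k A) (w : W), bimodDer δ E (e ⊗ₜ[k] w : Env k A ⊗[k] W) =
      (envDer δ e ⊗ₜ[k] w : Env k A ⊗[k] W) + (e ⊗ₜ[k] E w : Env k A ⊗[k] W) :=
    fun e w => rfl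
  rw [smul_inner, h, ← smul_inner, ← smul_inner, ← add_smul]
  rfl

theorem bimodDer_smul (δ : A →ₗ[k] A) (hδ : ∀ r s : A, δ (r * s) = δ r * s + r * δ s)
    (E : W →ₗ[k] W) (a b : A) (z : FreeBimod k A W) :
    bimodDer δ E ((a ⊗ₜ[k] MulOpposite.op b : Env k A) • z) =
      (δ a ⊗ₜ[k] MulOpposite.op b : Env k A) • z +
      (a ⊗ₜ[k] MulOpposite.op (δ b) : Env k A) • z +
      (a ⊗ₜ[k] MulOpposite.op b : Env k A) • bimodDer δ E z := by
  induction z using FreeBimod.induction with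
  | zero => simp
  | add x y hx hy => simp only [smul_add, map_add, hx, hy]; abel
  | smul_inner c d w =>
    simp only [tmul_op_smul_smul, bimodDer_smul_inner, hδ, TensorProduct.add_tmul,
      MulOpposite.op_add, TensorProduct.tmul_add, add_smul, smul_add]
    abel

theorem bimodDer_inner (δ : A →ₗ[k] A) (hδ : δ 1 = 0) (E : W →ₗ[k] W) (w : W) :
    bimodDer δ E (inner k A w) = inner k A (E w) := by
  have h := bimodDer_smul_inner δ E 1 1 w
  simpa only [hδ, MulOpposite.op_zero, zero_tmul_smul, tmul_zero_smul,
    zero_add, one_tmul_op_one_smul] using h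

/-- This is the Leibniz rule for the two-sided action, written as equivariance of the structure map
so that `twist_natural` applies to it. -/
theorem bimodAct_bimodDer (δ : A →ₗ[k] A) (hδ : ∀ r s : A, δ (r * s) = δ r * s + r * δ s)
    (E : W →ₗ[k] W) :
    bimodAct k A (FreeBimod k A W) ∘ₗ (δ.rTensor (FreeBimod k A W ⊗[k] A) +
      ((bimodDer δ E).rTensor A + δ.lTensor (FreeBimod k A W)).lTensor A) =
      bimodDer δ E ∘ₗ bimodAct k A (FreeBimod k A W) := by
  refine TensorProduct.ext' fun a x => ?_
  induction x with
  | zero => simp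
  | add x y hx hy => simp only [TensorProduct.tmul_add, map_add, hx, hy]
  | tmul z b =>
    simp only [LinearMap.comp_apply, LinearMap.add_apply, LinearMap.rTensor_tmul, map_add,
      LinearMap.lTensor_tmul, TensorProduct.tmul_add, bimodAct_tmul, bimodDer_smul δ hδ]
    abel

/-- A free bimodule is compatible with the twisting map of a derivation. -/
theorem isCompatibleLeft_twist (δ : A →ₗ[k] A)
    (hδ : ∀ r s : A, δ (r * s) = δ r * s + r * δ s) (E : W →ₗ[k] W) :
    IsCompatibleLeft (M := FreeBimod k A W) (twist δ) (twist (bimodDer δ E)) where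
  bijective := twist_bijective _
  mul := twist_comp_mul _
  act := by
    -- Twisting is natural along ρ, and the twisting past A ⊗ M ⊗ A splits into three successive
    -- crossings.
    rw [twist_natural _ (bimodAct_bimodDer δ hδ E), twist_lTensor_tensor, twist_lTensor_tensor]
    simp only [LinearMap.lTensor_comp, LinearMap.comp_assoc]

/-- The map `1 ⊗ f ⊗ 1` of free bimodules. -/
noncomputable def FreeBimod.mapInner (k : Type u) [Field k] (A : Type v) [Ring A] [Algebra k A]
    {W W' : Type*} [AddCommGroup W] [Module k W] [AddCommGroup W'] [Module k W'] (f : W →ₗ[k] W') :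
    FreeBimod k A W →ₗ[Env k A] FreeBimod k A W' :=
  (f.baseChange (Env k A) : Env k A ⊗[k] W →ₗ[Env k A] Env k A ⊗[k] W')

theorem FreeBimod.mapInner_inner (f : W →ₗ[k] W') (w : W) :
    FreeBimod.mapInner k A f (inner k A w) = inner k A (f w) := rfl

end FreeBimodMaps

/-! ### Free bimodules over k[X] and compatibility on the right -/

section PolyBimod

variable {k : Type u} [Field k] {A : Type v} [Ring A] [Algebra k A]
  {W : Type*} [AddCommGroup W] [Module k W]

/-- The elements 1 ⊗ w ⊗ 1 generate the bimodule under the left and right actions of X alone. The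
twisting `rtwist` is only ever computed through these two actions. -/
theorem polyBimod_induction {P : FreeBimod k (Poly k) W → Prop} (z : FreeBimod k (Poly k) W)
    (zero : P 0) (add : ∀ x y, P x → P y → P (x + y)) (smul : ∀ (c : k) x, P x → P (c • x))
    (inner : ∀ w, P (inner k (Poly k) w))
    (left : ∀ z, P z → P (((Polynomial.X : Poly k) ⊗ₜ[k] MulOpposite.op (1 : Poly k) :
      Env k (Poly k)) • z))
    (right : ∀ z, P z → P (((1 : Poly k) ⊗ₜ[k] MulOpposite.op (Polynomial.X : Poly k) :
      Env k (Poly k)) • z)) : P z := by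
  have hs : ∀ (c : k) (e : Env k (Poly k)) (x : FreeBimod k (Poly k) W),
      (c • e) • x = c • (e • x) := fun c e x => smul_assoc c e x
  induction z using FreeBimod.induction with
  | zero => exact zero
  | add x y hx hy => exact add x y hx hy
  | smul_inner p q w =>
    induction p using poly_induction with
    | add p p' hp hp' => rw [TensorProduct.add_tmul, add_smul]; exact add _ _ hp hp'
    | smul c p hp => rw [← TensorProduct.smul_tmul', hs]; exact smul _ _ hp
    | X_mul p hp =>
      have := left _ hp
      rwa [tmul_op_smul_smul, mul_one] at this
    | one =>
      induction q using poly_induction with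
      | add p p' hp hp' =>
        rw [MulOpposite.op_add, TensorProduct.tmul_add, add_smul]; exact add _ _ hp hp'
      | smul c p hp =>
        rw [MulOpposite.op_smul, TensorProduct.tmul_smul, hs]; exact smul _ _ hp
      | X_mul p hp =>
        have := right _ hp
        rwa [tmul_op_smul_smul, mul_one, mul_comm] at this
      | one =>
        rw [one_tmul_op_one_smul]
        exact inner w

variable {N : Type*} [AddCommGroup N] [Module k N] [Module (Env k (Poly k)) N]
  [IsScalarTower k (Env k (Poly k)) N]

/-- The left action of `X` on a `k[X]`-bimodule. -/
noncomputable abbrev leftX (k : Type u) [Field k] (N : Type*) [AddCommGroup N] [Module k N]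
    [Module (Env k (Poly k)) N] [IsScalarTower k (Env k (Poly k)) N] : N →ₗ[k] N :=
  sandwich k (Polynomial.X : Poly k) 1

/-- The right action of `X` on a `k[X]`-bimodule. -/
noncomputable abbrev rightX (k : Type u) [Field k] (N : Type*) [AddCommGroup N] [Module k N]
    [Module (Env k (Poly k)) N] [IsScalarTower k (Env k (Poly k)) N] : N →ₗ[k] N :=
  sandwich k 1 (Polynomial.X : Poly k)

theorem leftX_rightX (n : N) : leftX k N (rightX k N n) = rightX k N (leftX k N n) := by
  simp only [sandwich_apply, tmul_op_smul_smul, one_mul, mul_one]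

/-- `1 ⊗ f + δ ⊗ 1` on `A ⊗ N`. -/
noncomputable def shiftBy (δ : A →ₗ[k] A) (f : N →ₗ[k] N) : Module.End k (A ⊗[k] N) :=
  f.lTensor A + δ.rTensor N

omit [Module (Env k (Poly k)) N] [IsScalarTower k (Env k (Poly k)) N] in
@[simp]
theorem shiftBy_tmul (δ : A →ₗ[k] A) (f : N →ₗ[k] N) (a : A) (n : N) :
    shiftBy δ f (a ⊗ₜ n) = a ⊗ₜ f n + δ a ⊗ₜ n := rfl

/-- The two actions of X on N commute and δ touches only the factor A. Commutativity is what allows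
the enveloping algebra of k[X] to act on A ⊗ N through these two operators. -/
theorem commute_shiftBy (δ : A →ₗ[k] A) :
    Commute (shiftBy δ (leftX k N)) (shiftBy δ (rightX k N)) := by
  refine TensorProduct.ext' fun a n => ?_
  simp only [Module.End.mul_apply, shiftBy_tmul, map_add, leftX_rightX]
  abel

theorem commute_aeval {R : Type*} [Semiring R] [Algebra k R] {x y : R} (h : Commute x y)
    (p : Poly k) : Commute (Polynomial.aeval x p) y := by
  induction p using poly_induction with
  | add p p' hp hp' => rw [map_add]; exact hp.add_left hp'
  | smul c p hp => rw [map_smul]; exact hp.smul_left c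
  | one => rw [map_one]; exact Commute.one_left _
  | X_mul p hp => rw [map_mul, Polynomial.aeval_X]; exact h.mul_left hp

theorem commute_aeval_aeval {R : Type*} [Semiring R] [Algebra k R] {x y : R} (h : Commute x y)
    (p q : Poly k) : Commute (Polynomial.aeval x p) (Polynomial.aeval y q) :=
  (commute_aeval (commute_aeval h p).symm q).symm

/-- The action of `k[X]ᵉ` on `Z` determined by two commuting endomorphisms. -/
noncomputable def envPolyAct {R : Type*} [Semiring R] [Algebra k R] {x y : R} (h : Commute x y) :
    Env k (Poly k) →ₐ[k] R :=
  Algebra.TensorProduct.lift (Polynomial.aeval x)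
    ((Polynomial.aeval y).comp (AlgEquiv.toOpposite k (Poly k)).symm.toAlgHom)
    (fun p q => commute_aeval_aeval h p q.unop)

theorem envPolyAct_tmul {R : Type*} [Semiring R] [Algebra k R] {x y : R} (h : Commute x y)
    (p q : Poly k) : envPolyAct h (p ⊗ₜ[k] MulOpposite.op q) =
      Polynomial.aeval x p * Polynomial.aeval y q := rfl

theorem envPolyAct_left {R : Type*} [Semiring R] [Algebra k R] {x y : R} (h : Commute x y) :
    envPolyAct h ((Polynomial.X : Poly k) ⊗ₜ[k] MulOpposite.op (1 : Poly k)) = x := by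
  rw [envPolyAct_tmul]
  simp

theorem envPolyAct_right {R : Type*} [Semiring R] [Algebra k R] {x y : R} (h : Commute x y) :
    envPolyAct h ((1 : Poly k) ⊗ₜ[k] MulOpposite.op (Polynomial.X : Poly k)) = y := by
  rw [envPolyAct_tmul]
  simp

/-- The action of `k[X]ᵉ` on `A ⊗ N` in which `X ⊗ 1` and `1 ⊗ X` act by the actions on `N`
shifted by `δ`. -/
noncomputable def rtwistAct (δ : A →ₗ[k] A) (N : Type*) [AddCommGroup N] [Module k N]
    [Module (Env k (Poly k)) N] [IsScalarTower k (Env k (Poly k)) N] :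
    Env k (Poly k) →ₐ[k] Module.End k (A ⊗[k] N) :=
  envPolyAct (commute_shiftBy δ)

/-- The twisting `N ⊗ A → A ⊗ N` of a free `k[X]`-bimodule. -/
noncomputable def rtwist (δ : A →ₗ[k] A) :
    FreeBimod k (Poly k) W ⊗[k] A →ₗ[k] A ⊗[k] FreeBimod k (Poly k) W :=
  TensorProduct.lift ((TensorProduct.lift (LinearMap.mk₂ k
    (fun (e : Env k (Poly k)) (w : W) => (rtwistAct δ (FreeBimod k (Poly k) W) e) ∘ₗ
      (TensorProduct.mk k A (FreeBimod k (Poly k) W)).flip (innerₗ k (Poly k) W w))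
    (by intro x y w; ext; simp) (by intro c x w; ext; simp)
    (by intro x y w; rw [map_add]; ext; simp)
    (by intro c x w; rw [map_smul]; ext; simp)) : Env k (Poly k) ⊗[k] W →ₗ[k] _))

theorem rtwist_smul_inner (δ : A →ₗ[k] A) (e : Env k (Poly k)) (w : W) (a : A) :
    rtwist δ ((e • inner k (Poly k) w) ⊗ₜ a) =
      rtwistAct δ (FreeBimod k (Poly k) W) e (a ⊗ₜ inner k (Poly k) w) := by
  rw [smul_inner]; rfl

@[simp]
theorem rtwist_inner (δ : A →ₗ[k] A) (w : W) (a : A) :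
    rtwist δ (inner k (Poly k) w ⊗ₜ a) = a ⊗ₜ inner k (Poly k) w := by
  rw [← one_smul (Env k (Poly k)) (inner k (Poly k) w), rtwist_smul_inner]
  simp

/-- By construction a free generator crosses `a` unchanged and a coefficient acts afterwards by
`rtwistAct`. As `rtwistAct` is multiplicative, the twisting is equivariant on the whole bimodule. -/
theorem rtwist_smul (δ : A →ₗ[k] A) (e : Env k (Poly k)) (n : FreeBimod k (Poly k) W) (a : A) :
    rtwist δ ((e • n) ⊗ₜ a) = rtwistAct δ (FreeBimod k (Poly k) W) e (rtwist δ (n ⊗ₜ a)) := by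
  induction n using FreeBimod.induction with
  | zero => simp
  | add x y hx hy => simp only [smul_add, TensorProduct.add_tmul, map_add, hx, hy]
  | smul_inner p q w => rw [smul_smul, rtwist_smul_inner, rtwist_smul_inner, map_mul]; rfl

theorem rtwist_left (δ : A →ₗ[k] A) (n : FreeBimod k (Poly k) W) (a : A) :
    rtwist δ (leftX k _ n ⊗ₜ a) = shiftBy δ (leftX k _) (rtwist δ (n ⊗ₜ a)) := by
  rw [sandwich_apply, rtwist_smul]
  rw [rtwistAct, envPolyAct_left]

theorem rtwist_right (δ : A →ₗ[k] A) (n : FreeBimod k (Poly k) W) (a : A) :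
    rtwist δ (rightX k _ n ⊗ₜ a) = shiftBy δ (rightX k _) (rtwist δ (n ⊗ₜ a)) := by
  rw [sandwich_apply, rtwist_smul]
  rw [rtwistAct, envPolyAct_right]

/-- δ ⊗ 1 commutes with both shifted actions of X, so δ may be applied before or after the crossing.
-/
theorem rtwist_lTensor (δ : A →ₗ[k] A) (n : FreeBimod k (Poly k) W) (a : A) :
    rtwist δ (n ⊗ₜ δ a) = δ.rTensor (FreeBimod k (Poly k) W) (rtwist δ (n ⊗ₜ a)) := by
  have h : ∀ (f : FreeBimod k (Poly k) W →ₗ[k] FreeBimod k (Poly k) W) z,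
      δ.rTensor (FreeBimod k (Poly k) W) (shiftBy δ f z) =
      shiftBy δ f (δ.rTensor (FreeBimod k (Poly k) W) z) := by
    intro f z
    induction z with
    | zero => simp
    | add x y hx hy => simp only [map_add, hx, hy]
    | tmul a n => simp
  induction n using polyBimod_induction with
  | zero => simp
  | add x y hx hy => simp only [TensorProduct.add_tmul, map_add, hx, hy]
  | smul c x hx => simp only [← TensorProduct.smul_tmul', map_smul, hx]
  | inner w => simp
  | left z hz =>
    rw [← sandwich_apply, rtwist_left, rtwist_left, hz, h]
  | right z hz =>
    rw [← sandwich_apply, rtwist_right, rtwist_right, hz, h]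

/-- As for `twist_neg_twist`: under each action of X the contributions δ and -δ cancel, because the
twisting by -δ commutes with δ. -/
theorem rtwist_neg_rtwist (δ : A →ₗ[k] A) (n : FreeBimod k (Poly k) W) (a : A) :
    rtwist (-δ) (TensorProduct.comm k A (FreeBimod k (Poly k) W) (rtwist δ (n ⊗ₜ a))) =
      a ⊗ₜ n := by
  have key : ∀ (f : FreeBimod k (Poly k) W →ₗ[k] FreeBimod k (Poly k) W)
      (hf : ∀ (n : FreeBimod k (Poly k) W) (a : A),
        rtwist (-δ) (f n ⊗ₜ a) = shiftBy (-δ) f (rtwist (-δ) (n ⊗ₜ a)))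
      (z : A ⊗[k] FreeBimod k (Poly k) W),
      rtwist (-δ) (TensorProduct.comm k A (FreeBimod k (Poly k) W) (shiftBy δ f z)) =
        f.lTensor A (rtwist (-δ) (TensorProduct.comm k A (FreeBimod k (Poly k) W) z)) := by
    intro f hf z
    induction z with
    | zero => simp
    | add x y hx hy => simp only [map_add, hx, hy]
    | tmul a n =>
      have h1 := rtwist_lTensor (-δ) n a
      rw [LinearMap.neg_apply, TensorProduct.tmul_neg, map_neg, LinearMap.rTensor_neg,
        LinearMap.neg_apply, neg_inj] at h1
      simp only [shiftBy_tmul, map_add, TensorProduct.comm_tmul, hf, h1]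
      rw [shiftBy, LinearMap.rTensor_neg, LinearMap.add_apply, LinearMap.neg_apply,
        neg_add_cancel_right]
  induction n using polyBimod_induction with
  | zero => simp
  | add x y hx hy => simp only [TensorProduct.add_tmul, map_add, hx, hy, TensorProduct.tmul_add]
  | smul c x hx =>
    simp only [← TensorProduct.smul_tmul', map_smul, hx, TensorProduct.tmul_smul]
  | inner w => simp
  | left z hz =>
    rw [← sandwich_apply, rtwist_left, key _ (rtwist_left (-δ)), hz, LinearMap.lTensor_tmul]
  | right z hz =>
    rw [← sandwich_apply, rtwist_right, key _ (rtwist_right (-δ)), hz, LinearMap.lTensor_tmul]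

theorem rtwist_bijective (δ : A →ₗ[k] A) : Function.Bijective (rtwist (W := W) δ) := by
  refine ⟨Function.LeftInverse.injective (g := fun z => (TensorProduct.comm k A
    (FreeBimod k (Poly k) W)) (rtwist (-δ) (TensorProduct.comm k A _ z))) fun z => ?_,
    Function.RightInverse.surjective (g := fun z => (TensorProduct.comm k A
    (FreeBimod k (Poly k) W)) (rtwist (-δ) (TensorProduct.comm k A _ z))) fun z => ?_⟩
  · induction z with
    | zero => simp
    | add x y hx hy => simp only [map_add, hx, hy]
    | tmul n a => simp only [rtwist_neg_rtwist, TensorProduct.comm_tmul]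
  · induction z with
    | zero => simp
    | add x y hx hy => simp only [map_add, hx, hy]
    | tmul a n =>
      have h := rtwist_neg_rtwist (-δ) n a
      rw [neg_neg] at h
      simp only [TensorProduct.comm_tmul, h]

/-- A generator crosses ab, or a and then b, unchanged. For the inductive step both sides obey the
same recursion under X from either side, the two occurrences of δ being collected by the Leibniz
rule. -/
theorem rtwist_mul (δ : A →ₗ[k] A) (hδ : ∀ r s : A, δ (r * s) = δ r * s + r * δ s) :
    rtwist (W := W) δ ∘ₗ (LinearMap.mul' k A).lTensor _ =
      (LinearMap.mul' k A).rTensor _ ∘ₗ (TensorProduct.assoc k A A _).symm.toLinearMap ∘ₗ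
      (rtwist δ).lTensor A ∘ₗ onLeft (rtwist δ) := by
  have key : ∀ (f : FreeBimod k (Poly k) W →ₗ[k] FreeBimod k (Poly k) W)
      (hf : ∀ (n : FreeBimod k (Poly k) W) (a : A),
        rtwist δ (f n ⊗ₜ a) = shiftBy δ f (rtwist δ (n ⊗ₜ a)))
      (z : A ⊗[k] FreeBimod k (Poly k) W) (b : A),
      (LinearMap.mul' k A).rTensor _ ((TensorProduct.assoc k A A _).symm
        ((rtwist δ).lTensor A (TensorProduct.assoc k A _ A (shiftBy δ f z ⊗ₜ b)))) =
      shiftBy δ f ((LinearMap.mul' k A).rTensor _ ((TensorProduct.assoc k A A _).symm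
        ((rtwist δ).lTensor A (TensorProduct.assoc k A _ A (z ⊗ₜ b))))) := by
    intro f hf z b
    induction z with
    | zero => simp
    | add x y hx hy => simp only [map_add, TensorProduct.add_tmul, hx, hy]
    | tmul a n =>
      simp only [shiftBy_tmul, TensorProduct.add_tmul, TensorProduct.assoc_tmul, map_add,
        LinearMap.lTensor_tmul, hf]
      generalize rtwist δ (n ⊗ₜ b) = z
      induction z with
      | zero => simp
      | add x y hx hy =>
        simp only [map_add, TensorProduct.tmul_add] at hx hy ⊢
        rw [← hx, ← hy]; abel
      | tmul b n =>
        simp [TensorProduct.tmul_add, hδ, TensorProduct.add_tmul]; abel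
  refine TensorProduct.ext' fun n x => ?_
  induction x with
  | zero => simp
  | add x y hx hy => simp only [TensorProduct.tmul_add, map_add, hx, hy]
  | tmul a b =>
    simp only [LinearMap.comp_apply, LinearMap.lTensor_tmul, LinearMap.mul'_apply, onLeft,
      LinearEquiv.coe_coe, TensorProduct.assoc_symm_tmul, LinearMap.rTensor_tmul]
    induction n using polyBimod_induction with
    | zero => simp
    | add x y hx hy => simp only [TensorProduct.add_tmul, map_add, hx, hy]
    | smul c x hx => simp only [← TensorProduct.smul_tmul', map_smul, hx]
    | inner w => simp
    | left z hz => rw [← sandwich_apply, rtwist_left, rtwist_left, hz, key _ (rtwist_left δ)]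
    | right z hz => rw [← sandwich_apply, rtwist_right, rtwist_right, hz, key _ (rtwist_right δ)]

/-- The recursion in the left polynomial for the right-hand side of the compatibility with ρ. It
agrees with the recursion of `rtwist` under the left action of X. -/
theorem bimodAct_twist_X_mul (δ : A →ₗ[k] A) (p : Poly k)
    (y : A ⊗[k] (FreeBimod k (Poly k) W ⊗[k] Poly k)) :
    (bimodAct k (Poly k) (FreeBimod k (Poly k) W)).lTensor A
      (onLeft (twist δ) ((Polynomial.X * p) ⊗ₜ y)) =
    shiftBy δ (leftX k _) ((bimodAct k (Poly k) (FreeBimod k (Poly k) W)).lTensor A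
      (onLeft (twist δ) (p ⊗ₜ y))) := by
  induction y with
  | zero => simp
  | add x y hx hy => simp only [TensorProduct.tmul_add, map_add, hx, hy]
  | tmul a y =>
    simp only [onLeft, LinearMap.comp_apply, LinearEquiv.coe_coe, TensorProduct.assoc_symm_tmul,
      LinearMap.rTensor_tmul, twist_X_mul]
    generalize twist δ (p ⊗ₜ a) = z
    induction z with
    | zero => simp
    | add x y hx hy => simp only [TensorProduct.add_tmul, map_add, hx, hy]
    | tmul a p =>
      simp only [shift_tmul, TensorProduct.add_tmul, map_add, TensorProduct.assoc_tmul,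
        LinearMap.lTensor_tmul, shiftBy_tmul]
      rw [add_comm]
      congr 2
      induction y with
      | zero => simp
      | add x y hx hy => simp only [TensorProduct.tmul_add, map_add, hx, hy]
      | tmul n q =>
        simp only [bimodAct_tmul, sandwich_apply, tmul_op_smul_smul, mul_one]

theorem bimodAct_twist_one (δ : A →ₗ[k] A) (a : A) (n : FreeBimod k (Poly k) W) (q : Poly k) :
    (bimodAct k (Poly k) (FreeBimod k (Poly k) W)).lTensor A
      (onLeft (twist δ) (1 ⊗ₜ (a ⊗ₜ (n ⊗ₜ q)))) = a ⊗ₜ sandwich k 1 q n := by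
  simp only [onLeft, LinearMap.comp_apply, LinearEquiv.coe_coe, TensorProduct.assoc_symm_tmul,
    LinearMap.rTensor_tmul, twist_one, TensorProduct.assoc_tmul, LinearMap.lTensor_tmul,
    bimodAct_tmul, sandwich_apply]

/-- The recursion in the right polynomial. When X on the right of n crosses a it leaves δ(a) behind,
and `rtwist_lTensor` carries this δ through the crossing of n. -/
theorem bimodAct_rtwist_shift (δ : A →ₗ[k] A) (n : FreeBimod k (Poly k) W) (z : A ⊗[k] Poly k) :
    (bimodAct k (Poly k) (FreeBimod k (Poly k) W)).lTensor A
      (onLeft (twist δ) (1 ⊗ₜ onLeft (rtwist δ) (n ⊗ₜ shift δ z))) =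
    shiftBy δ (rightX k _) ((bimodAct k (Poly k) (FreeBimod k (Poly k) W)).lTensor A
      (onLeft (twist δ) (1 ⊗ₜ onLeft (rtwist δ) (n ⊗ₜ z)))) := by
  induction z with
  | zero => simp
  | add x y hx hy => simp only [TensorProduct.tmul_add, map_add, hx, hy]
  | tmul a q =>
    have h : ∀ (a : A) (q : Poly k), onLeft (rtwist δ) (n ⊗ₜ[k] (a ⊗ₜ[k] q)) =
        TensorProduct.assoc k A (FreeBimod k (Poly k) W) (Poly k) (rtwist δ (n ⊗ₜ a) ⊗ₜ q) :=
      fun _ _ => rfl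
    simp only [shift_tmul, TensorProduct.tmul_add, map_add, h, rtwist_lTensor]
    generalize rtwist δ (n ⊗ₜ a) = z
    induction z with
    | zero => simp
    | add x y hx hy =>
      simp only [TensorProduct.add_tmul, TensorProduct.tmul_add, map_add] at hx hy ⊢
      rw [← hx, ← hy]; abel
    | tmul a n =>
      simp only [LinearMap.rTensor_tmul, TensorProduct.assoc_tmul, bimodAct_twist_one, shiftBy_tmul]
      rw [add_comm]
      simp only [sandwich_apply, tmul_op_smul_smul, mul_one, mul_comm]

/-- The condition for p · n · q is reduced to p = 1 and then to q = 1, removing one factor X at a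
time; the two preceding recursions match those of `rtwist`. -/
theorem isCompatibleRight_rtwist (δ : A →ₗ[k] A)
    (hδ : ∀ r s : A, δ (r * s) = δ r * s + r * δ s) :
    IsCompatibleRight (N := FreeBimod k (Poly k) W) (twist δ) (rtwist δ) where
  bijective := rtwist_bijective δ
  mul := rtwist_mul δ hδ
  act := by
    refine TensorProduct.ext' fun p x => ?_
    induction x with
    | zero => simp
    | add x y hx hy => simp only [TensorProduct.tmul_add, map_add, hx, hy]
    | tmul n y =>
    induction y with
    | zero => simp
    | add x y hx hy => simp only [TensorProduct.tmul_add, map_add, hx, hy]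
    | tmul q a =>
    simp only [LinearMap.comp_apply, LinearMap.lTensor_tmul,
      LinearEquiv.coe_coe, TensorProduct.assoc_symm_tmul, LinearMap.rTensor_tmul, bimodAct_tmul]
    rw [← sandwich_apply]
    induction p using poly_induction with
    | add p p' hp hp' =>
      simp only [sandwich_apply, TensorProduct.add_tmul, add_smul, map_add] at hp hp' ⊢
      rw [hp, hp']
    | smul c p hp =>
      rw [← TensorProduct.smul_tmul', map_smul, map_smul, ← hp, sandwich_smul_left,
        ← TensorProduct.smul_tmul', map_smul]
    | X_mul p hp =>
      rw [bimodAct_twist_X_mul, ← hp, ← rtwist_left]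
      simp only [sandwich_apply, tmul_op_smul_smul, mul_one]
    | one =>
      induction q using poly_induction with
      | add p p' hp hp' =>
        simp only [sandwich_apply, TensorProduct.add_tmul, TensorProduct.tmul_add, add_smul,
          map_add, MulOpposite.op_add] at hp hp' ⊢
        rw [hp, hp']
      | smul c p hp =>
        simp only [← TensorProduct.smul_tmul', map_smul, hp, TensorProduct.tmul_smul,
          sandwich_smul_right]
      | X_mul p hp =>
        rw [twist_X_mul, bimodAct_rtwist_shift, ← hp, ← rtwist_right]
        simp only [sandwich_apply, tmul_op_smul_smul, mul_one, mul_comm]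
      | one =>
        rw [twist_one, sandwich_apply, one_tmul_op_one_smul]
        simp only [onLeft, LinearMap.comp_apply, LinearEquiv.coe_coe,
          TensorProduct.assoc_symm_tmul, LinearMap.rTensor_tmul]
        generalize rtwist δ (n ⊗ₜ a) = z
        induction z with
        | zero => simp
        | add x y hx hy =>
          simp only [TensorProduct.add_tmul, TensorProduct.tmul_add, map_add] at hx hy ⊢
          rw [← hx, ← hy]
        | tmul a n =>
          have := bimodAct_twist_one δ a n 1
          simp only [onLeft, LinearMap.comp_apply, LinearEquiv.coe_coe, sandwich_apply,
            one_tmul_op_one_smul] at this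
          simp only [TensorProduct.assoc_tmul, this]

end PolyBimod

/-! ### The total derivation of a tensor power and the iterated twisting -/

section TotalDerivation

variable {k : Type u} [Field k] {A : Type v} [Ring A] [Algebra k A]

/-- The endomorphism `∑ 1 ⊗ ⋯ ⊗ δ ⊗ ⋯ ⊗ 1` of `A^{⊗n}`. -/
noncomputable def totalDer (δ : A →ₗ[k] A) (n : ℕ) : (⨂[k]^n A) →ₗ[k] ⨂[k]^n A :=
  ∑ i : Fin n, PiTensorProduct.map (Function.update (fun _ => LinearMap.id) i δ)

theorem totalDer_tprod (δ : A →ₗ[k] A) (n : ℕ) (a : Fin n → A) :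
    totalDer δ n (PiTensorProduct.tprod k a) =
      ∑ i : Fin n, PiTensorProduct.tprod k (Function.update a i (δ (a i))) := by
  rw [totalDer, LinearMap.sum_apply]
  refine Finset.sum_congr rfl fun i _ => ?_
  rw [PiTensorProduct.map_tprod]
  congr 1
  funext j
  by_cases h : j = i
  · subst h; simp
  · simp [h]

/-- The isomorphism `A^{⊗n} ⊗ A ≃ A^{⊗(n+1)}`. -/
noncomputable def snocEquiv (k : Type u) [Field k] (A : Type v) [Ring A] [Algebra k A] (n : ℕ) :
    (⨂[k]^n A) ⊗[k] A ≃ₗ[k] ⨂[k]^(n + 1) A :=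
  (PiTensorProduct.subsingletonEquiv (R := k) (s := fun _ : Fin 1 => A) 0).symm.lTensor
    (⨂[k]^n A) ≪≫ₗ TensorPower.mulEquiv

theorem snocEquiv_tprod (n : ℕ) (a : Fin n → A) (b : A) :
    snocEquiv k A n (PiTensorProduct.tprod k a ⊗ₜ b) =
      PiTensorProduct.tprod k (Fin.snoc a b : Fin (n + 1) → A) := by
  have h : (PiTensorProduct.subsingletonEquiv (R := k) (s := fun _ : Fin 1 => A) 0).symm b =
      PiTensorProduct.tprod k (fun _ => b) := by
    rw [LinearEquiv.symm_apply_eq]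
    exact (PiTensorProduct.subsingletonEquiv_apply_tprod (R := k) (s := fun _ : Fin 1 => A) 0
      (fun _ => b)).symm
  rw [snocEquiv, LinearEquiv.trans_apply, LinearEquiv.lTensor_tmul, h]
  refine (TensorPower.tprod_mul_tprod k a (fun _ : Fin 1 => b)).trans ?_
  rw [Fin.append_right_eq_snoc]

/-- The summand differentiating the last factor is split off. This is the inductive structure on
which `twistPow` is built. -/
theorem snocEquiv_der (δ : A →ₗ[k] A) (n : ℕ) :
    (snocEquiv k A n).toLinearMap ∘ₗ ((totalDer δ n).rTensor A + δ.lTensor (⨂[k]^n A)) =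
      totalDer δ (n + 1) ∘ₗ (snocEquiv k A n).toLinearMap := by
  refine TensorProduct.ext ?_
  refine PiTensorProduct.ext ?_
  refine MultilinearMap.ext fun a => LinearMap.ext fun b => ?_
  change snocEquiv k A n ((totalDer δ n).rTensor A (PiTensorProduct.tprod k a ⊗ₜ b) +
    δ.lTensor (⨂[k]^n A) (PiTensorProduct.tprod k a ⊗ₜ b)) =
    totalDer δ (n + 1) (snocEquiv k A n (PiTensorProduct.tprod k a ⊗ₜ b))
  rw [snocEquiv_tprod, totalDer_tprod, LinearMap.rTensor_tmul, LinearMap.lTensor_tmul,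
    totalDer_tprod, TensorProduct.sum_tmul, map_add, map_sum, snocEquiv_tprod,
    Fin.sum_univ_castSucc]
  congr 1
  · refine Finset.sum_congr rfl fun i _ => ?_
    rw [snocEquiv_tprod, Fin.snoc_update, Fin.snoc_castSucc]
  · rw [Fin.snoc_last, Fin.update_snoc_last]

/-- The iterated twisting of a derivation is the twisting of the total derivation. -/
theorem twistPow_twist (δ : A →ₗ[k] A) (n : ℕ) :
    twistPow (twist δ) n = twist (totalDer δ n) := by
  induction n with
  | zero =>
    have : totalDer δ 0 = 0 := by simp [totalDer]
    rw [this, twist_zero]; rfl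
  | succ n ih =>
    -- The twisting past A^{⊗n} ⊗ A splits into the one past A^{⊗n} and the one past A, which is the
    -- recursive definition of `twistPow`.
    have h1 := twist_natural (snocEquiv k A n).toLinearMap (snocEquiv_der δ n)
    rw [twist_lTensor_tensor, ← ih] at h1
    have h2 : twistPow (twist δ) (n + 1) = (snocEquiv k A n).toLinearMap.rTensor (Poly k) ∘ₗ
      (TensorProduct.assoc k (⨂[k]^n A) A (Poly k)).symm.toLinearMap ∘ₗ
      (twist δ).lTensor (⨂[k]^n A) ∘ₗ onLeft (twistPow (twist δ) n) ∘ₗ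
        (snocEquiv k A n).symm.toLinearMap.lTensor (Poly k) := rfl
    have h3 : (snocEquiv k A n).toLinearMap.lTensor (Poly k) ∘ₗ
        (snocEquiv k A n).symm.toLinearMap.lTensor (Poly k) = LinearMap.id := by
      rw [← LinearMap.lTensor_comp, LinearEquiv.comp_symm, LinearMap.lTensor_id]
    rw [h2]
    calc _ = ((snocEquiv k A n).toLinearMap.rTensor (Poly k) ∘ₗ
      (TensorProduct.assoc k (⨂[k]^n A) A (Poly k)).symm.toLinearMap ∘ₗ
      (twist δ).lTensor (⨂[k]^n A) ∘ₗ onLeft (twistPow (twist δ) n)) ∘ₗ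
        (snocEquiv k A n).symm.toLinearMap.lTensor (Poly k) := rfl
      _ = _ := by rw [← h1, LinearMap.comp_assoc, h3, LinearMap.comp_id]

end TotalDerivation

/-! ### Derivations acting on the reduced bar resolution -/

section BarDerivation

variable {k : Type u} [Field k] {A : Type v} [Ring A] [Algebra k A]

/-- Contracting two neighbours amounts to deleting the second and overwriting the first. In this
form the interaction of faces with changes of one entry is a computation with `Function.update`. -/
theorem contractNth_eq_update {n : ℕ} (i : Fin (n + 1)) (a : Fin (n + 2) → A) :
    i.castSucc.contractNth (· * ·) a =
      Function.update (fun j => a (i.succ.succAbove j)) i (a i.castSucc * a i.succ) := by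
  funext j
  rcases lt_trichotomy j i with h | h | h
  · rw [Fin.contractNth_apply_of_lt _ _ _ _ (by simpa using h), Function.update_of_ne h.ne,
      Fin.succAbove_of_castSucc_lt]
    exact Fin.castSucc_lt_succ_iff.2 h.le
  · subst h
    rw [Fin.contractNth_apply_of_eq _ _ _ _ (by simp), Function.update_self]
  · rw [Fin.contractNth_apply_of_gt _ _ _ _ (by simpa using h), Function.update_of_ne h.ne',
      Fin.succAbove_of_le_castSucc]
    exact Fin.succ_le_castSucc_iff.2 h

theorem succ_succAbove_self {n : ℕ} (i : Fin (n + 1)) : i.succ.succAbove i = i.castSucc :=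
  Fin.succAbove_of_castSucc_lt _ _ Fin.castSucc_lt_succ

theorem contractNth_update_succ {n : ℕ} (i : Fin (n + 1)) (a : Fin (n + 2) → A) (v : A) :
    i.castSucc.contractNth (· * ·) (Function.update a i.succ v) =
      Function.update (i.castSucc.contractNth (· * ·) a) i (a i.castSucc * v) := by
  rw [contractNth_eq_update, contractNth_eq_update, Function.update_idem]
  have h : i.castSucc ≠ i.succ := Fin.castSucc_lt_succ.ne
  rw [Function.update_self, Function.update_of_ne h]
  congr 1
  funext j
  rw [Function.update_of_ne (Fin.succAbove_ne _ _)]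

theorem contractNth_update_castSucc {n : ℕ} (i : Fin (n + 1)) (a : Fin (n + 2) → A) (v : A) :
    i.castSucc.contractNth (· * ·) (Function.update a i.castSucc v) =
      Function.update (i.castSucc.contractNth (· * ·) a) i (v * a i.succ) := by
  have h : i.succ ≠ i.castSucc := Fin.castSucc_lt_succ.ne'
  rw [contractNth_eq_update, contractNth_eq_update, Function.update_idem, Function.update_self,
    Function.update_of_ne h]
  funext j
  by_cases hj : j = i
  · subst hj; simp
  · rw [Function.update_of_ne hj, Function.update_of_ne hj, Function.update_of_ne]
    rw [← succ_succAbove_self]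
    exact fun h => hj (Fin.succAbove_right_injective h)

theorem contractNth_update_succAbove {n : ℕ} (i j : Fin (n + 1)) (hj : j ≠ i)
    (a : Fin (n + 2) → A) (v : A) :
    i.castSucc.contractNth (· * ·) (Function.update a (i.succ.succAbove j) v) =
      Function.update (i.castSucc.contractNth (· * ·) a) j v := by
  have h1 : i.succ ≠ i.succ.succAbove j := (Fin.succAbove_ne _ _).symm
  have h2 : i.castSucc ≠ i.succ.succAbove j := by
    rw [← succ_succAbove_self]
    exact fun h => hj (Fin.succAbove_right_injective h).symm
  rw [contractNth_eq_update, contractNth_eq_update, Function.update_of_ne h1,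
    Function.update_of_ne h2, Function.update_comm hj.symm]
  congr 1
  funext q
  by_cases hq : q = j
  · subst hq; simp
  · rw [Function.update_of_ne hq, Function.update_of_ne]
    exact fun h => hq (Fin.succAbove_right_injective h)

/-- A derivative of an entry not involved in the contraction passes through the face. The
derivatives of the two contracted entries add up, by the Leibniz rule, to the derivative of their
product. -/
theorem barFace_totalDer (δ : A →ₗ[k] A) (hδ : ∀ r s : A, δ (r * s) = δ r * s + r * δ s) (n : ℕ)
    (i : Fin (n + 1)) (z : ⨂[k]^(n + 2) A) :
    barFace k A n i (totalDer δ (n + 2) z) = totalDer δ (n + 1) (barFace k A n i z) := by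
  suffices h : barFace k A n i ∘ₗ totalDer δ (n + 2) = totalDer δ (n + 1) ∘ₗ barFace k A n i from
    LinearMap.congr_fun h z
  refine PiTensorProduct.ext (MultilinearMap.ext fun a => ?_)
  change barFace k A n i (totalDer δ (n + 2) (PiTensorProduct.tprod k a)) =
    totalDer δ (n + 1) (barFace k A n i (PiTensorProduct.tprod k a))
  rw [totalDer_tprod, barFace_tprod, totalDer_tprod, map_sum, Fin.sum_univ_succAbove _ i.succ,
    ← Finset.add_sum_erase _ _ (Finset.mem_univ i), ← add_assoc,
    ← Finset.add_sum_erase (a := i) _ _ (Finset.mem_univ i)]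
  congr 1
  · rw [succ_succAbove_self, barFace_tprod, barFace_tprod, contractNth_update_succ,
      contractNth_update_castSucc]
    have : i.castSucc.contractNth (· * ·) a i = a i.castSucc * a i.succ := by
      rw [contractNth_eq_update, Function.update_self]
    rw [this, hδ, MultilinearMap.map_update_add]
    exact add_comm _ _
  · refine Finset.sum_congr rfl fun j hj => ?_
    have hj' : j ≠ i := (Finset.mem_erase.1 hj).1
    rw [barFace_tprod, contractNth_update_succAbove i j hj']
    congr 2
    rw [contractNth_eq_update, Function.update_of_ne hj']

theorem barD_totalDer (δ : A →ₗ[k] A) (hδ : ∀ r s : A, δ (r * s) = δ r * s + r * δ s) (n : ℕ)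
    (z : Bar k A (n + 1)) :
    barD k A n (totalDer δ (n + 3) z) = totalDer δ (n + 2) (barD k A n z) := by
  simp only [barD, LinearMap.sum_apply, LinearMap.smul_apply, map_sum, map_smul]
  exact Finset.sum_congr rfl fun i _ => by rw [barFace_totalDer δ hδ]

/-- Differentiating the inner entry 1 gives zero, and differentiating any other entry leaves that 1
in place. -/
theorem totalDer_degenerate (δ : A →ₗ[k] A) (h1 : δ 1 = 0) (n : ℕ) :
    barDegenerate k A n ≤ (barDegenerate k A n).comap (totalDer δ (n + 2)) := by
  refine Submodule.span_le.2 ?_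
  rintro _ ⟨a, q, hq, rfl⟩
  change totalDer δ (n + 2) (PiTensorProduct.tprod k a) ∈ barDegenerate k A n
  rw [totalDer_tprod]
  refine Submodule.sum_mem _ fun i _ => ?_
  by_cases hi : i = q.succ.castSucc
  · rw [hi, hq, h1, MultilinearMap.map_update_zero]
    exact Submodule.zero_mem _
  · exact Submodule.subset_span ⟨_, q, by rw [Function.update_of_ne (Ne.symm hi), hq], rfl⟩

/-- The total derivation of the reduced bar resolution. -/
noncomputable def rbarDer (δ : A →ₗ[k] A) (h1 : δ 1 = 0) (n : ℕ) : RBar k A n →ₗ[k] RBar k A n :=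
  (barDegenerate k A n).mapQ (barDegenerate k A n) (totalDer δ (n + 2)) (totalDer_degenerate δ h1 n)

theorem rbarDer_toRBar (δ : A →ₗ[k] A) (h1 : δ 1 = 0) (n : ℕ) (z : Bar k A n) :
    rbarDer δ h1 n (toRBar k A n z) = toRBar k A n (totalDer δ (n + 2) z) := rfl

theorem rbarD_rbarDer (δ : A →ₗ[k] A) (h1 : δ 1 = 0)
    (hδ : ∀ r s : A, δ (r * s) = δ r * s + r * δ s) (n : ℕ) (z : RBar k A (n + 1)) :
    rbarD k A n (rbarDer δ h1 (n + 1) z) = rbarDer δ h1 n (rbarD k A n z) := by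
  obtain ⟨z, rfl⟩ := Submodule.mkQ_surjective _ z
  exact congrArg (toRBar k A n) (barD_totalDer δ hδ n z)

end BarDerivation

/-! ### Permutations with one prescribed value -/

section InsertPerm

/-- The permutation `σ` with `σ p = j` and `σ ∘ p.succAbove = j.succAbove ∘ τ`. -/
def insertPerm {n : ℕ} (p j : Fin (n + 1)) (τ : Equiv.Perm (Fin n)) : Equiv.Perm (Fin (n + 1)) :=
  (Fin.cycleRange j)⁻¹ * Equiv.Perm.decomposeFin.symm (0, τ) * Fin.cycleRange p

theorem insertPerm_self {n : ℕ} (p j : Fin (n + 1)) (τ : Equiv.Perm (Fin n)) :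
    insertPerm p j τ p = j := by
  simp [insertPerm, Equiv.Perm.inv_def]

theorem insertPerm_succAbove {n : ℕ} (p j : Fin (n + 1)) (τ : Equiv.Perm (Fin n)) (q : Fin n) :
    insertPerm p j τ (p.succAbove q) = j.succAbove (τ q) := by
  simp [insertPerm, Equiv.Perm.inv_def]

theorem sign_insertPerm {n : ℕ} (p j : Fin (n + 1)) (τ : Equiv.Perm (Fin n)) :
    Equiv.Perm.sign (insertPerm p j τ) =
      (-1) ^ (p : ℕ) * (-1) ^ (j : ℕ) * Equiv.Perm.sign τ := by
  rw [insertPerm, Equiv.Perm.sign_mul, Equiv.Perm.sign_mul, Equiv.Perm.sign_inv,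
    Fin.sign_cycleRange, Fin.sign_cycleRange, Equiv.Perm.decomposeFin.symm_sign]
  simp only [if_true, one_mul]
  rw [mul_comm, mul_assoc]

/-- A permutation is determined by its value j at p and the permutation induced on the remaining
points. Injectivity of this parametrization suffices, since (n + 1) · n! = (n + 1)!. -/
theorem sum_insertPerm {n : ℕ} {M : Type*} [AddCommMonoid M] (p : Fin (n + 1))
    (F : Equiv.Perm (Fin (n + 1)) → M) :
    ∑ σ, F σ = ∑ j, ∑ τ : Equiv.Perm (Fin n), F (insertPerm p j τ) := by
  rw [← Fintype.sum_prod_type']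
  refine (Fintype.sum_bijective (fun q : Fin (n + 1) × Equiv.Perm (Fin n) => insertPerm p q.1 q.2)
    ?_ _ _ fun q => rfl).symm
  rw [Fintype.bijective_iff_injective_and_card]
  refine ⟨?_, by simp [Fintype.card_perm, Nat.factorial_succ]⟩
  rintro ⟨j, τ⟩ ⟨j', τ'⟩ h
  dsimp only at h
  have hj : j = j' := by rw [← insertPerm_self p j τ, h, insertPerm_self]
  subst hj
  refine Prod.ext rfl (Equiv.ext fun q => ?_)
  have := insertPerm_succAbove p j τ q
  rw [h, insertPerm_succAbove] at this
  exact (Fin.succAbove_right_injective this).symm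

end InsertPerm

/-! ### Tensors with distinguished outer factors -/

section BarVec

variable {A : Type v}

/-- The vector `(a, y₁, …, y_n, b)`. -/
def barVec {n : ℕ} (a : A) (y : Fin n → A) (b : A) : Fin (n + 2) → A :=
  Fin.cons a (Fin.snoc y b : Fin (n + 1) → A)

theorem barVec_zero {n : ℕ} (a : A) (y : Fin n → A) (b : A) : barVec a y b 0 = a := rfl

theorem barVec_inner {n : ℕ} (a : A) (y : Fin n → A) (b : A) (i : Fin n) :
    barVec a y b i.succ.castSucc = y i := by
  rw [barVec, ← Fin.succ_castSucc, Fin.cons_succ, Fin.snoc_castSucc]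

theorem barVec_last {n : ℕ} (a : A) (y : Fin n → A) (b : A) :
    barVec a y b (Fin.last (n + 1)) = b := by
  rw [barVec, ← Fin.succ_last, Fin.cons_succ, Fin.snoc_last]

theorem barVec_update {n : ℕ} (a : A) (y : Fin n → A) (b : A) (i : Fin n) (v : A) :
    barVec a (Function.update y i v) b = Function.update (barVec a y b) i.succ.castSucc v := by
  rw [barVec, Fin.snoc_update, Fin.cons_update, Fin.succ_castSucc]; rfl

theorem update_barVec_zero {n : ℕ} (a a' : A) (y : Fin n → A) (b : A) :
    Function.update (barVec a y b) 0 a' = barVec a' y b := by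
  rw [barVec, Fin.update_cons_zero]; rfl

theorem update_barVec_last {n : ℕ} (a : A) (y : Fin n → A) (b b' : A) :
    Function.update (barVec a y b) (Fin.last (n + 1)) b' = barVec a y b' := by
  rw [barVec, ← Fin.succ_last, ← Fin.cons_update, Fin.update_snoc_last]; rfl

theorem barVec_of_val {n : ℕ} (a : A) (y : Fin n → A) (b : A) (j : Fin (n + 2)) (i : Fin n)
    (h : (j : ℕ) = i + 1) : barVec a y b j = y i := by
  rw [← barVec_inner a y b i]
  congr 1
  exact Fin.ext (by simpa using h)

theorem eq_barVec {n : ℕ} {z : Fin (n + 2) → A} {a b : A} {y : Fin n → A} (h0 : z 0 = a)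
    (h : ∀ i : Fin n, z i.succ.castSucc = y i) (hl : z (Fin.last (n + 1)) = b) :
    z = barVec a y b := by
  funext j
  induction j using Fin.lastCases with
  | last => rw [hl, barVec_last]
  | cast j =>
    induction j using Fin.cases with
    | zero => exact h0
    | succ j => rw [h, barVec_inner]

end BarVec

/-! ### The symmetrization map and its bar differential -/

section Symmetrization

variable {k : Type u} [Field k] {A : Type v} [Ring A] [Algebra k A]

/-- The multilinear map `(y₁, …, y_n) ↦ a ⊗ y₁ ⊗ ⋯ ⊗ y_n ⊗ b`. -/
noncomputable def barInner (k : Type u) [Field k] {A : Type v} [Ring A] [Algebra k A]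
    (n : ℕ) (a b : A) : MultilinearMap k (fun _ : Fin n => A) (Bar k A n) where
  toFun y := PiTensorProduct.tprod k (barVec a y b)
  map_update_add' y i v w := by
    have : ∀ v, barVec a (Function.update y i v) b =
        Function.update (barVec a y b) i.succ.castSucc v := by
      intro v; rw [← barVec_update]; congr!
    rw [this, this, this, MultilinearMap.map_update_add]
  map_update_smul' y i c v := by
    have : ∀ v, barVec a (Function.update y i v) b =
        Function.update (barVec a y b) i.succ.castSucc v := by
      intro v; rw [← barVec_update]; congr!
    rw [this, this, MultilinearMap.map_update_smul]

theorem barInner_apply (n : ℕ) (a b : A) (y : Fin n → A) :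
    barInner k n a b y = PiTensorProduct.tprod k (barVec a y b) := rfl

theorem barInner_add_left (n : ℕ) (a a' b : A) :
    barInner k n (a + a') b = barInner k n a b + barInner k n a' b := by
  ext y
  simp only [add_apply, barInner_apply]
  rw [← update_barVec_zero a, MultilinearMap.map_update_add]
  simp only [update_barVec_zero]

theorem barInner_smul_left (n : ℕ) (c : k) (a b : A) :
    barInner k n (c • a) b = c • barInner k n a b := by
  ext y
  simp only [smul_apply, barInner_apply]
  rw [← update_barVec_zero a, MultilinearMap.map_update_smul]
  simp only [update_barVec_zero]

theorem barInner_add_right (n : ℕ) (a b b' : A) :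
    barInner k n a (b + b') = barInner k n a b + barInner k n a b' := by
  ext y
  simp only [add_apply, barInner_apply]
  rw [← update_barVec_last a y b, MultilinearMap.map_update_add]
  simp only [update_barVec_last]

theorem barInner_smul_right (n : ℕ) (c : k) (a b : A) :
    barInner k n a (c • b) = c • barInner k n a b := by
  ext y
  simp only [smul_apply, barInner_apply]
  rw [← update_barVec_last a y b, MultilinearMap.map_update_smul]
  simp only [update_barVec_last]

variable {m : ℕ}

/-- The alternating map `v ↦ ∑_σ sgn(σ) a ⊗ v_{σ(1)} ⊗ ⋯ ⊗ v_{σ(n)} ⊗ b`. -/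
noncomputable def symmAlt (x : Fin m → A) (n : ℕ) (a b : A) :
    (Fin m → k) [⋀^Fin n]→ₗ[k] Bar k A n :=
  MultilinearMap.alternatization
    ((barInner k n a b).compLinearMap fun _ => Fintype.linearCombination k x)

theorem symmAlt_apply (x : Fin m → A) (n : ℕ) (a b : A) (v : Fin n → Fin m → k) :
    symmAlt x n a b v = ∑ σ : Equiv.Perm (Fin n), ((Equiv.Perm.sign σ : ℤ) : k) •
      barInner k n a b (fun p => Fintype.linearCombination k x (v (σ p))) := by
  rw [symmAlt, MultilinearMap.alternatization_apply]
  refine Finset.sum_congr rfl fun σ _ => ?_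
  rw [Int.cast_smul_eq_zsmul]
  rfl

/-- The symmetrization map `A ⊗ ⋀ⁿ V ⊗ A → A^{⊗(n+2)}`. -/
noncomputable def symmetrize (x : Fin m → A) (n : ℕ) : Kos k A m n →ₗ[k] Bar k A n :=
  (TensorProduct.lift (TensorProduct.lift (LinearMap.mk₂ k
    (fun (a : A) (b : Aᵐᵒᵖ) => exteriorPower.alternatingMapLinearEquiv (symmAlt x n a b.unop))
    (by
      intro a a' b; rw [← map_add]; congr 1; ext v
      simp [symmAlt_apply, barInner_add_left, Finset.sum_add_distrib])
    (by
      intro c a b; rw [← map_smul]; congr 1; ext v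
      simp only [symmAlt_apply, barInner_smul_left, AlternatingMap.smul_apply,
        smul_apply, Finset.smul_sum]
      exact Finset.sum_congr rfl fun _ _ => smul_comm _ _ _)
    (by
      intro a b b'; rw [← map_add]; congr 1; ext v
      simp [symmAlt_apply, barInner_add_right, Finset.sum_add_distrib])
    (by
      intro c a b; rw [← map_smul]; congr 1; ext v
      simp only [symmAlt_apply, barInner_smul_right, AlternatingMap.smul_apply,
        smul_apply, Finset.smul_sum, MulOpposite.unop_smul]
      exact Finset.sum_congr rfl fun _ _ => smul_comm _ _ _))) :
    Env k A ⊗[k] (⋀[k]^n (Fin m → k)) →ₗ[k] Bar k A n)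

theorem symmetrize_wedge (x : Fin m → A) (n : ℕ) (a b : A) (v : Fin n → Fin m → k) :
    symmetrize x n ((a ⊗ₜ[k] MulOpposite.op b : Env k A) • wedge k A v) =
      ∑ σ : Equiv.Perm (Fin n), ((Equiv.Perm.sign σ : ℤ) : k) •
        barInner k n a b (fun p => Fintype.linearCombination k x (v (σ p))) := by
  rw [wedge, smul_inner, ← symmAlt_apply]
  exact exteriorPower.alternatingMapLinearEquiv_apply_ιMulti _ _

theorem linearCombination_vec (x : Fin m → A) (i : Fin m) :
    Fintype.linearCombination k x (vec k m i) = x i := by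
  simp [vec]

theorem symmetrize_gen (x : Fin m → A) (n : ℕ) (a b : A) (l : Fin n → Fin m) :
    symmetrize x n ((a ⊗ₜ[k] MulOpposite.op b : Env k A) • gen k A l) =
      ∑ σ : Equiv.Perm (Fin n), ((Equiv.Perm.sign σ : ℤ) : k) •
        barInner k n a b (fun p => x (l (σ p))) := by
  rw [gen, symmetrize_wedge]
  simp only [linearCombination_vec]

theorem isSymmetrization_symmetrize (x : Fin m → A) :
    IsSymmetrization x (symmetrize (k := k) x) :=
  fun n l _ a b => symmetrize_gen x n a b l

theorem barInner_one_mem (n : ℕ) (a b : A) (y : Fin n → A) (i : Fin n) (c : A)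
    (hc : c ∈ Submodule.span k {(1 : A)}) :
    barInner k n a b (Function.update y i c) ∈ barDegenerate k A n := by
  obtain ⟨r, rfl⟩ := Submodule.mem_span_singleton.1 hc
  rw [MultilinearMap.map_update_smul]
  refine Submodule.smul_mem _ _ (Submodule.subset_span ⟨_, i, ?_, rfl⟩)
  rw [barVec_inner, Function.update_self]

/-! The bar differential of the symmetrization -/

theorem contractNth_barVec_zero (n : ℕ) (a b : A) (y : Fin (n + 1) → A) :
    (0 : Fin (n + 2)).castSucc.contractNth (· * ·) (barVec a y b) =
      barVec (a * y 0) (fun q => y ((0 : Fin (n + 1)).succAbove q)) b := by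
  rw [contractNth_eq_update]
  refine eq_barVec ?_ (fun i => ?_) ?_
  · rw [Function.update_self, barVec_of_val a y b (0 : Fin (n + 2)).succ 0 (by simp)]; rfl
  · rw [Function.update_of_ne (by simp [Fin.ext_iff])]
    refine barVec_of_val _ _ _ _ _ ?_
    simp [Fin.succAbove, Fin.lt_def]
  · rw [Function.update_of_ne (by simp [Fin.ext_iff])]
    refine (congrArg _ (Fin.ext ?_)).trans (barVec_last a y b)
    simp [Fin.succAbove, Fin.lt_def]

theorem contractNth_barVec_last (n : ℕ) (a b : A) (y : Fin (n + 1) → A) :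
    (Fin.last (n + 1)).castSucc.contractNth (· * ·) (barVec a y b) =
      barVec a (fun q => y ((Fin.last n).succAbove q)) (y (Fin.last n) * b) := by
  rw [contractNth_eq_update]
  refine eq_barVec ?_ (fun i => ?_) ?_
  · rw [Function.update_of_ne (by simp [Fin.ext_iff])]
    exact (congrArg _ (Fin.ext (by simp [Fin.succAbove, Fin.lt_def]))).trans (barVec_zero a y b)
  · rw [Function.update_of_ne (by simp [Fin.ext_iff]; omega)]
    refine barVec_of_val _ _ _ _ _ ?_
    have := i.isLt
    simp only [Fin.succAbove, Fin.lt_def, Fin.val_castSucc, Fin.val_succ, Fin.val_last]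
    split_ifs <;> simp <;> omega
  · rw [Function.update_self, barVec_of_val _ _ _ _ (Fin.last n) (by simp), Fin.succ_last,
      barVec_last]

theorem contractNth_barVec_inner (n : ℕ) (a b : A) (y : Fin (n + 1) → A) (p : Fin n) :
    p.succ.castSucc.castSucc.contractNth (· * ·) (barVec a y b) =
      barVec a (Function.update (fun q => y (p.succ.succAbove q)) p
        (y p.castSucc * y p.succ)) b := by
  have hp := p.isLt
  rw [contractNth_eq_update]
  refine eq_barVec ?_ (fun i => ?_) ?_
  · rw [Function.update_of_ne (by simp [Fin.ext_iff])]
    exact (congrArg _ (Fin.ext (by simp [Fin.succAbove, Fin.lt_def]))).trans (barVec_zero a y b)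
  · have hi := i.isLt
    by_cases h : i = p
    · subst h
      rw [Function.update_self, Function.update_self, barVec_of_val _ _ _ _ i.castSucc (by simp),
        barVec_of_val _ _ _ _ i.succ (by simp)]
    · have h' : (i : ℕ) ≠ p := fun h' => h (Fin.ext h')
      rw [Function.update_of_ne (by simpa [Fin.ext_iff] using h'), Function.update_of_ne h]
      refine barVec_of_val _ _ _ _ _ ?_
      simp only [Fin.succAbove, Fin.lt_def, Fin.val_castSucc, Fin.val_succ]
      split_ifs <;> simp <;> omega
  · rw [Function.update_of_ne (by simp [Fin.ext_iff]; omega)]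
    refine (congrArg _ (Fin.ext ?_)).trans (barVec_last a y b)
    simp only [Fin.succAbove, Fin.lt_def, Fin.val_castSucc, Fin.val_succ, Fin.val_last]
    split_ifs <;> simp <;> omega

/-- The two outer faces, which multiply into `a` and `b`, are separated from the inner ones: after
antisymmetrization the former give the Koszul terms and the latter the commutators. -/
theorem barD_barInner (n : ℕ) (a b : A) (y : Fin (n + 1) → A) :
    barD k A n (barInner k (n + 1) a b y) =
      barInner k n (a * y 0) b (fun q => y ((0 : Fin (n + 1)).succAbove q)) +
      ((∑ p : Fin n, (-1 : k) ^ ((p : ℕ) + 1) • barInner k n a b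
        (Function.update (fun q => y (p.succ.succAbove q)) p (y p.castSucc * y p.succ))) +
      (-1 : k) ^ (n + 1) •
        barInner k n a (y (Fin.last n) * b) (fun q => y ((Fin.last n).succAbove q))) := by
  simp only [barD, LinearMap.sum_apply, LinearMap.smul_apply, barInner_apply, barFace_tprod]
  rw [Fin.sum_univ_succ, Fin.sum_univ_castSucc, contractNth_barVec_zero]
  congr 1
  · simp
  · congr 1
    · refine Finset.sum_congr rfl fun p _ => ?_
      rw [Fin.succ_castSucc, contractNth_barVec_inner]
      simp
    · rw [Fin.succ_last, contractNth_barVec_last]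
      simp

theorem sign_insertPerm_cast {n : ℕ} (p j : Fin (n + 1)) (τ : Equiv.Perm (Fin n)) :
    ((Equiv.Perm.sign (insertPerm p j τ) : ℤ) : k) =
      (-1) ^ (p : ℕ) * (-1) ^ (j : ℕ) * ((Equiv.Perm.sign τ : ℤ) : k) := by
  rw [sign_insertPerm]; push_cast; rfl

/-- The bar differential of a symmetrized tensor, in terms of commutators. -/
theorem barD_sum_barInner (n : ℕ) (a b : A) (y : Fin (n + 1) → A) :
    barD k A n (∑ σ : Equiv.Perm (Fin (n + 1)), ((Equiv.Perm.sign σ : ℤ) : k) •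
        barInner k (n + 1) a b (fun p => y (σ p))) =
      (∑ j : Fin (n + 1), (-1 : k) ^ (j : ℕ) • ∑ τ : Equiv.Perm (Fin n),
        ((Equiv.Perm.sign τ : ℤ) : k) • (barInner k n (a * y j) b (fun q => y (j.succAbove (τ q))) -
          barInner k n a (y j * b) (fun q => y (j.succAbove (τ q))))) +
      ∑ j : Fin (n + 1), (-1 : k) ^ (j : ℕ) • ∑ τ : Equiv.Perm (Fin n),
        ((Equiv.Perm.sign τ : ℤ) : k) • ∑ p : Fin n, if j.succAbove (τ p) < j then
          barInner k n a b (Function.update (fun q => y (j.succAbove (τ q))) p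
            (y (j.succAbove (τ p)) * y j - y j * y (j.succAbove (τ p)))) else 0 := by
  have hs : ∀ r : ℕ, (-1 : k) ^ r * (-1) ^ r = 1 := fun r => by
    rw [← mul_pow]; simp
  -- The first outer face is sorted by the value j = σ(0) that is multiplied into `a`.
  have h0 : ∑ σ : Equiv.Perm (Fin (n + 1)), ((Equiv.Perm.sign σ : ℤ) : k) •
      barInner k n (a * y (σ 0)) b (fun q => y (σ ((0 : Fin (n + 1)).succAbove q))) =
      ∑ j : Fin (n + 1), (-1 : k) ^ (j : ℕ) • ∑ τ : Equiv.Perm (Fin n),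
        ((Equiv.Perm.sign τ : ℤ) : k) • barInner k n (a * y j) b
          (fun q => y (j.succAbove (τ q))) := by
    rw [sum_insertPerm 0]
    refine Finset.sum_congr rfl fun j _ => ?_
    rw [Finset.smul_sum]
    refine Finset.sum_congr rfl fun τ _ => ?_
    rw [smul_smul, sign_insertPerm_cast]
    simp only [insertPerm_self, insertPerm_succAbove]
    simp
  -- The last outer face is sorted by j, the value of σ at the last index. The sign (-1)^n of moving
  -- that index to the front meets the sign (-1)^{n+1} of the face and leaves -1.
  have hl : ∑ σ : Equiv.Perm (Fin (n + 1)), ((Equiv.Perm.sign σ : ℤ) : k) • (-1 : k) ^ (n + 1) •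
      barInner k n a (y (σ (Fin.last n)) * b) (fun q => y (σ ((Fin.last n).succAbove q))) =
      -∑ j : Fin (n + 1), (-1 : k) ^ (j : ℕ) • ∑ τ : Equiv.Perm (Fin n),
        ((Equiv.Perm.sign τ : ℤ) : k) • barInner k n a (y j * b)
          (fun q => y (j.succAbove (τ q))) := by
    rw [sum_insertPerm (Fin.last n), ← Finset.sum_neg_distrib]
    refine Finset.sum_congr rfl fun j _ => ?_
    rw [Finset.smul_sum, ← Finset.sum_neg_distrib]
    refine Finset.sum_congr rfl fun τ _ => ?_
    rw [smul_smul, smul_smul, sign_insertPerm_cast, ← neg_smul]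
    simp only [insertPerm_self, insertPerm_succAbove, Fin.val_last]
    congr 1
    linear_combination (-(-1 : k) ^ (j : ℕ) * ((Equiv.Perm.sign τ : ℤ) : k)) * hs n
  -- In an inner face, permutations that differ by exchanging the values at p and p + 1 are paired.
  -- Their signs are opposite, so a pair contributes a commutator.
  have hm : ∀ p : Fin n, ∑ σ : Equiv.Perm (Fin (n + 1)), ((Equiv.Perm.sign σ : ℤ) : k) •
      (-1 : k) ^ ((p : ℕ) + 1) • barInner k n a b
        (Function.update (fun q => y (σ (p.succ.succAbove q))) p
          (y (σ p.castSucc) * y (σ p.succ))) =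
      ∑ j : Fin (n + 1), (-1 : k) ^ (j : ℕ) • ∑ τ : Equiv.Perm (Fin n),
        ((Equiv.Perm.sign τ : ℤ) : k) • if j.succAbove (τ p) < j then
          barInner k n a b (Function.update (fun q => y (j.succAbove (τ q))) p
            (y (j.succAbove (τ p)) * y j - y j * y (j.succAbove (τ p)))) else 0 := by
    intro p
    set F : Equiv.Perm (Fin (n + 1)) → Bar k A n := fun σ => ((Equiv.Perm.sign σ : ℤ) : k) •
      (-1 : k) ^ ((p : ℕ) + 1) • barInner k n a b
        (Function.update (fun q => y (σ (p.succ.succAbove q))) p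
          (y (σ p.castSucc) * y (σ p.succ))) with hF
    have hsplit : ∑ σ, F σ = (∑ σ, if σ p.castSucc < σ p.succ then F σ else 0) +
        ∑ σ, if σ p.succ < σ p.castSucc then F σ else 0 := by
      rw [← Finset.sum_add_distrib]
      refine Finset.sum_congr rfl fun σ _ => ?_
      have hne : σ p.castSucc ≠ σ p.succ :=
        fun h => Fin.castSucc_lt_succ.ne (σ.injective h)
      rcases lt_or_gt_of_ne hne with h | h
      · rw [if_pos h, if_neg h.not_gt, add_zero]
      · rw [if_neg h.not_gt, if_pos h, zero_add]
    -- In each half j is the larger of the two values: it sits at p + 1 in the first half and at p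
    -- in the second.
    rw [hsplit, sum_insertPerm p.succ, sum_insertPerm p.castSucc, ← Finset.sum_add_distrib]
    refine Finset.sum_congr rfl fun j _ => ?_
    rw [← Finset.sum_add_distrib, Finset.smul_sum]
    refine Finset.sum_congr rfl fun τ _ => ?_
    have e1 : insertPerm p.succ j τ p.castSucc = j.succAbove (τ p) := by
      have : p.castSucc = p.succ.succAbove p :=
        (Fin.succAbove_of_castSucc_lt _ _ Fin.castSucc_lt_succ).symm
      rw [this, insertPerm_succAbove]
    have e2 : insertPerm p.castSucc j τ p.succ = j.succAbove (τ p) := by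
      have : p.succ = p.castSucc.succAbove p :=
        (Fin.succAbove_of_le_castSucc _ _ le_rfl).symm
      rw [this, insertPerm_succAbove]
    -- Deleting position p + 1 instead of p changes only entry p of the remaining sequence, and that
    -- entry is overwritten.
    have e3 : ∀ v, Function.update (fun q => y (insertPerm p.castSucc j τ (p.succ.succAbove q))) p v
        = Function.update (fun q => y (j.succAbove (τ q))) p v := by
      intro v
      funext q
      by_cases hq : q = p
      · subst hq; simp
      · rw [Function.update_of_ne hq, Function.update_of_ne hq, ← insertPerm_succAbove p.castSucc]
        congr 2
        have hq' : (q : ℕ) ≠ p := fun h => hq (Fin.ext h)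
        simp only [Fin.succAbove, Fin.lt_def, Fin.val_castSucc, Fin.val_succ]
        split_ifs <;> first | rfl | (exfalso; omega)
    by_cases h : j.succAbove (τ p) < j
    · simp only [e1, e2, insertPerm_self, if_pos h, hF, e3, insertPerm_succAbove,
        sign_insertPerm_cast]
      rw [MultilinearMap.map_update_sub, Fin.val_succ, Fin.val_castSucc]
      generalize barInner k n a b (Function.update (fun q => y (j.succAbove (τ q))) p
        (y (j.succAbove (τ p)) * y j)) = w1
      generalize barInner k n a b (Function.update (fun q => y (j.succAbove (τ q))) p
        (y j * y (j.succAbove (τ p)))) = w2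
      have h1 := congrArg
        (fun r => (r * ((-1 : k) ^ (j : ℕ) * ((Equiv.Perm.sign τ : ℤ) : k))) • w1) (hs (p + 1))
      have h2 := congrArg
        (fun r => (r * ((-1 : k) ^ (j : ℕ) * ((Equiv.Perm.sign τ : ℤ) : k))) • w2) (hs p)
      simp only [one_mul] at h1 h2
      rw [smul_sub, smul_sub, smul_smul, smul_smul, smul_smul, smul_smul, ← h1, ← h2,
        sub_eq_add_neg, ← neg_smul]
      congr 2 <;> ring
    · simp only [e1, e2, insertPerm_self, if_neg h, add_zero, smul_zero]
  have key : ∀ σ : Equiv.Perm (Fin (n + 1)), barD k A n (((Equiv.Perm.sign σ : ℤ) : k) •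
      barInner k (n + 1) a b (fun p => y (σ p))) = _ := fun σ => by
    rw [map_smul, barD_barInner, smul_add, smul_add, Finset.smul_sum]
  rw [map_sum, Finset.sum_congr rfl fun σ _ => key σ, Finset.sum_add_distrib,
    Finset.sum_add_distrib, h0, hl, Finset.sum_comm, Finset.sum_congr rfl fun p _ => hm p]
  have e : ∑ p : Fin n, ∑ j : Fin (n + 1), (-1 : k) ^ (j : ℕ) • ∑ τ : Equiv.Perm (Fin n),
        ((Equiv.Perm.sign τ : ℤ) : k) • (if j.succAbove (τ p) < j then
          barInner k n a b (Function.update (fun q => y (j.succAbove (τ q))) p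
            (y (j.succAbove (τ p)) * y j - y j * y (j.succAbove (τ p)))) else 0) =
      ∑ j : Fin (n + 1), (-1 : k) ^ (j : ℕ) • ∑ τ : Equiv.Perm (Fin n),
        ((Equiv.Perm.sign τ : ℤ) : k) • ∑ p : Fin n, if j.succAbove (τ p) < j then
          barInner k n a b (Function.update (fun q => y (j.succAbove (τ q))) p
            (y (j.succAbove (τ p)) * y j - y j * y (j.succAbove (τ p)))) else 0 := by
    rw [Finset.sum_comm]
    refine Finset.sum_congr rfl fun j _ => ?_
    rw [← Finset.smul_sum, Finset.sum_comm]
    simp only [Finset.smul_sum]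
  rw [e]
  simp only [smul_sub, Finset.sum_sub_distrib]
  abel

end Symmetrization

/-! ### Symmetrization as a chain map -/

section SymmetrizationChain

variable {k : Type u} [Field k] {A : Type v} [Ring A] [Algebra k A] {m : ℕ}

theorem inner_basis_eq_gen (n : ℕ) (s : Set.powersetCard (Fin m) n) :
    inner k A ((Pi.basisFun k (Fin m)).exteriorPower n s) =
      gen k A (Set.powersetCard.ofFinEmbEquiv.symm s) := by
  rw [exteriorPower.basis_apply, exteriorPower.ιMulti_family]
  simp only [gen, wedge, vec]
  congr 2
  funext p
  simp [Pi.basisFun_apply]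

theorem kos_hom_ext {n : ℕ} {Z : Type*} [AddCommGroup Z] [Module k Z]
    {F G : Kos k A m n →ₗ[k] Z}
    (h : ∀ (a b : A) (l : Fin n → Fin m), StrictMono l →
      F ((a ⊗ₜ[k] MulOpposite.op b : Env k A) • gen k A l) =
      G ((a ⊗ₜ[k] MulOpposite.op b : Env k A) • gen k A l)) : F = G := by
  refine FreeBimod.hom_ext_basis ((Pi.basisFun k (Fin m)).exteriorPower n) fun a b s => ?_
  rw [inner_basis_eq_gen]
  exact h a b _ (Set.powersetCard.ofFinEmbEquiv.symm s).strictMono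

theorem sum_ite_lt_eq_sum_succAbove {n : ℕ} {M : Type*} [AddCommMonoid M] (j : Fin (n + 1))
    (f : Fin (n + 1) → M) : (∑ i, if i < j then f i else 0) =
      ∑ q, if j.succAbove q < j then f (j.succAbove q) else 0 := by
  rw [Fin.sum_univ_succAbove _ j, if_neg (lt_irrefl j), zero_add]

/-- The image of the differential is brought to the shape of `barD_sum_barInner`, with minus the
linear part in place of the commutator, so that the two can be compared term by term. -/
theorem symmetrize_koszulFormula (x : Fin m → A) (c : Fin m → Fin m → (Fin m → k)) (n : ℕ)
    (a b : A) (l : Fin (n + 1) → Fin m) :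
    symmetrize x n ((a ⊗ₜ[k] MulOpposite.op b : Env k A) • koszulFormula x c n l) =
      (∑ j : Fin (n + 1), (-1 : k) ^ (j : ℕ) • ∑ τ : Equiv.Perm (Fin n),
        ((Equiv.Perm.sign τ : ℤ) : k) •
          (barInner k n (a * x (l j)) b (fun q => x (l (j.succAbove (τ q)))) -
          barInner k n a (x (l j) * b) (fun q => x (l (j.succAbove (τ q)))))) +
      ∑ j : Fin (n + 1), (-1 : k) ^ (j : ℕ) • ∑ τ : Equiv.Perm (Fin n),
        ((Equiv.Perm.sign τ : ℤ) : k) • ∑ p : Fin n, if j.succAbove (τ p) < j then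
          barInner k n a b (Function.update (fun q => x (l (j.succAbove (τ q)))) p
            (-Fintype.linearCombination k x (c (l j) (l (j.succAbove (τ p)))))) else 0 := by
  rw [← sandwich_apply, koszulFormula, map_add, map_add]
  congr 1
  · simp only [map_sum, map_smul, map_sub, sandwich_apply, tmul_op_smul_smul]
    refine Finset.sum_congr rfl fun j _ => ?_
    congr 1
    have h1 : ((x (l j) ⊗ₜ[k] (1 : Aᵐᵒᵖ) : Env k A)) =
      (x (l j) ⊗ₜ[k] MulOpposite.op (1 : A) : Env k A) := rfl
    rw [h1, tmul_op_smul_smul, symmetrize_gen, symmetrize_gen, ← Finset.sum_sub_distrib, mul_one,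
      one_mul]
    simp only [smul_sub]
  · rw [Finset.sum_comm, map_sum, map_sum]
    refine Finset.sum_congr rfl fun j _ => ?_
    rw [sum_ite_lt_eq_sum_succAbove j (fun i => (-1 : k) ^ ((j : ℕ) + 1) • wedge k A (fun p =>
      Function.update (fun q => vec k m (l q)) i (c (l j) (l i)) (j.succAbove p))), map_sum,
      map_sum]
    -- The factor replaced by c sits in position q of the wedge, hence in position τ⁻¹(q) of the
    -- tensor permuted by τ.
    have h : ∀ q : Fin n, symmetrize x n (sandwich k a b (if j.succAbove q < j then
        (-1 : k) ^ ((j : ℕ) + 1) • wedge k A (fun p => Function.update (fun q => vec k m (l q))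
          (j.succAbove q) (c (l j) (l (j.succAbove q))) (j.succAbove p)) else 0)) =
        (-1 : k) ^ (j : ℕ) • ∑ τ : Equiv.Perm (Fin n), ((Equiv.Perm.sign τ : ℤ) : k) •
          if j.succAbove q < j then barInner k n a b
            (Function.update (fun q => x (l (j.succAbove (τ q)))) (τ⁻¹ q)
            (-Fintype.linearCombination k x (c (l j) (l (j.succAbove q))))) else 0 := by
      intro q
      split_ifs with hq
      · rw [map_smul, map_smul, sandwich_apply, symmetrize_wedge, pow_succ, mul_smul]
        congr 1
        rw [neg_smul, one_smul, ← Finset.sum_neg_distrib]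
        refine Finset.sum_congr rfl fun τ _ => ?_
        rw [← neg_one_smul k (Fintype.linearCombination k x _), MultilinearMap.map_update_smul,
          neg_one_smul, smul_neg]
        congr 3
        funext p
        by_cases hp : p = τ⁻¹ q
        · subst hp; simp
        · have hp' : τ p ≠ q := fun h => hp (by simp [← h])
          rw [Function.update_of_ne hp, Function.update_of_ne (fun h => hp'
            (Fin.succAbove_right_injective h)), linearCombination_vec]
      · simp
    rw [Finset.sum_congr rfl fun q _ => h q, ← Finset.smul_sum, Finset.sum_comm]
    congr 1
    refine Finset.sum_congr rfl fun τ _ => ?_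
    rw [← Finset.smul_sum, ← Equiv.sum_comp τ]
    simp

/-- The commutation relations `[x_j, x_i] ≡ c_{ji}` modulo constants, for `i < j`. -/
def IsCommutator (x : Fin m → A) (c : Fin m → Fin m → (Fin m → k)) : Prop :=
  ∀ i j, i < j → x j * x i - x i * x j - Fintype.linearCombination k x (c j i) ∈
    Submodule.span k {(1 : A)}

/-- The outer terms of the two differentials agree exactly. The other terms differ by tensors having
a constant in an inner position, since commutators of generators equal their linear parts up to
constants, and such tensors are degenerate. -/
theorem rbarD_symmetrize {x : Fin m → A} {c : Fin m → Fin m → (Fin m → k)}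
    (hc : IsCommutator x c) (n : ℕ) (z : Kos k A m (n + 1)) :
    rbarD k A n (toRBar k A (n + 1) (symmetrize x (n + 1) z)) =
      toRBar k A n (symmetrize x n (koszulD x c n z)) := by
  suffices h : rbarD k A n ∘ₗ toRBar k A (n + 1) ∘ₗ symmetrize x (n + 1) =
      toRBar k A n ∘ₗ symmetrize x n ∘ₗ (koszulD x c n).restrictScalars k from
    LinearMap.congr_fun h z
  refine kos_hom_ext fun a b l hl => ?_
  simp only [LinearMap.comp_apply, LinearMap.restrictScalars_apply]
  rw [(koszulD x c n).map_smul, koszulD_gen x c n l hl, symmetrize_gen, symmetrize_koszulFormula]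
  change toRBar k A n (barD k A n _) = _
  rw [barD_sum_barInner n a b (fun p => x (l p)), map_add, map_add]
  congr 1
  simp only [map_sum, map_smul]
  refine Finset.sum_congr rfl fun j _ => ?_
  congr 1
  refine Finset.sum_congr rfl fun τ _ => ?_
  congr 1
  refine Finset.sum_congr rfl fun p _ => ?_
  split_ifs with h
  · rw [← sub_eq_zero, ← map_sub, ← MultilinearMap.map_update_sub]
    refine (Submodule.Quotient.mk_eq_zero _).2 (barInner_one_mem _ _ _ _ _ _ ?_)
    have := Submodule.neg_mem _ (hc _ _ (hl h))
    convert this using 1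
    abel
  · rfl

end SymmetrizationChain

/-! ### Injectivity of the symmetrization -/

section SymmetrizationInjective

variable {k : Type u} [Field k] {A : Type v} [Ring A] [Algebra k A] {m : ℕ}

/-- For `l : Fin n → Fin m`, the map
`a₀ ⊗ ⋯ ⊗ a_{n+1} ↦ (∏ f(a_p)_{l_p}) a₀ ⊗ a_{n+1}`. -/
noncomputable def barCoeff (f : A →ₗ[k] (Fin m → k)) {n : ℕ} (l : Fin n → Fin m) :
    Bar k A n →ₗ[k] Env k A :=
  PiTensorProduct.lift ((MultilinearMap.mkPiAlgebraFin k (n + 2) (Env k A)).compLinearMap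
    (Fin.cons ((TensorProduct.mk k A Aᵐᵒᵖ).flip 1)
      (Fin.snoc (fun p => (Algebra.linearMap k (Env k A)) ∘ₗ LinearMap.proj (l p) ∘ₗ f)
        ((TensorProduct.mk k A Aᵐᵒᵖ 1) ∘ₗ (MulOpposite.opLinearEquiv k).toLinearMap) :
          Fin (n + 1) → (A →ₗ[k] Env k A)) : Fin (n + 2) → (A →ₗ[k] Env k A)))

theorem barCoeff_barVec (f : A →ₗ[k] (Fin m → k)) {n : ℕ} (l : Fin n → Fin m) (a b : A)
    (y : Fin n → A) : barCoeff f l (PiTensorProduct.tprod k (barVec a y b)) =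
      (∏ p, f (y p) (l p)) • (a ⊗ₜ[k] MulOpposite.op b : Env k A) := by
  have h : ∀ r : Fin n → k, (List.ofFn fun p => algebraMap k (Env k A) (r p)).prod =
      algebraMap k (Env k A) (∏ p, r p) := by
    intro r
    rw [← List.prod_ofFn, map_list_prod, List.map_ofFn]
    rfl
  rw [barCoeff, PiTensorProduct.lift.tprod, MultilinearMap.compLinearMap_apply,
    MultilinearMap.mkPiAlgebraFin_apply, List.ofFn_succ, List.prod_cons, List.ofFn_succ',
    List.prod_concat]
  simp only [barVec, Fin.cons_succ, Fin.snoc_castSucc, Fin.snoc_last, Fin.cons_zero,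
    LinearMap.comp_apply, Algebra.linearMap_apply, LinearMap.proj_apply]
  rw [h (fun p => f (y p) (l p))]
  rw [Algebra.left_comm, ← Algebra.smul_def]
  congr 1
  simp

theorem barCoeff_degenerate (f : A →ₗ[k] (Fin m → k)) (h1 : f 1 = 0) {n : ℕ} (l : Fin n → Fin m) :
    barDegenerate k A n ≤ LinearMap.ker (barCoeff f l) := by
  refine Submodule.span_le.2 ?_
  rintro _ ⟨a, q, hq, rfl⟩
  have : a = barVec (a 0) (fun i => a i.succ.castSucc) (a (Fin.last (n + 1))) :=
    eq_barVec rfl (fun _ => rfl) rfl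
  rw [this]
  change barCoeff f l _ = 0
  rw [barCoeff_barVec, Finset.prod_eq_zero (Finset.mem_univ q), zero_smul]
  rw [hq, h1]; rfl

/-- Both sequences have the same range, and an increasing sequence is determined by its range. -/
theorem strictMono_comp_perm {n : ℕ} {l l' : Fin n → Fin m} (hl : StrictMono l)
    (hl' : StrictMono l') (σ : Equiv.Perm (Fin n)) (h : ∀ p, l (σ p) = l' p) :
    σ = 1 ∧ l = l' := by
  have e : l = l' := (hl.range_inj hl').1 (by
    rw [← σ.surjective.range_comp l]
    exact congrArg Set.range (funext h))
  refine ⟨Equiv.ext fun p => hl.injective ?_, e⟩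
  rw [h, e]; rfl

/-- Coordinates dual to the generators and vanishing on 1 give functionals on the reduced bar
resolution. The one attached to an increasing l' annihilates the symmetrization of an increasing l ≠
l', and for l = l' it sees only the identity permutation. Hence there is a linear retraction. -/
theorem toRBar_symmetrize_injective (x : Fin m → A) (f : A →ₗ[k] (Fin m → k)) (h1 : f 1 = 0)
    (hx : ∀ i, f (x i) = vec k m i) (n : ℕ) :
    Function.Injective (fun z => toRBar k A n (symmetrize x n z)) := by
  classical
  -- Each coefficient is an element of the enveloping algebra, recording the outer factors, and is
  -- placed on the corresponding generator.
  let retr : RBar k A n →ₗ[k] Kos k A m n := ∑ s : Set.powersetCard (Fin m) n,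
    (((LinearMap.toSpanSingleton (Env k A) (Kos k A m n)
      (gen k A (Set.powersetCard.ofFinEmbEquiv.symm s))).restrictScalars k) ∘ₗ
    (barDegenerate k A n).liftQ (barCoeff f (Set.powersetCard.ofFinEmbEquiv.symm s))
      (barCoeff_degenerate f h1 _))
  have h : retr ∘ₗ toRBar k A n ∘ₗ symmetrize x n = LinearMap.id := by
    refine kos_hom_ext fun a b l hl => ?_
    obtain ⟨s, hs⟩ := (Set.powersetCard.ofFinEmbEquiv (n := n) (I := Fin m)).symm.surjective
      (OrderEmbedding.ofStrictMono l hl)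
    have hs' : ⇑(Set.powersetCard.ofFinEmbEquiv.symm s) = l := by rw [hs]; rfl
    have hcoef : ∀ t : Set.powersetCard (Fin m) n,
        barCoeff f (Set.powersetCard.ofFinEmbEquiv.symm t)
          (symmetrize x n ((a ⊗ₜ[k] MulOpposite.op b : Env k A) • gen k A l)) =
        if t = s then (a ⊗ₜ[k] MulOpposite.op b : Env k A) else
          ((0 : A) ⊗ₜ[k] MulOpposite.op b : Env k A) := by
      intro t
      rw [symmetrize_gen, map_sum]
      have hterm : ∀ σ : Equiv.Perm (Fin n), σ ≠ 1 ∨ t ≠ s →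
          ∏ p, f (x (l (σ p))) (Set.powersetCard.ofFinEmbEquiv.symm t p) = 0 := by
        intro σ hσ
        by_contra hne
        have hall : ∀ p, l (σ p) = Set.powersetCard.ofFinEmbEquiv.symm t p := by
          intro p
          by_contra hp
          refine hne (Finset.prod_eq_zero (Finset.mem_univ p) ?_)
          rw [hx, vec, Pi.single_eq_of_ne (Ne.symm hp)]
        obtain ⟨h1, h2⟩ := strictMono_comp_perm hl
          (Set.powersetCard.ofFinEmbEquiv.symm t).strictMono σ hall
        rcases hσ with hσ | hσ
        · exact hσ h1
        · refine hσ (Set.powersetCard.ofFinEmbEquiv.symm.injective ?_)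
          refine DFunLike.coe_injective ?_
          rw [← h2, hs']
      rw [Finset.sum_eq_single 1]
      · rw [map_smul, barInner_apply, barCoeff_barVec]
        split_ifs with hts
        · subst hts
          rw [hs', Finset.prod_eq_one]
          · simp
          · intro p _
            simp [hx, vec]
        · rw [hterm 1 (Or.inr hts)]; simp
      · intro σ _ hσ
        rw [map_smul, barInner_apply, barCoeff_barVec, hterm σ (Or.inl hσ)]; simp
      · simp
    simp only [retr, LinearMap.comp_apply, LinearMap.sum_apply, LinearMap.id_apply,
      LinearMap.restrictScalars_apply, LinearMap.toSpanSingleton_apply]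
    rw [Finset.sum_eq_single s]
    · have hc := hcoef s
      rw [if_pos rfl, hs'] at hc
      rw [hs']
      change barCoeff f l _ • _ = _
      rw [hc]
    · intro t _ ht
      change barCoeff f _ _ • _ = _
      rw [hcoef, if_neg ht]
      exact zero_tmul_smul _ _
    · simp
  exact Function.LeftInverse.injective (g := retr) fun z => LinearMap.congr_fun h z

theorem isSymmetrizationEmbedding_symmetrize {x : Fin m → A} {c : Fin m → Fin m → (Fin m → k)}
    (hc : IsCommutator x c) (f : A →ₗ[k] (Fin m → k)) (h1 : f 1 = 0)
    (hx : ∀ i, f (x i) = vec k m i) :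
    IsSymmetrizationEmbedding x c (symmetrize (k := k) x) where
  symm := isSymmetrization_symmetrize x
  chain := rbarD_symmetrize hc
  injective := toRBar_symmetrize_injective x f h1 hx

end SymmetrizationInjective

/-! ### Derivations acting on the Koszul complex -/

section KosDerivation

variable {k : Type u} [Field k] {A : Type v} [Ring A] [Algebra k A] {m : ℕ}

/-- The derivation of `⋀ⁿ V` induced by `x_i ↦ e_i`, on the basis. -/
noncomputable def wedgeDer (e : Fin m → (Fin m → k)) (n : ℕ) :
    ⋀[k]^n (Fin m → k) →ₗ[k] ⋀[k]^n (Fin m → k) :=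
  ((Pi.basisFun k (Fin m)).exteriorPower n).constr k fun s =>
    ∑ p, exteriorPower.ιMulti k n (Function.update
      (fun q => vec k m (Set.powersetCard.ofFinEmbEquiv.symm s q)) p
        (e (Set.powersetCard.ofFinEmbEquiv.symm s p)))

/-- The derivation of `A ⊗ ⋀ⁿ V ⊗ A` induced by a derivation of `A` and `x_i ↦ e_i`. -/
noncomputable def kosDer (δ : A →ₗ[k] A) (e : Fin m → (Fin m → k)) (n : ℕ) :
    Kos k A m n →ₗ[k] Kos k A m n :=
  bimodDer δ (wedgeDer e n)

theorem kosDer_gen (δ : A →ₗ[k] A) (h1 : δ 1 = 0) (e : Fin m → (Fin m → k)) {n : ℕ}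
    (l : Fin n → Fin m) (hl : StrictMono l) : kosDer δ e n (gen k A l) =
      ∑ p, wedge k A (Function.update (fun q => vec k m (l q)) p (e (l p))) := by
  obtain ⟨s, hs⟩ := (Set.powersetCard.ofFinEmbEquiv (n := n) (I := Fin m)).symm.surjective
    (OrderEmbedding.ofStrictMono l hl)
  have hs' : ⇑(Set.powersetCard.ofFinEmbEquiv.symm s) = l := by rw [hs]; rfl
  rw [← hs', ← inner_basis_eq_gen, kosDer, bimodDer_inner δ h1, wedgeDer, Module.Basis.constr_basis,
    ← innerₗ_apply]
  exact map_sum (innerₗ k A (⋀[k]^n (Fin m → k))) _ _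

theorem totalDer_barInner (δ : A →ₗ[k] A) (n : ℕ) (a b : A) (y : Fin n → A) :
    totalDer δ (n + 2) (barInner k n a b y) = barInner k n (δ a) b y + (barInner k n a (δ b) y +
      ∑ p, barInner k n a b (Function.update y p (δ (y p)))) := by
  rw [barInner_apply, totalDer_tprod, Fin.sum_univ_castSucc, Fin.sum_univ_succ]
  rw [Fin.castSucc_zero, barVec_zero, update_barVec_zero, barVec_last, update_barVec_last,
    Finset.sum_congr rfl fun (p : Fin n) _ => show _ = barInner k n a b
      (Function.update y p (δ (y p))) by rw [barVec_inner, ← barVec_update]; rfl]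
  simp only [barInner_apply]
  abel

/-- `δ(x_i) ≡ e_i` modulo constants. -/
def IsLinearPart (δ : A →ₗ[k] A) (x : Fin m → A) (e : Fin m → (Fin m → k)) : Prop :=
  ∀ i, δ (x i) - Fintype.linearCombination k x (e i) ∈ Submodule.span k {(1 : A)}

/-- The total derivation differentiates an inner factor x_i to δ(x_i), whereas the Koszul side
inserts only the linear part e_i. The difference is a constant in an inner position and so
disappears in the reduced bar resolution. -/
theorem symmetrize_kosDer {δ : A →ₗ[k] A} (hδ : ∀ r s : A, δ (r * s) = δ r * s + r * δ s)
    (h1 : δ 1 = 0) {x : Fin m → A} {e : Fin m → (Fin m → k)} (he : IsLinearPart δ x e) (n : ℕ)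
    (z : Kos k A m n) : toRBar k A n (symmetrize x n (kosDer δ e n z)) =
      rbarDer δ h1 n (toRBar k A n (symmetrize x n z)) := by
  suffices h : toRBar k A n ∘ₗ symmetrize x n ∘ₗ kosDer δ e n =
      rbarDer δ h1 n ∘ₗ toRBar k A n ∘ₗ symmetrize x n from LinearMap.congr_fun h z
  refine kos_hom_ext fun a b l hl => ?_
  simp only [LinearMap.comp_apply]
  rw [rbarDer_toRBar, kosDer, bimodDer_smul δ hδ, ← kosDer, kosDer_gen δ h1 e l hl,
    ← sandwich_apply a b (∑ p, _), map_sum, map_add, map_add, map_add, map_sum,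
    symmetrize_gen, symmetrize_gen, symmetrize_gen]
  simp only [sandwich_apply, symmetrize_wedge, map_sum, map_add, map_smul, totalDer_barInner,
    smul_add, Finset.sum_add_distrib, ← add_assoc]
  congr 1
  rw [Finset.sum_comm]
  refine Finset.sum_congr rfl fun σ _ => ?_
  rw [← Finset.smul_sum]
  congr 1
  rw [← Equiv.sum_comp σ]
  refine Finset.sum_congr rfl fun p _ => ?_
  have h : (fun q => Fintype.linearCombination k x (Function.update (fun q => vec k m (l q)) (σ p)
      (e (l (σ p))) (σ q))) = Function.update (fun q => x (l (σ q))) p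
        (Fintype.linearCombination k x (e (l (σ p)))) := by
    funext q
    by_cases hq : q = p
    · subst hq; simp
    · rw [Function.update_of_ne hq, Function.update_of_ne (fun h => hq (σ.injective h)),
        linearCombination_vec]
  rw [h, eq_comm, ← sub_eq_zero, ← map_sub, ← MultilinearMap.map_update_sub]
  exact (Submodule.Quotient.mk_eq_zero _).2 (barInner_one_mem _ _ _ _ _ _ (he _))

/-- The data of generators `x_1, …, x_m` of `A`, linearly independent modulo constants, with the
commutation relations given by `c`. -/
structure IsKoszulData (x : Fin m → A) (c : Fin m → Fin m → (Fin m → k)) : Prop where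
  comm : IsCommutator x c
  coord : ∃ f : A →ₗ[k] (Fin m → k), f 1 = 0 ∧ ∀ i, f (x i) = vec k m i

/-- The corresponding identity holds in the reduced bar resolution, where it is the Leibniz rule,
and the symmetrization is injective and intertwines both the differentials and the derivations. This
replaces a direct check of how the coefficients `c` behave under `e`. -/
theorem koszulD_kosDer {δ : A →ₗ[k] A} (hδ : ∀ r s : A, δ (r * s) = δ r * s + r * δ s)
    (h1 : δ 1 = 0) {x : Fin m → A} {c : Fin m → Fin m → (Fin m → k)} (hx : IsKoszulData x c)
    {e : Fin m → (Fin m → k)} (he : IsLinearPart δ x e) (n : ℕ) (z : Kos k A m (n + 1)) :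
    koszulD x c n (kosDer δ e (n + 1) z) = kosDer δ e n (koszulD x c n z) := by
  obtain ⟨f, hf1, hf⟩ := hx.coord
  refine toRBar_symmetrize_injective x f hf1 hf n ?_
  change toRBar k A n (symmetrize x n _) = toRBar k A n (symmetrize x n _)
  rw [← rbarD_symmetrize hx.comm, symmetrize_kosDer hδ h1 he, symmetrize_kosDer hδ h1 he,
    rbarD_rbarDer δ h1 hδ, rbarD_symmetrize hx.comm]

theorem koszulAug_smul (a b : A) (z : Kos k A m 0) :
    koszulAug k A m ((a ⊗ₜ[k] MulOpposite.op b : Env k A) • z) = a * koszulAug k A m z * b := by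
  suffices h : koszulAug k A m ∘ₗ sandwich k a b =
      (LinearMap.mulRight k b ∘ₗ LinearMap.mulLeft k a) ∘ₗ koszulAug k A m from
    LinearMap.congr_fun h z
  refine kos_hom_ext fun c d l _ => ?_
  simp only [LinearMap.comp_apply, sandwich_apply, tmul_op_smul_smul, gen, koszulAug_smul_wedge,
    LinearMap.mulRight_apply, LinearMap.mulLeft_apply, mul_assoc]

theorem koszulAug_wedge (v : Fin 0 → (Fin m → k)) : koszulAug k A m (wedge k A v) = 1 := by
  have := koszulAug_smul_wedge (k := k) (1 : A) 1 v
  rwa [one_tmul_op_one_smul, mul_one] at this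

/-- In degree zero there is no wedge factor to differentiate, and what remains is the Leibniz rule
for a product ab. -/
theorem koszulAug_kosDer {δ : A →ₗ[k] A} (hδ : ∀ r s : A, δ (r * s) = δ r * s + r * δ s)
    (h1 : δ 1 = 0) (e : Fin m → (Fin m → k)) (z : Kos k A m 0) :
    koszulAug k A m (kosDer δ e 0 z) = δ (koszulAug k A m z) := by
  suffices h : koszulAug k A m ∘ₗ kosDer δ e 0 = δ ∘ₗ koszulAug k A m from LinearMap.congr_fun h z
  refine kos_hom_ext fun a b l hl => ?_
  simp only [LinearMap.comp_apply]
  rw [kosDer, bimodDer_smul δ hδ, ← kosDer, kosDer_gen δ h1 e l hl]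
  simp [koszulAug_smul, gen, koszulAug_wedge, hδ]

/-- The Koszul complex of `A` is compatible with the twisting map of a derivation. -/
theorem isCompatibleResolutionLeft_kosDer {δ : A →ₗ[k] A}
    (hδ : ∀ r s : A, δ (r * s) = δ r * s + r * δ s)
    (h1 : δ 1 = 0) {x : Fin m → A} {c : Fin m → Fin m → (Fin m → k)} (hx : IsKoszulData x c)
    {e : Fin m → (Fin m → k)} (he : IsLinearPart δ x e) :
    IsCompatibleResolutionLeft (P := Kos k A m) (twist δ) (koszulD x c) (koszulAug k A m)
      (fun n => twist (kosDer δ e n)) where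
  compatible _ := isCompatibleLeft_twist δ hδ _
  chain n := (twist_natural _ (LinearMap.ext fun z => koszulD_kosDer hδ h1 hx he n z)).symm
  lift := (twist_natural _ (LinearMap.ext fun z => koszulAug_kosDer hδ h1 e z)).symm

end KosDerivation

/-! ### The Koszul complex of k[X] and its compatibility with the twisting -/

section PolyResolution

variable {k : Type u} [Field k] {A : Type v} [Ring A] [Algebra k A]

/-- A bimodule map commutes with the shifted actions of X, so both sides obey the same recursions
and only free generators have to be tested. -/
theorem rtwist_natural {W W' : Type*} [AddCommGroup W] [Module k W] [AddCommGroup W'] [Module k W']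
    (δ : A →ₗ[k] A) (g : FreeBimod k (Poly k) W →ₗ[Env k (Poly k)] FreeBimod k (Poly k) W')
    (h : ∀ w a, rtwist δ (g (inner k (Poly k) w) ⊗ₜ a) = a ⊗ₜ g (inner k (Poly k) w)) :
    (g.restrictScalars k).lTensor A ∘ₗ rtwist δ = rtwist δ ∘ₗ (g.restrictScalars k).rTensor A := by
  have key : ∀ (p q : Poly k) (z : A ⊗[k] FreeBimod k (Poly k) W),
      (g.restrictScalars k).lTensor A (shiftBy δ (sandwich k p q) z) =
      shiftBy δ (sandwich k p q) ((g.restrictScalars k).lTensor A z) := by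
    intro p q z
    induction z with
    | zero => simp
    | add x y hx hy => simp only [map_add, hx, hy]
    | tmul a n =>
      simp only [shiftBy_tmul, map_add, LinearMap.lTensor_tmul, LinearMap.restrictScalars_apply,
        sandwich_apply, g.map_smul]
  refine TensorProduct.ext' fun n a => ?_
  simp only [LinearMap.comp_apply, LinearMap.rTensor_tmul, LinearMap.restrictScalars_apply]
  induction n using polyBimod_induction with
  | zero => simp
  | add x y hx hy => simp only [TensorProduct.add_tmul, map_add, hx, hy]
  | smul c x hx =>
    have : g (c • x) = c • g x := (g.restrictScalars k).map_smul c x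
    rw [this, ← TensorProduct.smul_tmul', ← TensorProduct.smul_tmul', map_smul, map_smul, map_smul,
      hx]
  | inner w => rw [h, rtwist_inner]; rfl
  | left z hz => rw [g.map_smul, ← sandwich_apply, ← sandwich_apply, rtwist_left, rtwist_left, key, hz]
  | right z hz =>
    rw [g.map_smul, ← sandwich_apply, ← sandwich_apply, rtwist_right, rtwist_right, key, hz]

theorem vec_fin_one (v : Fin 1 → k) : v = v 0 • vec k 1 0 := by
  funext i
  rw [Subsingleton.elim i 0]
  simp [vec]

theorem subsingleton_exteriorPower_of_lt {m n : ℕ} (h : m < n) :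
    Subsingleton (⋀[k]^n (Fin m → k)) := by
  refine Module.finrank_zero_iff (R := k).1 ?_
  rw [exteriorPower.finrank_eq, Module.finrank_fin_fun, Nat.choose_eq_zero_of_lt h]

theorem FreeBimod.subsingleton {A : Type v} [Ring A] [Algebra k A] {W : Type*} [AddCommGroup W]
    [Module k W] [Subsingleton W] : Subsingleton (FreeBimod k A W) := by
  refine subsingleton_of_forall_eq 0 fun z => ?_
  induction z using FreeBimod.induction with
  | zero => rfl
  | add x y hx hy => rw [hx, hy, add_zero]
  | smul_inner a b w => rw [Subsingleton.elim w 0, ← innerₗ_apply, map_zero, smul_zero]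

theorem polyKos_subsingleton (n : ℕ) : Subsingleton (Kos k (Poly k) 1 (n + 2)) := by
  have := subsingleton_exteriorPower_of_lt (k := k) (show 1 < n + 2 by omega)
  exact FreeBimod.subsingleton

theorem polyD_gen (l : Fin 1 → Fin 1) : polyD k 0 (gen k (Poly k) l) =
    leftX k _ (gen k (Poly k) Fin.elim0) - rightX k _ (gen k (Poly k) Fin.elim0) := by
  rw [polyD, koszulD_gen _ _ _ _ (Subsingleton.strictMono l), koszulFormula]
  have e : ∀ l' : Fin 0 → Fin 1, gen k (Poly k) l' = gen k (Poly k) Fin.elim0 := fun l' => by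
    congr 1; exact Subsingleton.elim _ _
  simp [e]

theorem inner_eq_smul_gen_one (w : ⋀[k]^1 (Fin 1 → k)) :
    ∃ r : k, inner k (Poly k) w = r • gen k (Poly k) (fun _ : Fin 1 => (0 : Fin 1)) := by
  set v := exteriorPower.oneEquiv k (Fin 1 → k) w with hv
  refine ⟨v 0, ?_⟩
  have : w = v 0 • exteriorPower.ιMulti k 1 (fun _ : Fin 1 => vec k 1 0) := by
    refine (exteriorPower.oneEquiv k (Fin 1 → k)).injective ?_
    rw [map_smul, exteriorPower.oneEquiv_ιMulti, ← vec_fin_one, hv]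
  rw [this]
  exact (innerₗ k (Poly k) _).map_smul _ _

theorem inner_eq_smul_gen_zero {m : ℕ} (w : ⋀[k]^0 (Fin m → k)) :
    ∃ r : k, inner k A w = r • gen k A (Fin.elim0 : Fin 0 → Fin m) := by
  set r := exteriorPower.zeroEquiv k (Fin m → k) w with hr
  refine ⟨r, ?_⟩
  have : w = r • exteriorPower.ιMulti k 0 (fun p : Fin 0 => vec k m (p.elim0)) := by
    refine (exteriorPower.zeroEquiv k (Fin m → k)).injective ?_
    rw [map_smul, exteriorPower.zeroEquiv_ιMulti, ← hr, smul_eq_mul, mul_one]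
  rw [this]
  exact (innerₗ k A _).map_smul _ _

/-- When X ⊗ 1 - 1 ⊗ X crosses a, each of the two terms leaves δ(a) ⊗ (1 ⊗ 1) behind, and these
cancel. From degree two on the source of the differential is zero. -/
theorem polyD_rtwist (δ : A →ₗ[k] A) (n : ℕ) :
    ((polyD k n).restrictScalars k).lTensor A ∘ₗ rtwist δ =
      rtwist δ ∘ₗ ((polyD k n).restrictScalars k).rTensor A := by
  refine rtwist_natural δ (polyD k n) fun w a => ?_
  rcases n with _ | n
  · obtain ⟨r, hr⟩ := inner_eq_smul_gen_one w
    have : polyD k 0 (r • gen k (Poly k) (fun _ : Fin 1 => (0 : Fin 1))) = r • polyD k 0 _ :=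
      ((polyD k 0).restrictScalars k).map_smul r _
    rw [hr, this, polyD_gen, ← TensorProduct.smul_tmul', map_smul, TensorProduct.sub_tmul, map_sub,
      rtwist_left, rtwist_right, gen, wedge, rtwist_inner]
    simp [TensorProduct.tmul_sub]
  · have := polyKos_subsingleton (k := k) n
    rw [Subsingleton.elim (inner k (Poly k) w) 0]
    simp

/-- As k[X] is commutative, the left and right actions of X both become multiplication by X after
augmentation, and both shifted actions become `shift δ`. -/
theorem koszulAug_rtwist (δ : A →ₗ[k] A) :
    (koszulAug k (Poly k) 1).lTensor A ∘ₗ rtwist δ =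
      twist δ ∘ₗ (koszulAug k (Poly k) 1).rTensor A := by
  have key : ∀ (f : Kos k (Poly k) 1 0 →ₗ[k] Kos k (Poly k) 1 0)
      (_ : ∀ n, koszulAug k (Poly k) 1 (f n) = Polynomial.X * koszulAug k (Poly k) 1 n)
      (z : A ⊗[k] Kos k (Poly k) 1 0), (koszulAug k (Poly k) 1).lTensor A (shiftBy δ f z) =
        shift δ ((koszulAug k (Poly k) 1).lTensor A z) := by
    intro f hf z
    induction z with
    | zero => simp
    | add x y hx hy => simp only [map_add, hx, hy]
    | tmul a n => simp [hf, add_comm]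
  have hl : ∀ n, koszulAug k (Poly k) 1 (leftX k _ n) =
      Polynomial.X * koszulAug k (Poly k) 1 n := fun n => by
    rw [sandwich_apply, koszulAug_smul, mul_one]
  have hr : ∀ n, koszulAug k (Poly k) 1 (rightX k _ n) =
      Polynomial.X * koszulAug k (Poly k) 1 n := fun n => by
    rw [sandwich_apply, koszulAug_smul, one_mul, mul_comm]
  refine TensorProduct.ext' fun n a => ?_
  simp only [LinearMap.comp_apply, LinearMap.rTensor_tmul]
  induction n using polyBimod_induction with
  | zero => simp
  | add x y hx hy => simp only [TensorProduct.add_tmul, map_add, hx, hy]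
  | smul c x hx =>
    simp only [map_smul, ← TensorProduct.smul_tmul', hx]
  | inner w =>
    obtain ⟨r, hw⟩ := inner_eq_smul_gen_zero (A := Poly k) w
    rw [rtwist_inner, LinearMap.lTensor_tmul, hw, map_smul, gen, koszulAug_wedge,
      ← TensorProduct.smul_tmul', map_smul, twist_one, TensorProduct.tmul_smul]
  | left z hz => rw [← sandwich_apply, hl, rtwist_left, key _ hl, hz, twist_X_mul]
  | right z hz => rw [← sandwich_apply, hr, rtwist_right, key _ hr, hz, twist_X_mul]

theorem isCompatibleResolutionRight_rtwist {δ : A →ₗ[k] A}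
    (hδ : ∀ r s : A, δ (r * s) = δ r * s + r * δ s) :
    IsCompatibleResolutionRight (Q := Kos k (Poly k) 1) (twist δ) (polyD k)
      (koszulAug k (Poly k) 1) (fun _ => rtwist δ) where
  compatible _ := isCompatibleRight_rtwist δ hδ
  chain := polyD_rtwist δ
  lift := koszulAug_rtwist δ

end PolyResolution

/-! ### The Ore extension as a twisted tensor product -/

section OreMultiplication

variable {k : Type u} [Field k] {A T : Type v} [Ring A] [Algebra k A] [Ring T] [Algebra k T]

/-- The map `A ⊗ k[X] → T`, `a ⊗ p ↦ a p(y)`. -/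
noncomputable def evalRight (ι : A →ₐ[k] T) (y : T) : A ⊗[k] Poly k →ₗ[k] T :=
  LinearMap.mul' k T ∘ₗ TensorProduct.map ι.toLinearMap (Polynomial.aeval y).toLinearMap

@[simp]
theorem evalRight_tmul (ι : A →ₐ[k] T) (y : T) (a : A) (p : Poly k) :
    evalRight ι y (a ⊗ₜ p) = ι a * Polynomial.aeval y p := rfl

/-- The map `k[X] ⊗ A → T`, `p ⊗ a ↦ p(y) a`. -/
noncomputable def evalLeft (ι : A →ₐ[k] T) (y : T) : Poly k ⊗[k] A →ₗ[k] T :=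
  LinearMap.mul' k T ∘ₗ TensorProduct.map (Polynomial.aeval y).toLinearMap ι.toLinearMap

@[simp]
theorem evalLeft_tmul (ι : A →ₐ[k] T) (y : T) (a : A) (p : Poly k) :
    evalLeft ι y (p ⊗ₜ a) = Polynomial.aeval y p * ι a := rfl

variable {ι : A →ₐ[k] T} {y : T} {δ : A →ₗ[k] A}

/-- The Ore relation in its operator form: under A ⊗ k[X] → T, left multiplication by y corresponds
to `shift δ`. -/
theorem evalRight_shift (h : ∀ r : A, y * ι r = ι r * y + ι (δ r)) (z : A ⊗[k] Poly k) :
    evalRight ι y (shift δ z) = y * evalRight ι y z := by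
  induction z with
  | zero => simp
  | add x y hx hy => simp only [map_add, hx, hy, mul_add]
  | tmul a p =>
    simp only [shift_tmul, map_add, evalRight_tmul, map_mul, Polynomial.aeval_X]
    rw [← mul_assoc y, h, add_mul, mul_assoc, add_comm]

/-- The twisting rewrites p(y) a with the powers of y on the right, because both sides satisfy the
recursion given by left multiplication by y. -/
theorem evalRight_twist (h : ∀ r : A, y * ι r = ι r * y + ι (δ r)) :
    evalRight ι y ∘ₗ twist δ = evalLeft ι y := by
  refine polyTensor_ext (LinearMap.mulLeft k y) (by simp) ?_ ?_
  · intro p m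
    simp [twist_X_mul, evalRight_shift h]
  · intro p m
    simp [mul_assoc]

/-- A ⊗ k[X] is the space of finitely supported sequences in A, and on these the map is the one that
freeness over the powers of y declares bijective. -/
theorem evalRight_bijective (h : IsOreExtension ι y δ) : Function.Bijective (evalRight ι y) := by
  let g : A ⊗[k] Poly k ≃ₗ[k] (ℕ →₀ A) :=
    (LinearEquiv.lTensor A (Polynomial.toFinsuppIsoLinear k ≪≫ₗ
      AddMonoidAlgebra.coeffLinearEquiv k)) ≪≫ₗ TensorProduct.finsuppScalarRight k k A ℕ
  have hg : ∀ z, evalRight ι y z = (fun f : ℕ →₀ A => f.sum (fun n r => ι r * y ^ n)) (g z) := by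
    have hadd : ∀ f f' : ℕ →₀ A, (f + f').sum (fun n r => ι r * y ^ n) =
        f.sum (fun n r => ι r * y ^ n) + f'.sum (fun n r => ι r * y ^ n) := fun f f' =>
      Finsupp.sum_add_index' (by simp) (by simp [add_mul])
    intro z
    induction z with
    | zero => simp
    | add x y hx hy => simp only [map_add, hx, hy, hadd]
    | tmul a p =>
      induction p using Polynomial.induction_on' with
      | add p q hp hq => simp only [TensorProduct.tmul_add, map_add, hp, hq, hadd]
      | monomial n c =>
        have : g (a ⊗ₜ Polynomial.monomial n c) = Finsupp.single n (c • a) := by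
          simp [g, TensorProduct.finsuppScalarRight_apply_tmul]
        simp only [this, evalRight_tmul, Polynomial.aeval_monomial]
        rw [Finsupp.sum_single_index (by simp), map_smul, Algebra.smul_def, ← mul_assoc,
          Algebra.commutes]
  have : evalRight ι y = (fun f : ℕ →₀ A => f.sum (fun n r => ι r * y ^ n)) ∘ g := funext hg
  rw [this]
  exact h.basis.comp g.bijective

/-- The isomorphism `A ⊗ k[X] ≃ T`. -/
noncomputable def evalEquiv (h : IsOreExtension ι y δ) : A ⊗[k] Poly k ≃ₗ[k] T :=
  LinearEquiv.ofBijective (evalRight ι y) (evalRight_bijective h)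

theorem evalEquiv_apply (h : IsOreExtension ι y δ) (z : A ⊗[k] Poly k) :
    evalEquiv h z = evalRight ι y z := rfl

/-- The isomorphism `k[X] ⊗ A ≃ T`. -/
noncomputable def evalLeftEquiv (h : IsOreExtension ι y δ) : Poly k ⊗[k] A ≃ₗ[k] T :=
  twistEquiv δ ≪≫ₗ evalEquiv h

theorem evalLeftEquiv_apply (h : IsOreExtension ι y δ) (z : Poly k ⊗[k] A) :
    evalLeftEquiv h z = evalLeft ι y z :=
  LinearMap.congr_fun (evalRight_twist h.commute) z

theorem mul'_map_mul' {B : Type*} [Ring B] [Algebra k B] (f : A →ₐ[k] T) (g : B →ₐ[k] T) (a : A)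
    (z : A ⊗[k] B) (b : B) :
    LinearMap.mul' k T (TensorProduct.map f.toLinearMap g.toLinearMap
      (TensorProduct.map (LinearMap.mul' k A) (LinearMap.mul' k B)
        ((TensorProduct.assoc k A A (B ⊗[k] B)).symm
          (a ⊗ₜ (TensorProduct.assoc k A B B (z ⊗ₜ b)))))) =
      f a * LinearMap.mul' k T (TensorProduct.map f.toLinearMap g.toLinearMap z) * g b := by
  induction z with
  | zero =>
    simp only [TensorProduct.zero_tmul, TensorProduct.tmul_zero, map_zero, mul_zero, zero_mul]
  | add x y hx hy =>
    simp only [TensorProduct.add_tmul, TensorProduct.tmul_add, map_add, hx, hy, mul_add, add_mul]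
  | tmul c q =>
    simp [mul_assoc]

/-- In (a p)(a' p') only the middle product p a' has to be rewritten, and `evalRight_twist`
identifies it with the twisting. -/
theorem evalEquiv_twistMul (h : IsOreExtension ι y δ) (u v : A ⊗[k] Poly k) :
    evalEquiv h (twistMul (twist δ) (u ⊗ₜ v)) = evalEquiv h u * evalEquiv h v := by
  simp only [evalEquiv_apply]
  induction u with
  | zero => simp
  | add x y hx hy => simp only [TensorProduct.add_tmul, map_add, hx, hy, add_mul]
  | tmul a p =>
  induction v with
  | zero => simp
  | add x y hx hy => simp only [TensorProduct.tmul_add, map_add, hx, hy, mul_add]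
  | tmul a' p' =>
  have e : twistMul (twist δ) ((a ⊗ₜ p) ⊗ₜ (a' ⊗ₜ p')) =
      TensorProduct.map (LinearMap.mul' k A) (LinearMap.mul' k (Poly k))
        ((TensorProduct.assoc k A A (Poly k ⊗[k] Poly k)).symm
          (a ⊗ₜ (TensorProduct.assoc k A (Poly k) (Poly k) (twist δ (p ⊗ₜ a') ⊗ₜ p')))) := by
    simp only [twistMul, mid, TensorProduct.assoc_tmul, LinearMap.lTensor_tmul,
      LinearMap.comp_apply, LinearEquiv.coe_coe, TensorProduct.assoc_symm_tmul,
      LinearMap.rTensor_tmul]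
  have key : ∀ z : A ⊗[k] Poly k, evalRight ι y
      (TensorProduct.map (LinearMap.mul' k A) (LinearMap.mul' k (Poly k))
        ((TensorProduct.assoc k A A (Poly k ⊗[k] Poly k)).symm
          (a ⊗ₜ (TensorProduct.assoc k A (Poly k) (Poly k) (z ⊗ₜ p'))))) =
      ι a * evalRight ι y z * Polynomial.aeval y p' :=
    fun z => mul'_map_mul' ι (Polynomial.aeval y) a z p'
  have h2 : evalRight ι y (twist δ (p ⊗ₜ a')) = Polynomial.aeval y p * ι a' :=
    LinearMap.congr_fun (evalRight_twist h.commute) (p ⊗ₜ a')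
  rw [e, key, h2]
  simp only [evalRight_tmul, mul_assoc]

end OreMultiplication

/-! ### Tensor products of free bimodules as free bimodules over the Ore extension -/

section Gather

variable {k : Type u} [Field k] {A T : Type v} [Ring A] [Algebra k A] [Ring T] [Algebra k T]
  {ι : A →ₐ[k] T} {y : T} {δ : A →ₗ[k] A}
  {W W' : Type*} [AddCommGroup W] [Module k W] [AddCommGroup W'] [Module k W']

/-- The isomorphism `Aᵒᵖ ⊗ k[X]ᵒᵖ ≃ Tᵒᵖ`. -/
noncomputable def evalOpEquiv (h : IsOreExtension ι y δ) :
    Aᵐᵒᵖ ⊗[k] (Poly k)ᵐᵒᵖ ≃ₗ[k] Tᵐᵒᵖ :=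
  TensorProduct.congr (MulOpposite.opLinearEquiv k).symm (MulOpposite.opLinearEquiv k).symm ≪≫ₗ
    evalEquiv h ≪≫ₗ MulOpposite.opLinearEquiv k

/-- The rearrangement `(k[X] ⊗ (A ⊗ W ⊗ A)) ⊗ (k[X] ⊗ W') ≃ T ⊗ (W ⊗ W') ⊗ T`. -/
noncomputable def gather (h : IsOreExtension ι y δ) (W W' : Type*) [AddCommGroup W] [Module k W]
    [AddCommGroup W'] [Module k W'] :
    (Poly k ⊗[k] FreeBimod k A W) ⊗[k] ((Poly k)ᵐᵒᵖ ⊗[k] W') ≃ₗ[k] FreeBimod k T (W ⊗[k] W') :=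
  (TensorProduct.congr (TensorProduct.assoc k (Poly k) (Env k A) W).symm (LinearEquiv.refl k _) ≪≫ₗ
    TensorProduct.tensorTensorTensorComm k (Poly k ⊗[k] Env k A) W (Poly k)ᵐᵒᵖ W' ≪≫ₗ
    TensorProduct.congr
      (TensorProduct.congr (TensorProduct.assoc k (Poly k) A Aᵐᵒᵖ).symm (LinearEquiv.refl k _) ≪≫ₗ
        TensorProduct.assoc k (Poly k ⊗[k] A) Aᵐᵒᵖ (Poly k)ᵐᵒᵖ ≪≫ₗ
        TensorProduct.congr (evalLeftEquiv h) (evalOpEquiv h)) (LinearEquiv.refl k _) :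
    (Poly k ⊗[k] (Env k A ⊗[k] W)) ⊗[k] ((Poly k)ᵐᵒᵖ ⊗[k] W') ≃ₗ[k] Env k T ⊗[k] (W ⊗[k] W'))

/-- The left copy of T is read as k[X] ⊗ A and the right one as A ⊗ k[X]. The coefficients in A thus
stay next to w, while the polynomials in y are outermost. -/
theorem gather_tmul (h : IsOreExtension ι y δ) (p q : Poly k) (a b : A) (w : W) (w' : W') :
    gather h W W' ((p ⊗ₜ ((a ⊗ₜ[k] MulOpposite.op b : Env k A) • inner k A w)) ⊗ₜ
      (MulOpposite.op q ⊗ₜ w')) =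
      ((Polynomial.aeval y p * ι a) ⊗ₜ[k] MulOpposite.op (ι b * Polynomial.aeval y q) : Env k T) •
        inner k T (w ⊗ₜ w') := by
  rw [smul_inner, smul_inner, ← evalLeft_tmul, ← evalRight_tmul, ← evalLeftEquiv_apply h,
    ← evalEquiv_apply h]
  rfl

theorem gather_left (h : IsOreExtension ι y δ) (z : Poly k ⊗[k] FreeBimod k A W)
    (x : (Poly k)ᵐᵒᵖ ⊗[k] W') :
    gather h W W' ((LinearMap.mulLeft k (Polynomial.X : Poly k)).rTensor _ z ⊗ₜ x) =
      sandwich k y 1 (gather h W W' (z ⊗ₜ x)) := by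
  induction x with
  | zero => simp
  | add x y hx hy => simp only [TensorProduct.tmul_add, map_add, hx, hy]
  | tmul q w' =>
  induction z with
  | zero => simp
  | add x y hx hy => simp only [TensorProduct.add_tmul, map_add, hx, hy]
  | tmul p m =>
  induction m using FreeBimod.induction with
  | zero => simp
  | add x y hx hy => simp only [TensorProduct.tmul_add, TensorProduct.add_tmul, map_add, hx, hy]
  | smul_inner a b w =>
    rw [← MulOpposite.op_unop q, LinearMap.rTensor_tmul, gather_tmul, gather_tmul, sandwich_apply,
      tmul_op_smul_smul]
    simp [mul_assoc]

theorem gather_right (h : IsOreExtension ι y δ) (z : Poly k ⊗[k] FreeBimod k A W)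
    (q : Poly k) (w' : W') :
    gather h W W' (z ⊗ₜ (MulOpposite.op (q * Polynomial.X) ⊗ₜ w')) =
      sandwich k 1 y (gather h W W' (z ⊗ₜ (MulOpposite.op q ⊗ₜ w'))) := by
  induction z with
  | zero => simp
  | add x y hx hy => simp only [TensorProduct.add_tmul, map_add, hx, hy]
  | tmul p m =>
  induction m using FreeBimod.induction with
  | zero => simp
  | add x y hx hy => simp only [TensorProduct.tmul_add, TensorProduct.add_tmul, map_add, hx, hy]
  | smul_inner a b w =>
    rw [gather_tmul, gather_tmul, sandwich_apply, tmul_op_smul_smul]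
    simp [mul_assoc]

/-- The isomorphism `(A ⊗ W ⊗ A) ⊗ (k[X] ⊗ W' ⊗ k[X]) ≃ T ⊗ (W ⊗ W') ⊗ T` of the twisted product of
two free bimodules with a free bimodule. -/
noncomputable def twistedEquiv (h : IsOreExtension ι y δ) (E : W →ₗ[k] W)
    (W' : Type*) [AddCommGroup W'] [Module k W'] :
    FreeBimod k A W ⊗[k] FreeBimod k (Poly k) W' ≃ₗ[k] FreeBimod k T (W ⊗[k] W') :=
  (TensorProduct.congr (LinearEquiv.refl k (FreeBimod k A W))
      (TensorProduct.assoc k (Poly k) (Poly k)ᵐᵒᵖ W') ≪≫ₗ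
    (TensorProduct.assoc k (FreeBimod k A W) (Poly k) ((Poly k)ᵐᵒᵖ ⊗[k] W')).symm ≪≫ₗ
    TensorProduct.congr (twistEquiv (bimodDer δ E)).symm (LinearEquiv.refl k _) ≪≫ₗ
    gather h W W' :
    FreeBimod k A W ⊗[k] (Env k (Poly k) ⊗[k] W') ≃ₗ[k] FreeBimod k T (W ⊗[k] W'))

variable (h : IsOreExtension ι y δ) (E : W →ₗ[k] W)

theorem twistedEquiv_tmul (m : FreeBimod k A W) (p q : Poly k) (w' : W') :
    twistedEquiv h E W' (m ⊗ₜ ((p ⊗ₜ[k] MulOpposite.op q : Env k (Poly k)) •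
      inner k (Poly k) w')) =
    gather h W W' ((twistEquiv (bimodDer δ E)).symm (m ⊗ₜ p) ⊗ₜ (MulOpposite.op q ⊗ₜ w')) := by
  rw [smul_inner]
  rfl

theorem twistedEquiv_inner (a b : A) (w : W) (w' : W') :
    twistedEquiv h E W' (((a ⊗ₜ[k] MulOpposite.op b : Env k A) • inner k A w) ⊗ₜ
      inner k (Poly k) w') =
    (ι a ⊗ₜ[k] MulOpposite.op (ι b) : Env k T) • inner k T (w ⊗ₜ w') := by
  rw [← one_tmul_op_one_smul (k := k) (A := Poly k) (inner k (Poly k) w'), twistedEquiv_tmul, twistEquiv_symm_one,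
    gather_tmul]
  simp

theorem twistedEquiv_right (m : FreeBimod k A W) (n : FreeBimod k (Poly k) W') :
    twistedEquiv h E W' (m ⊗ₜ rightX k _ n) = sandwich k 1 y (twistedEquiv h E W' (m ⊗ₜ n)) := by
  induction n using FreeBimod.induction with
  | zero => simp
  | add x y hx hy => simp only [TensorProduct.tmul_add, map_add, hx, hy]
  | smul_inner p q w' =>
    rw [sandwich_apply, tmul_op_smul_smul, one_mul, twistedEquiv_tmul, gather_right,
      twistedEquiv_tmul]

/-- This is the rule y (m ⊗ n) = m ⊗ X n + D(m) ⊗ n of the twisted action, solved for the term in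
which X reaches n. -/
theorem twistedEquiv_left (m : FreeBimod k A W) (n : FreeBimod k (Poly k) W') :
    twistedEquiv h E W' (m ⊗ₜ leftX k _ n) = sandwich k y 1 (twistedEquiv h E W' (m ⊗ₜ n)) -
      twistedEquiv h E W' (bimodDer δ E m ⊗ₜ n) := by
  induction n using FreeBimod.induction with
  | zero => simp
  | add x y hx hy => simp only [TensorProduct.tmul_add, map_add, hx, hy]; abel
  | smul_inner p q w' =>
    rw [sandwich_apply, tmul_op_smul_smul, mul_one, twistedEquiv_tmul, twistEquiv_symm_X_mul,
      TensorProduct.sub_tmul, map_sub, gather_left, twistedEquiv_tmul, twistedEquiv_tmul]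

theorem twistedEquiv_smul_inner (a b : A) (m : FreeBimod k A W) (w' : W') :
    twistedEquiv h E W' (sandwich k a b m ⊗ₜ inner k (Poly k) w') =
      sandwich k (ι a) (ι b) (twistedEquiv h E W' (m ⊗ₜ inner k (Poly k) w')) := by
  induction m using FreeBimod.induction with
  | zero => simp
  | add x y hx hy => simp only [TensorProduct.add_tmul, map_add, hx, hy]
  | smul_inner c d w =>
    rw [sandwich_apply, tmul_op_smul_smul, twistedEquiv_inner, twistedEquiv_inner, sandwich_apply,
      tmul_op_smul_smul, map_mul, map_mul]

theorem sandwich_sandwich {R : Type*} [Ring R] [Algebra k R] {M : Type*} [AddCommGroup M]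
    [Module k M] [Module (Env k R) M] [IsScalarTower k (Env k R) M] (a b c d : R) (m : M) :
    sandwich k a b (sandwich k c d m) = sandwich k (a * c) (d * b) m := by
  simp only [sandwich_apply, tmul_op_smul_smul]

theorem sandwich_add_left {R : Type*} [Ring R] [Algebra k R] {M : Type*} [AddCommGroup M]
    [Module k M] [Module (Env k R) M] [IsScalarTower k (Env k R) M] (a b c : R) (m : M) :
    sandwich k (a + b) c m = sandwich k a c m + sandwich k b c m := by
  simp only [sandwich_apply, TensorProduct.add_tmul, add_smul]

theorem sandwich_add_right {R : Type*} [Ring R] [Algebra k R] {M : Type*} [AddCommGroup M]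
    [Module k M] [Module (Env k R) M] [IsScalarTower k (Env k R) M] (a b c : R) (m : M) :
    sandwich k a (b + c) m = sandwich k a b m + sandwich k a c m := by
  simp only [sandwich_apply, MulOpposite.op_add, TensorProduct.tmul_add, add_smul]

theorem bimodDer_sandwich (hδ : ∀ r s : A, δ (r * s) = δ r * s + r * δ s) (a b : A)
    (m : FreeBimod k A W) : bimodDer δ E (sandwich k a b m) = sandwich k (δ a) b m +
      sandwich k a (δ b) m + sandwich k a b (bimodDer δ E m) :=
  bimodDer_smul δ hδ E a b m

/-- Linearity over A is immediate only when n is a free generator, because a left polynomial in n is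
moved to the left of a by the inverse twisting. -/
theorem twistedEquiv_smul_left (a : A) (m : FreeBimod k A W) (n : FreeBimod k (Poly k) W') :
    twistedEquiv h E W' (sandwich k a 1 m ⊗ₜ n) =
      sandwich k (ι a) 1 (twistedEquiv h E W' (m ⊗ₜ n)) := by
  have h1 : δ 1 = 0 := by simpa using h.leibniz 1 1
  have hz : ∀ (a : A) (x : FreeBimod k A W), sandwich k a 0 x = 0 := fun a x => by
    rw [sandwich_apply, MulOpposite.op_zero, tmul_zero_smul]
  induction n using polyBimod_induction generalizing a m with
  | zero => simp
  | add x y hx hy => simp only [TensorProduct.tmul_add, map_add, hx, hy]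
  | smul c x hx => simp only [TensorProduct.tmul_smul, map_smul, hx]
  | inner w => rw [twistedEquiv_smul_inner, map_one]
  | right z hz' =>
    rw [← sandwich_apply, twistedEquiv_right, twistedEquiv_right, hz', sandwich_sandwich,
      sandwich_sandwich]
    simp
  -- The term with δ(a) that the Leibniz rule yields for D(a m) is the one by which y a differs from
  -- a y.
  | left z hz' =>
    rw [← sandwich_apply, twistedEquiv_left, twistedEquiv_left, bimodDer_sandwich E h.leibniz, h1,
      hz, add_zero, TensorProduct.add_tmul, map_add, hz', hz', hz', map_sub, sandwich_sandwich,
      sandwich_sandwich, h.commute, sandwich_add_left, mul_one]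
    abel

end Gather

/-! ### The two-sided action on a twisted product -/

section TwistedAct

variable {k : Type u} [Field k] {A : Type v} [Ring A] [Algebra k A] {B : Type w} [Ring B]
  [Algebra k B] {M N : Type*}
  [AddCommGroup M] [Module k M] [Module (Env k A) M] [IsScalarTower k (Env k A) M]
  [AddCommGroup N] [Module k N] [Module (Env k B) N] [IsScalarTower k (Env k B) N]

/-- The map `b ⊗ q ↦ (a · m · b) ⊗ (q · n · p)`. -/
noncomputable def outerAct (a : A) (p : B) (m : M) (n : N) : A ⊗[k] B →ₗ[k] M ⊗[k] N :=
  TensorProduct.map (bimodAct k A M ∘ₗ TensorProduct.mk k A (M ⊗[k] A) a ∘ₗ TensorProduct.mk k M A m)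
    (bimodAct k B N ∘ₗ (TensorProduct.mk k B (N ⊗[k] B)).flip (n ⊗ₜ p))

@[simp]
theorem outerAct_tmul (a b : A) (p q : B) (m : M) (n : N) :
    outerAct a p m n (b ⊗ₜ q) = sandwich k a b m ⊗ₜ[k] sandwich k q p n := by
  simp only [outerAct, TensorProduct.map_tmul, LinearMap.comp_apply, TensorProduct.mk_apply,
    LinearMap.flip_apply, bimodAct_tmul, sandwich_apply]

/-- The last steps `(ρ ⊗ ρ)(1 ⊗ 1 ⊗ τ ⊗ 1 ⊗ 1)` of the two-sided action on `M ⊗ N`. -/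
noncomputable def actTail (τ : B ⊗[k] A →ₗ[k] A ⊗[k] B) (a : A) (p : B) :
    (M ⊗[k] B) ⊗[k] (A ⊗[k] N) →ₗ[k] M ⊗[k] N :=
  TensorProduct.map (bimodAct k A M ∘ₗ TensorProduct.mk k A (M ⊗[k] A) a)
    (bimodAct k B N ∘ₗ ((TensorProduct.mk k N B).flip p).lTensor B) ∘ₗ mid τ

theorem actTail_tmul (τ : B ⊗[k] A →ₗ[k] A ⊗[k] B) (a b : A) (p q : B) (m : M) (n : N) :
    actTail τ a p ((m ⊗ₜ q) ⊗ₜ (b ⊗ₜ n)) = outerAct a p m n (τ (q ⊗ₜ b)) := by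
  simp only [actTail, mid, LinearMap.comp_apply, LinearEquiv.coe_coe, TensorProduct.assoc_tmul,
    LinearMap.lTensor_tmul, TensorProduct.assoc_symm_tmul, LinearMap.rTensor_tmul]
  generalize τ (q ⊗ₜ b) = z
  induction z with
  | zero => simp only [TensorProduct.zero_tmul, TensorProduct.tmul_zero, map_zero]
  | add x y hx hy => simp only [TensorProduct.add_tmul, TensorProduct.tmul_add, map_add, hx, hy]
  | tmul b q =>
    simp only [TensorProduct.assoc_tmul, TensorProduct.assoc_symm_tmul, TensorProduct.map_tmul,
      LinearMap.comp_apply, LinearMap.lTensor_tmul, TensorProduct.mk_apply,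
      LinearMap.flip_apply, bimodAct_tmul, outerAct_tmul, sandwich_apply]

/-- The first crossings, of p past m and of n past a', are separated from the remaining steps, so
that inductions on p and on n can use the recursions of the two twistings. -/
theorem twistedAct_tmul (τ : B ⊗[k] A →ₗ[k] A ⊗[k] B)
    (τM : B ⊗[k] M →ₗ[k] M ⊗[k] B) (τN : N ⊗[k] A →ₗ[k] A ⊗[k] N) (a a' : A) (p p' : B)
    (m : M) (n : N) :
    twistedAct τ τM τN ((a ⊗ₜ p) ⊗ₜ ((m ⊗ₜ n) ⊗ₜ (a' ⊗ₜ p'))) =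
      actTail τ a p' (τM (p ⊗ₜ m) ⊗ₜ τN (n ⊗ₜ a')) := by
  simp only [twistedAct, LinearMap.comp_apply, LinearEquiv.coe_coe, TensorProduct.assoc_tmul,
    LinearMap.lTensor_tmul, TensorProduct.assoc_symm_tmul, TensorProduct.map_tmul,
    LinearMap.rTensor_tmul]
  generalize τM (p ⊗ₜ m) = y
  generalize τN (n ⊗ₜ a') = z
  induction y with
  | zero => simp only [TensorProduct.zero_tmul, TensorProduct.tmul_zero, map_zero]
  | add x y hx hy => simp only [TensorProduct.add_tmul, TensorProduct.tmul_add, map_add, hx, hy]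
  | tmul m q =>
  induction z with
  | zero => simp only [TensorProduct.zero_tmul, TensorProduct.tmul_zero, map_zero]
  | add x y hx hy => simp only [TensorProduct.add_tmul, TensorProduct.tmul_add, map_add, hx, hy]
  | tmul b n =>
  simp only [actTail_tmul, onLeft, LinearMap.comp_apply, LinearEquiv.coe_coe,
    TensorProduct.assoc_tmul, LinearMap.lTensor_tmul, TensorProduct.assoc_symm_tmul,
    LinearMap.rTensor_tmul]
  generalize τ (q ⊗ₜ b) = z
  induction z with
  | zero => simp only [TensorProduct.zero_tmul, TensorProduct.tmul_zero, map_zero]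
  | add x y hx hy => simp only [TensorProduct.add_tmul, TensorProduct.tmul_add, map_add, hx, hy]
  | tmul b q =>
    simp only [TensorProduct.assoc_tmul, TensorProduct.assoc_symm_tmul, TensorProduct.map_tmul,
      bimodAct_tmul, outerAct_tmul, sandwich_apply]

end TwistedAct

/-! ### Bimodule maps on twisted products, described on generators -/

section TwistedBimodMap

variable {k : Type u} [Field k] {A T : Type v} [Ring A] [Algebra k A] [Ring T] [Algebra k T]
  {W W' : Type*} [AddCommGroup W] [Module k W] [AddCommGroup W'] [Module k W']
  {Z : Type*} [AddCommGroup Z] [Module k Z] [Module (Env k T) Z] [IsScalarTower k (Env k T) Z]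

/-- `F : (A ⊗ W ⊗ A) ⊗ (k[X] ⊗ W' ⊗ k[X]) → Z` is a map of bimodules over `T = A[y; 1, δ]`, where
`y m = m X + D(m)`; only the action of generators on suitable elements is spelled out. -/
structure IsTwistedBimodMap (ι : A →ₐ[k] T) (y : T) (D : FreeBimod k A W →ₗ[k] FreeBimod k A W)
    (F : FreeBimod k A W ⊗[k] FreeBimod k (Poly k) W' →ₗ[k] Z) : Prop where
  smul_left : ∀ a m n, F (sandwich k a 1 m ⊗ₜ n) = sandwich k (ι a) 1 (F (m ⊗ₜ n))
  left : ∀ m n, F (m ⊗ₜ leftX k _ n) = sandwich k y 1 (F (m ⊗ₜ n)) - F (D m ⊗ₜ n)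
  right : ∀ m n, F (m ⊗ₜ rightX k _ n) = sandwich k 1 y (F (m ⊗ₜ n))
  smul_right : ∀ a m w, F (sandwich k 1 a m ⊗ₜ inner k (Poly k) w) =
    sandwich k 1 (ι a) (F (m ⊗ₜ inner k (Poly k) w))

variable {ι : A →ₐ[k] T} {y : T} {δ : A →ₗ[k] A} {E : W →ₗ[k] W}
  {F G : FreeBimod k A W ⊗[k] FreeBimod k (Poly k) W' →ₗ[k] Z}

namespace IsTwistedBimodMap

/-- The four rules strip off first the polynomials of n and then the coefficients of m, until only
free generators are left. The induction on n must allow all m, since the rule for the left action of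
X brings in D(m). -/
theorem ext' {D : FreeBimod k A W →ₗ[k] FreeBimod k A W} (hF : IsTwistedBimodMap ι y D F)
    (hG : IsTwistedBimodMap ι y D G) {S : Set W} {S' : Set W'} (hS : Submodule.span k S = ⊤)
    (hS' : Submodule.span k S' = ⊤)
    (h : ∀ w ∈ S, ∀ w' ∈ S', F (inner k A w ⊗ₜ inner k (Poly k) w') =
      G (inner k A w ⊗ₜ inner k (Poly k) w')) : F = G := by
  have h0 : ∀ w w', F (inner k A w ⊗ₜ inner k (Poly k) w') =
      G (inner k A w ⊗ₜ inner k (Poly k) w') := by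
    have h1 : ∀ w ∈ S, ∀ w', F (inner k A w ⊗ₜ inner k (Poly k) w') =
        G (inner k A w ⊗ₜ inner k (Poly k) w') := fun w hw w' => by
      have := LinearMap.ext_on hS' (f := F ∘ₗ TensorProduct.mk k _ _ (inner k A w) ∘ₗ
        innerₗ k (Poly k) W') (g := G ∘ₗ TensorProduct.mk k _ _ (inner k A w) ∘ₗ
        innerₗ k (Poly k) W') fun w' hw' => h w hw w' hw'
      exact LinearMap.congr_fun this w'
    intro w w'
    have := LinearMap.ext_on hS (f := F ∘ₗ (TensorProduct.mk k _ _).flip (inner k (Poly k) w') ∘ₗ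
        innerₗ k A W) (g := G ∘ₗ (TensorProduct.mk k _ _).flip (inner k (Poly k) w') ∘ₗ
        innerₗ k A W) fun w hw => h1 w hw w'
    exact LinearMap.congr_fun this w
  refine TensorProduct.ext' fun m n => ?_
  induction n using polyBimod_induction generalizing m with
  | zero => simp
  | add x y hx hy => simp only [TensorProduct.tmul_add, map_add, hx, hy]
  | smul c x hx => simp only [TensorProduct.tmul_smul, map_smul, hx]
  | left z hz => rw [← sandwich_apply, hF.left, hG.left, hz, hz]
  | right z hz => rw [← sandwich_apply, hF.right, hG.right, hz]
  | inner w' =>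
  induction m using FreeBimod.induction with
  | zero => simp
  | add x y hx hy => simp only [TensorProduct.add_tmul, map_add, hx, hy]
  | smul_inner a b w =>
    have : (a ⊗ₜ[k] MulOpposite.op b : Env k A) • inner k A w =
        sandwich k a 1 (sandwich k 1 b (inner k A w)) := by
      rw [sandwich_sandwich, mul_one, mul_one, sandwich_apply]
    rw [this, hF.smul_left, hG.smul_left, hF.smul_right, hG.smul_right, h0]

variable (hF : IsTwistedBimodMap ι y (bimodDer δ E) F)
include hF

/-- The right action of A is prescribed only on free generators of the second factor. The recursions
of `rtwist` propagate it to every n, with the Ore relation absorbing the δ(a) that appears when X on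
the right crosses a. -/
theorem rtwist_act (hδ : ∀ r s : A, δ (r * s) = δ r * s + r * δ s)
    (hy : ∀ r : A, y * ι r = ι r * y + ι (δ r)) (m : FreeBimod k A W) (n : FreeBimod k (Poly k) W')
    (a : A) :
    F (actTail (twist δ) 1 1 ((m ⊗ₜ 1) ⊗ₜ rtwist δ (n ⊗ₜ a))) =
      sandwich k 1 (ι a) (F (m ⊗ₜ n)) := by
  have h1 : δ 1 = 0 := by simpa using hδ 1 1
  have t : ∀ (m : FreeBimod k A W) (b : A) (n : FreeBimod k (Poly k) W'),
      actTail (twist δ) 1 1 ((m ⊗ₜ (1 : Poly k)) ⊗ₜ (b ⊗ₜ n)) = sandwich k 1 b m ⊗ₜ n := by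
    intro m b n
    rw [actTail_tmul, twist_one, outerAct_tmul, sandwich_apply 1 1, one_tmul_op_one_smul]
  have hz : ∀ (a : A) (x : FreeBimod k A W), sandwich k 0 a x = 0 := fun a x => by
    rw [sandwich_apply, zero_tmul_smul]
  induction n using polyBimod_induction generalizing a m with
  | zero => simp
  | add x y hx hy => simp only [TensorProduct.tmul_add, TensorProduct.add_tmul, map_add, hx, hy]
  | smul c x hx =>
    simp only [← TensorProduct.smul_tmul', map_smul, TensorProduct.tmul_smul, hx]
  | inner w => rw [rtwist_inner, t, hF.smul_right]
  | left n hn =>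
    have e : sandwich k 1 (ι a) (F (m ⊗ₜ[k] leftX k (FreeBimod k (Poly k) W') n)) =
        sandwich k y 1 (sandwich k 1 (ι a) (F (m ⊗ₜ n))) -
          sandwich k 1 (ι a) (F (bimodDer δ E m ⊗ₜ n)) := by
      rw [hF.left, map_sub, sandwich_sandwich, sandwich_sandwich]
      simp only [mul_one, one_mul]
    rw [← sandwich_apply, rtwist_left, e, ← hn, ← hn]
    generalize rtwist δ (n ⊗ₜ a) = z
    clear hn e
    induction z with
    | zero => simp
    | add x y hx hy =>
      simp only [TensorProduct.tmul_add, map_add, hx, hy]; abel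
    | tmul b n =>
      rw [shiftBy_tmul, TensorProduct.tmul_add, map_add, map_add, t, t, t, t, hF.left,
        bimodDer_sandwich _ hδ, h1, hz, TensorProduct.add_tmul, TensorProduct.add_tmul, map_add,
        map_add, TensorProduct.zero_tmul, map_zero]
      abel
  | right n hn =>
    have e : sandwich k 1 (ι a) (F (m ⊗ₜ[k] rightX k (FreeBimod k (Poly k) W') n)) =
        sandwich k 1 y (sandwich k 1 (ι a) (F (m ⊗ₜ n))) +
          sandwich k 1 (ι (δ a)) (F (m ⊗ₜ n)) := by
      rw [hF.right, sandwich_sandwich, hy, sandwich_add_right, sandwich_sandwich, mul_one]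
    rw [← sandwich_apply, rtwist_right, e, ← hn, ← hn, rtwist_lTensor]
    generalize rtwist δ (n ⊗ₜ a) = z
    clear hn e
    induction z with
    | zero => simp
    | add x y hx hy =>
      simp only [TensorProduct.tmul_add, map_add, hx, hy]; abel
    | tmul b n =>
      rw [shiftBy_tmul, LinearMap.rTensor_tmul, TensorProduct.tmul_add, map_add, map_add, t, t, t,
        hF.right]

/-- Left multiplication by y: the operator `shift` on the first pair accounts for D(m), and moving X
past b contributes δ(b). Both belong to D(m b), the correction term in the rule for the left action.
-/
theorem actTail_shift (hδ : ∀ r s : A, δ (r * s) = δ r * s + r * δ s)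
    (x : FreeBimod k A W ⊗[k] Poly k) (z : A ⊗[k] FreeBimod k (Poly k) W') :
    F (actTail (twist δ) 1 1 (shift (bimodDer δ E) x ⊗ₜ z)) =
      sandwich k y 1 (F (actTail (twist δ) 1 1 (x ⊗ₜ z))) := by
  have h1 : δ 1 = 0 := by simpa using hδ 1 1
  have hz : ∀ (a : A) (x : FreeBimod k A W), sandwich k 0 a x = 0 := fun a x => by
    rw [sandwich_apply, zero_tmul_smul]
  induction x with
  | zero => simp
  | add x y hx hy => simp only [TensorProduct.add_tmul, map_add, hx, hy]
  | tmul m q =>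
  induction z with
  | zero => simp
  | add x y hx hy => simp only [TensorProduct.tmul_add, map_add, hx, hy]
  | tmul b n =>
  rw [shift_tmul, TensorProduct.add_tmul, map_add, map_add, actTail_tmul, actTail_tmul,
    actTail_tmul, twist_X_mul]
  generalize twist δ (q ⊗ₜ b) = u
  induction u with
  | zero => simp
  | add x y hx hy =>
    simp only [map_add] at hx hy ⊢
    rw [← hx, ← hy]; abel
  | tmul b q =>
    have e : sandwich k (Polynomial.X * q) 1 n = leftX k _ (sandwich k q 1 n) := by
      rw [sandwich_sandwich, one_mul]
    rw [shift_tmul, map_add, map_add, outerAct_tmul, outerAct_tmul, outerAct_tmul, outerAct_tmul,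
      e, hF.left, bimodDer_sandwich _ hδ, h1, hz, TensorProduct.add_tmul, TensorProduct.add_tmul,
      map_add, map_add, TensorProduct.zero_tmul, map_zero]
    abel

theorem right_aeval (m : FreeBimod k A W) (n : FreeBimod k (Poly k) W') (p : Poly k) :
    F (m ⊗ₜ sandwich k 1 p n) = sandwich k 1 (Polynomial.aeval y p) (F (m ⊗ₜ n)) := by
  induction p using poly_induction with
  | add p p' hp hp' =>
    rw [sandwich_add_right, TensorProduct.tmul_add, map_add, hp, hp', map_add, sandwich_add_right]
  | smul c p hp =>
    rw [sandwich_smul_right, TensorProduct.tmul_smul, map_smul, hp, map_smul, sandwich_smul_right]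
  | one => rw [map_one, sandwich_apply, one_tmul_op_one_smul, sandwich_apply, one_tmul_op_one_smul]
  | X_mul p hp =>
    have : sandwich k 1 (Polynomial.X * p) n = rightX k _ (sandwich k 1 p n) := by
      rw [sandwich_sandwich, one_mul, mul_comm]
    rw [this, hF.right, hp, sandwich_sandwich, mul_comm Polynomial.X p, map_mul,
      Polynomial.aeval_X, one_mul]

theorem actTail_outer (a : A) (p : Poly k) (x : FreeBimod k A W ⊗[k] Poly k)
    (z : A ⊗[k] FreeBimod k (Poly k) W') :
    F (actTail (twist δ) a p (x ⊗ₜ z)) = sandwich k (ι a) (Polynomial.aeval y p)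
      (F (actTail (twist δ) 1 1 (x ⊗ₜ z))) := by
  induction x with
  | zero => simp
  | add x y hx hy => simp only [TensorProduct.add_tmul, map_add, hx, hy]
  | tmul m q =>
  induction z with
  | zero => simp
  | add x y hx hy => simp only [TensorProduct.tmul_add, map_add, hx, hy]
  | tmul b n =>
  rw [actTail_tmul, actTail_tmul]
  generalize twist δ (q ⊗ₜ b) = u
  induction u with
  | zero => simp
  | add x y hx hy => simp only [map_add, hx, hy]
  | tmul b q =>
    have e1 : sandwich k a b m = sandwich k a 1 (sandwich k 1 b m) := by
      rw [sandwich_sandwich, mul_one, mul_one]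
    have e2 : sandwich k q p n = sandwich k 1 p (sandwich k q 1 n) := by
      rw [sandwich_sandwich, one_mul, one_mul]
    rw [outerAct_tmul, outerAct_tmul, e1, e2, hF.smul_left, hF.right_aeval, sandwich_sandwich,
      mul_one, mul_one]

/-- The four rules determine the whole action. The outer factors are removed by `actTail_outer`;
what remains is an induction on the left polynomial, with base `rtwist_act` and inductive step
`actTail_shift`. -/
theorem twistedAct (h : IsOreExtension ι y δ) (u v : A ⊗[k] Poly k)
    (z : FreeBimod k A W ⊗[k] FreeBimod k (Poly k) W') :
    F (twistedAct (twist δ) (twist (bimodDer δ E)) (rtwist δ) (u ⊗ₜ (z ⊗ₜ v))) =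
      (evalEquiv h u ⊗ₜ[k] MulOpposite.op (evalEquiv h v) : Env k T) • F z := by
  rw [← sandwich_apply]
  simp only [evalEquiv_apply]
  induction u with
  | zero =>
    rw [TensorProduct.zero_tmul, map_zero, map_zero, map_zero, sandwich_apply, zero_tmul_smul]
  | add x y hx hy => simp only [TensorProduct.add_tmul, map_add, hx, hy, sandwich_add_left]
  | tmul a p =>
  induction v with
  | zero =>
    rw [TensorProduct.tmul_zero, TensorProduct.tmul_zero, map_zero, map_zero, map_zero,
      sandwich_apply, MulOpposite.op_zero, tmul_zero_smul]
  | add x y hx hy => simp only [TensorProduct.tmul_add, map_add, hx, hy, sandwich_add_right]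
  | tmul a' p' =>
  induction z with
  | zero => rw [TensorProduct.zero_tmul, TensorProduct.tmul_zero, map_zero, map_zero, map_zero]
  | add x y hx hy => simp only [TensorProduct.tmul_add, TensorProduct.add_tmul, map_add, hx, hy]
  | tmul m n =>
  rw [twistedAct_tmul, hF.actTail_outer, evalRight_tmul, evalRight_tmul]
  have : F (actTail (twist δ) 1 1 (twist (bimodDer δ E) (p ⊗ₜ m) ⊗ₜ rtwist δ (n ⊗ₜ a'))) =
      sandwich k (Polynomial.aeval y p) (ι a') (F (m ⊗ₜ n)) := by
    induction p using poly_induction with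
    | add p p' hp hp' =>
      simp only [TensorProduct.add_tmul, map_add, hp, hp', sandwich_add_left]
    | smul c p hp =>
      simp only [← TensorProduct.smul_tmul', map_smul, hp, sandwich_smul_left]
    | one => rw [twist_one, hF.rtwist_act h.leibniz h.commute, map_one]
    | X_mul p hp =>
      rw [twist_X_mul, hF.actTail_shift h.leibniz, hp, sandwich_sandwich, map_mul,
        Polynomial.aeval_X, mul_one]
  rw [this, sandwich_sandwich]

end IsTwistedBimodMap

theorem isTwistedBimodMap_twistedEquiv (h : IsOreExtension ι y δ) (E : W →ₗ[k] W) :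
    IsTwistedBimodMap ι y (bimodDer δ E) (twistedEquiv h E W').toLinearMap where
  smul_left a m n := twistedEquiv_smul_left h E a m n
  left := twistedEquiv_left h E
  right := twistedEquiv_right h E
  smul_right a m w := by
    have := twistedEquiv_smul_inner h E (1 : A) a m w
    rwa [map_one] at this

theorem map_sandwich {Z' : Type*}
    [AddCommGroup Z'] [Module k Z'] [Module (Env k T) Z'] [IsScalarTower k (Env k T) Z']
    (g : Z →ₗ[Env k T] Z') (a b : T) (z : Z) :
    g.restrictScalars k (sandwich k a b z) = sandwich k a b (g.restrictScalars k z) :=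
  g.map_smul _ z

theorem IsTwistedBimodMap.comp {D : FreeBimod k A W →ₗ[k] FreeBimod k A W} {Z' : Type*}
    [AddCommGroup Z'] [Module k Z'] [Module (Env k T) Z'] [IsScalarTower k (Env k T) Z']
    (hF : IsTwistedBimodMap ι y D F) (g : Z →ₗ[Env k T] Z') :
    IsTwistedBimodMap ι y D (g.restrictScalars k ∘ₗ F) where
  smul_left a m n := by
    rw [LinearMap.comp_apply, hF.smul_left, map_sandwich, LinearMap.comp_apply]
  left m n := by
    rw [LinearMap.comp_apply, hF.left, map_sub, map_sandwich, LinearMap.comp_apply,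
      LinearMap.comp_apply]
  right m n := by
    rw [LinearMap.comp_apply, hF.right, map_sandwich, LinearMap.comp_apply]
  smul_right a m w := by
    rw [LinearMap.comp_apply, hF.smul_right, map_sandwich, LinearMap.comp_apply]

end TwistedBimodMap

/-! ### Products of exterior powers -/

section WedgeMul

variable {k : Type u} [Field k] {V U V' : Type*} [AddCommGroup V] [Module k V] [AddCommGroup U]
  [Module k U] [AddCommGroup V'] [Module k V']

/-- The product `⋀ⁱ V ⊗ ⋀ʲ U → ⋀ⁿ V'`, where `n = i + j`, determined by `f : V → V'` and
`g : U → V'`. -/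
noncomputable def wedgeMul (f : V →ₗ[k] V') (g : U →ₗ[k] V') (i j : ℕ) {n : ℕ} (h : i + j = n) :
    (⋀[k]^i V) ⊗[k] (⋀[k]^j U) →ₗ[k] ⋀[k]^n V' :=
  (LinearMap.mul' k (ExteriorAlgebra k V') ∘ₗ TensorProduct.map
    ((⋀[k]^i V').subtype ∘ₗ exteriorPower.map i f)
    ((⋀[k]^j V').subtype ∘ₗ exteriorPower.map j g)).codRestrict (⋀[k]^n V') (by
      subst h
      intro z
      induction z with
      | zero => rw [map_zero]; exact Submodule.zero_mem _
      | add x y hx hy => rw [map_add]; exact Submodule.add_mem _ hx hy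
      | tmul a b =>
        exact SetLike.mul_mem_graded (A := fun i : ℕ => ⋀[k]^i V')
          (exteriorPower.map i f a).2 (exteriorPower.map j g b).2)

theorem wedgeMul_ιMulti (f : V →ₗ[k] V') (g : U →ₗ[k] V') (i j : ℕ) {n : ℕ} (h : i + j = n)
    (a : Fin i → V) (b : Fin j → U) :
    wedgeMul f g i j h (exteriorPower.ιMulti k i a ⊗ₜ exteriorPower.ιMulti k j b) =
      exteriorPower.ιMulti k n
        (fun p => Fin.append (fun q => f (a q)) (fun q => g (b q)) (Fin.cast h.symm p)) := by
  subst h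
  refine Subtype.ext ?_
  simp only [wedgeMul, LinearMap.codRestrict_apply, LinearMap.comp_apply, TensorProduct.map_tmul,
    exteriorPower.map_apply_ιMulti, Submodule.subtype_apply, exteriorPower.ιMulti_apply_coe,
    LinearMap.mul'_apply, ExteriorAlgebra.ιMulti_mul_ιMulti]
  rfl

end WedgeMul

/-! ### The exterior algebra after adjoining one basis vector -/

section TotalWedge

variable {k : Type u} [Field k] {m : ℕ}

variable (k m) in
/-- The inclusion of the span of `x_1, …, x_m` into the span of `x_1, …, x_{m+1}`. -/
noncomputable def inclInit : (Fin m → k) →ₗ[k] (Fin (m + 1) → k) :=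
  Fintype.linearCombination k fun i => vec k (m + 1) i.castSucc

variable (k m) in
/-- The inclusion of the span of `x_{m+1}` into the span of `x_1, …, x_{m+1}`. -/
noncomputable def inclLast : (Fin 1 → k) →ₗ[k] (Fin (m + 1) → k) :=
  Fintype.linearCombination k fun _ => vec k (m + 1) (Fin.last m)

@[simp]
theorem inclInit_vec (i : Fin m) : inclInit k m (vec k m i) = vec k (m + 1) i.castSucc :=
  linearCombination_vec _ _

@[simp]
theorem inclLast_vec (i : Fin 1) : inclLast k m (vec k 1 i) = vec k (m + 1) (Fin.last m) :=
  linearCombination_vec _ _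

variable (k m) in
/-- The product `⋀ⁱ V ⊗ ⋀ʲ k x_{m+1} → ⋀ⁿ (V ⊕ k x_{m+1})`. -/
noncomputable abbrev wedgeSnoc (i j : ℕ) {n : ℕ} (h : i + j = n) :
    (⋀[k]^i (Fin m → k)) ⊗[k] (⋀[k]^j (Fin 1 → k)) →ₗ[k] ⋀[k]^n (Fin (m + 1) → k) :=
  wedgeMul (inclInit k m) (inclLast k m) i j h

/-- The sequence `l` followed by entries equal to the last index. -/
def appendLast {i j n : ℕ} (h : i + j = n) (l : Fin i → Fin m) : Fin n → Fin (m + 1) :=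
  fun p => Fin.append (fun q => (l q).castSucc) (fun _ : Fin j => Fin.last m) (Fin.cast h.symm p)

theorem wedgeSnoc_vec (i j : ℕ) {n : ℕ} (h : i + j = n) (l : Fin i → Fin m) (l' : Fin j → Fin 1) :
    wedgeSnoc k m i j h (exteriorPower.ιMulti k i (fun q => vec k m (l q)) ⊗ₜ
      exteriorPower.ιMulti k j (fun q => vec k 1 (l' q))) =
      exteriorPower.ιMulti k n (fun p => vec k (m + 1) (appendLast h l p)) := by
  rw [wedgeMul_ιMulti]
  congr 1
  funext p
  subst h
  simp only [appendLast, Fin.cast_refl, id, inclInit_vec, inclLast_vec]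
  refine Fin.addCases (fun q => ?_) (fun q => ?_) p <;> simp

/-- In a strictly increasing sequence the largest index can occur only in the last place, so at most
one entry is split off. -/
theorem exists_eq_appendLast {n : ℕ} (l : Fin n → Fin (m + 1)) (hl : StrictMono l) :
    ∃ (i j : ℕ) (h : i + j = n) (l₀ : Fin i → Fin m), l = appendLast h l₀ := by
  by_cases hn : ∃ p, l p = Fin.last m
  · obtain ⟨p, hp⟩ := hn
    obtain ⟨n, rfl⟩ : ∃ n', n = n' + 1 := ⟨n - 1, by have := p.isLt; omega⟩
    have hlast : p = Fin.last n := by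
      by_contra hne
      have := hl (Fin.lt_last_iff_ne_last.2 hne)
      rw [hp] at this
      exact absurd (Fin.le_last _) (not_le.2 this)
    subst hlast
    have hlt : ∀ q : Fin n, l q.castSucc ≠ Fin.last m := fun q hq =>
      absurd (hl (Fin.castSucc_lt_last q)) (by rw [hq, hp]; exact lt_irrefl _)
    refine ⟨n, 1, rfl, fun q => (l q.castSucc).castPred (hlt q), ?_⟩
    funext p
    refine Fin.lastCases ?_ (fun q => ?_) p
    · rw [hp, appendLast, show Fin.cast rfl (Fin.last n) = Fin.natAdd n (0 : Fin 1) from rfl,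
        Fin.append_right]
    · rw [appendLast, show Fin.cast rfl q.castSucc = Fin.castAdd 1 q from rfl, Fin.append_left,
        Fin.castSucc_castPred]
  · push Not at hn
    refine ⟨n, 0, rfl, fun q => (l q).castPred (hn q), ?_⟩
    funext q
    rw [appendLast, show Fin.cast rfl q = Fin.castAdd 0 q from rfl, Fin.append_left,
        Fin.castSucc_castPred]

variable (k m) in
/-- The map `⨁_{i+j=n} ⋀ⁱ V ⊗ ⋀ʲ k x_{m+1} → ⋀ⁿ (V ⊕ k x_{m+1})`. -/
noncomputable def totWedge (n : ℕ) :
    Tot k (fun i => ⋀[k]^i (Fin m → k)) (fun j => ⋀[k]^j (Fin 1 → k)) n →ₗ[k]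
      ⋀[k]^n (Fin (m + 1) → k) :=
  DirectSum.toModule k {p : ℕ × ℕ // p.1 + p.2 = n} _ fun p => wedgeSnoc k m p.1.1 p.1.2 p.2

theorem totWedge_totIncl (i j : ℕ) {n : ℕ} (h : i + j = n)
    (z : (⋀[k]^i (Fin m → k)) ⊗[k] (⋀[k]^j (Fin 1 → k))) :
    totWedge k m n (totIncl (P := fun i => ⋀[k]^i (Fin m → k)) (Q := fun j => ⋀[k]^j (Fin 1 → k))
      i j h z) = wedgeSnoc k m i j h z :=
  DirectSum.toModule_lof k _ _

theorem totWedge_surjective (n : ℕ) : Function.Surjective (totWedge k m n) := by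
  rw [← LinearMap.range_eq_top, eq_top_iff,
    ← ((Pi.basisFun k (Fin (m + 1))).exteriorPower n).span_eq, Submodule.span_le]
  rintro _ ⟨s, rfl⟩
  have hl := (Set.powersetCard.ofFinEmbEquiv.symm s).strictMono
  obtain ⟨i, j, h, l₀, hl₀⟩ := exists_eq_appendLast _ hl
  refine ⟨totIncl i j h (exteriorPower.ιMulti k i (fun q => vec k m (l₀ q)) ⊗ₜ
      exteriorPower.ιMulti k j (fun _ => vec k 1 0)), ?_⟩
  rw [totWedge_totIncl, wedgeSnoc_vec i j h l₀ (fun _ => 0), exteriorPower.basis_apply,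
    exteriorPower.ιMulti_family]
  congr 1
  funext p
  simp only [Function.comp_apply, Pi.basisFun_apply, vec]
  rw [← hl₀]

/-- The basis wedges of V ⊕ k x_{m+1} are attained, and a surjection between finite-dimensional
spaces of equal dimension is bijective. -/
theorem totWedge_bijective (n : ℕ) : Function.Bijective (totWedge k m n) := by
  let _ : Fintype {p : ℕ × ℕ // p.1 + p.2 = n} :=
    Fintype.subtype (Finset.HasAntidiagonal.antidiagonal n) (fun p => Finset.HasAntidiagonal.mem_antidiagonal)
  have hrank : Module.finrank k
      (Tot k (fun i => ⋀[k]^i (Fin m → k)) (fun j => ⋀[k]^j (Fin 1 → k)) n) =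
      Module.finrank k (⋀[k]^n (Fin (m + 1) → k)) := by
    -- The equality of dimensions is Vandermonde's identity for the binomial coefficients of m + 1.
    rw [Module.finrank_directSum, exteriorPower.finrank_eq, Module.finrank_fin_fun,
      Nat.add_choose_eq, Finset.sum_subtype _ (fun p => Finset.HasAntidiagonal.mem_antidiagonal)]
    refine Finset.sum_congr rfl fun p _ => ?_
    rw [Module.finrank_tensorProduct, exteriorPower.finrank_eq, exteriorPower.finrank_eq,
      Module.finrank_fin_fun, Module.finrank_fin_fun]
  exact ⟨(LinearMap.injective_iff_surjective_of_finrank_eq_finrank hrank).2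
    (totWedge_surjective n), totWedge_surjective n⟩

end TotalWedge

/-! ### The isomorphism from the twisted product to the complex of the Ore extension -/

section TotalEquiv

variable {k : Type u} [Field k] {A T : Type v} [Ring A] [Algebra k A] [Ring T] [Algebra k T]
  {ι : A →ₐ[k] T} {y : T} {δ : A →ₗ[k] A} {m : ℕ}

/-- The isomorphism `(A ⊗ ⋀ⁱ V ⊗ A) ⊗ (k[X] ⊗ ⋀ʲ k x_{m+1} ⊗ k[X]) ≃
T ⊗ (⋀ⁱ V ⊗ ⋀ʲ k x_{m+1}) ⊗ T` followed by the product in the exterior algebra. -/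
noncomputable def totComponent (h : IsOreExtension ι y δ) (e : Fin m → (Fin m → k)) (i j : ℕ)
    {n : ℕ} (hn : i + j = n) :
    Kos k A m i ⊗[k] Kos k (Poly k) 1 j →ₗ[k] Kos k T (m + 1) n :=
  (FreeBimod.mapInner k T (wedgeSnoc k m i j hn)).restrictScalars k ∘ₗ
    (twistedEquiv h (wedgeDer e i) (⋀[k]^j (Fin 1 → k))).toLinearMap

variable (k T m) in
/-- The isomorphism `⨁_{i+j=n} T ⊗ (⋀ⁱ V ⊗ ⋀ʲ k x_{m+1}) ⊗ T ≃ T ⊗ ⋀ⁿ (V ⊕ k x_{m+1}) ⊗ T`. -/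
noncomputable def freeTotWedge (n : ℕ) : (⨁ p : {p : ℕ × ℕ // p.1 + p.2 = n}, FreeBimod k T
      ((⋀[k]^p.1.1 (Fin m → k)) ⊗[k] (⋀[k]^p.1.2 (Fin 1 → k)))) ≃ₗ[k] Kos k T (m + 1) n :=
  ((TensorProduct.directSumRight k k (Env k T) (fun p : {p : ℕ × ℕ // p.1 + p.2 = n} =>
      (⋀[k]^p.1.1 (Fin m → k)) ⊗[k] (⋀[k]^p.1.2 (Fin 1 → k)))).symm ≪≫ₗ
    LinearEquiv.lTensor (Env k T) (LinearEquiv.ofBijective (totWedge k m n) (totWedge_bijective n)) :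
    (⨁ p : {p : ℕ × ℕ // p.1 + p.2 = n}, Env k T ⊗[k]
      ((⋀[k]^p.1.1 (Fin m → k)) ⊗[k] (⋀[k]^p.1.2 (Fin 1 → k)))) ≃ₗ[k]
      Env k T ⊗[k] (⋀[k]^n (Fin (m + 1) → k)))

theorem freeTotWedge_lof (i j : ℕ) {n : ℕ} (hn : i + j = n)
    (z : FreeBimod k T ((⋀[k]^i (Fin m → k)) ⊗[k] (⋀[k]^j (Fin 1 → k)))) :
    freeTotWedge k T m n (DirectSum.lof k {p : ℕ × ℕ // p.1 + p.2 = n} (fun p => FreeBimod k T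
        ((⋀[k]^p.1.1 (Fin m → k)) ⊗[k] (⋀[k]^p.1.2 (Fin 1 → k)))) ⟨(i, j), hn⟩ z) =
      FreeBimod.mapInner k T (wedgeSnoc k m i j hn) z := by
  have h2 : ∀ y : Env k T ⊗[k] ((⋀[k]^i (Fin m → k)) ⊗[k] (⋀[k]^j (Fin 1 → k))),
      LinearEquiv.lTensor (Env k T)
        (LinearEquiv.ofBijective (totWedge k m n) (totWedge_bijective n))
        ((TensorProduct.directSumRight k k (Env k T) (fun p : {p : ℕ × ℕ // p.1 + p.2 = n} =>
      (⋀[k]^p.1.1 (Fin m → k)) ⊗[k] (⋀[k]^p.1.2 (Fin 1 → k)))).symm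
        (DirectSum.lof k {p : ℕ × ℕ // p.1 + p.2 = n} (fun p => Env k T ⊗[k]
        ((⋀[k]^p.1.1 (Fin m → k)) ⊗[k] (⋀[k]^p.1.2 (Fin 1 → k)))) ⟨(i, j), hn⟩ y)) =
      (wedgeSnoc k m i j hn).lTensor (Env k T) y := by
    intro y
    induction y with
    | zero => simp
    | add x y hx hy => simp only [map_add, hx, hy]
    | tmul a w =>
      rw [TensorProduct.directSumRight_symm_lof_tmul]
      exact congrArg (fun x => a ⊗ₜ[k] x) (totWedge_totIncl i j hn w)
  exact h2 z

/-- The isomorphism of the twisted product with the complex of `T`. -/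
noncomputable def totEquiv (h : IsOreExtension ι y δ) (e : Fin m → (Fin m → k)) (n : ℕ) :
    Tot k (Kos k A m) (Kos k (Poly k) 1) n ≃ₗ[k] Kos k T (m + 1) n :=
  LinearEquiv.trans (M₂ := ⨁ p : {p : ℕ × ℕ // p.1 + p.2 = n}, FreeBimod k T
      ((⋀[k]^p.1.1 (Fin m → k)) ⊗[k] (⋀[k]^p.1.2 (Fin 1 → k))))
    (DFinsupp.mapRange.linearEquiv fun p : {p : ℕ × ℕ // p.1 + p.2 = n} =>
      twistedEquiv h (wedgeDer e p.1.1) (⋀[k]^p.1.2 (Fin 1 → k)))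
    (freeTotWedge k T m n)

theorem totEquiv_totIncl (h : IsOreExtension ι y δ) (e : Fin m → (Fin m → k)) (i j : ℕ)
    {n : ℕ} (hn : i + j = n) (z : Kos k A m i ⊗[k] Kos k (Poly k) 1 j) :
    totEquiv h e n (totIncl i j hn z) = totComponent h e i j hn z := by
  have h1 : (DFinsupp.mapRange.linearEquiv fun p : {p : ℕ × ℕ // p.1 + p.2 = n} =>
      twistedEquiv h (wedgeDer e p.1.1) (⋀[k]^p.1.2 (Fin 1 → k))) (totIncl i j hn z) =
      DirectSum.lof k {p : ℕ × ℕ // p.1 + p.2 = n} (fun p => FreeBimod k T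
        ((⋀[k]^p.1.1 (Fin m → k)) ⊗[k] (⋀[k]^p.1.2 (Fin 1 → k)))) ⟨(i, j), hn⟩
        (twistedEquiv h (wedgeDer e i) (⋀[k]^j (Fin 1 → k)) z) :=
    DFinsupp.mapRange_single (hf := fun _ => map_zero _)
  exact (congrArg (freeTotWedge k T m n) h1).trans (freeTotWedge_lof i j hn _)

theorem isTwistedBimodMap_totComponent (h : IsOreExtension ι y δ) (e : Fin m → (Fin m → k))
    (i j : ℕ) {n : ℕ} (hn : i + j = n) :
    IsTwistedBimodMap ι y (kosDer δ e i) (totComponent h e i j hn) :=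
  (isTwistedBimodMap_twistedEquiv h (wedgeDer e i)).comp _

theorem totComponent_inner (h : IsOreExtension ι y δ) (e : Fin m → (Fin m → k)) (i j : ℕ)
    {n : ℕ} (hn : i + j = n) (w : ⋀[k]^i (Fin m → k)) (w' : ⋀[k]^j (Fin 1 → k)) :
    totComponent h e i j hn (inner k A w ⊗ₜ inner k (Poly k) w') =
      inner k T (wedgeSnoc k m i j hn (w ⊗ₜ w')) := by
  have := twistedEquiv_inner h (wedgeDer e i) (1 : A) 1 w w'
  rw [one_tmul_op_one_smul, map_one, one_tmul_op_one_smul] at this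
  rw [totComponent, LinearMap.comp_apply, LinearEquiv.coe_coe, this]
  rfl

theorem totComponent_gen (h : IsOreExtension ι y δ) (e : Fin m → (Fin m → k)) (i j : ℕ)
    {n : ℕ} (hn : i + j = n) (l : Fin i → Fin m) (l' : Fin j → Fin 1) :
    totComponent h e i j hn (gen k A l ⊗ₜ gen k (Poly k) l') = gen k T (appendLast hn l) := by
  rw [gen, gen, wedge, wedge, totComponent_inner, wedgeSnoc_vec]
  rfl

end TotalEquiv

/-! ### Closure properties of twisted bimodule maps -/

section Closure

variable {k : Type u} [Field k] {A T : Type v} [Ring A] [Algebra k A] [Ring T] [Algebra k T]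
  {W W' : Type*} [AddCommGroup W] [Module k W] [AddCommGroup W'] [Module k W']
  {Z : Type*} [AddCommGroup Z] [Module k Z] [Module (Env k T) Z] [IsScalarTower k (Env k T) Z]
  {ι : A →ₐ[k] T} {y : T} {δ : A →ₗ[k] A}
  {F G : FreeBimod k A W ⊗[k] FreeBimod k (Poly k) W' →ₗ[k] Z}

namespace IsTwistedBimodMap

theorem add {D : FreeBimod k A W →ₗ[k] FreeBimod k A W} (hF : IsTwistedBimodMap ι y D F)
    (hG : IsTwistedBimodMap ι y D G) : IsTwistedBimodMap ι y D (F + G) where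
  smul_left a m n := by
    rw [LinearMap.add_apply, hF.smul_left, hG.smul_left, ← map_add, LinearMap.add_apply]
  left m n := by
    simp only [LinearMap.add_apply, hF.left, hG.left, map_add]; abel
  right m n := by
    rw [LinearMap.add_apply, hF.right, hG.right, ← map_add, LinearMap.add_apply]
  smul_right a m w := by
    rw [LinearMap.add_apply, hF.smul_right, hG.smul_right, ← map_add, LinearMap.add_apply]

theorem smul {D : FreeBimod k A W →ₗ[k] FreeBimod k A W} (hF : IsTwistedBimodMap ι y D F)
    (c : k) : IsTwistedBimodMap ι y D (c • F) where
  smul_left a m n := by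
    rw [LinearMap.smul_apply, hF.smul_left, ← map_smul, LinearMap.smul_apply]
  left m n := by
    rw [LinearMap.smul_apply, hF.left, smul_sub, ← map_smul, LinearMap.smul_apply,
      LinearMap.smul_apply]
  right m n := by
    rw [LinearMap.smul_apply, hF.right, ← map_smul, LinearMap.smul_apply]
  smul_right a m w := by
    rw [LinearMap.smul_apply, hF.smul_right, ← map_smul, LinearMap.smul_apply]

/-- The rule for the left action of X contains D, so precomposition on the first factor requires a
map that commutes with the derivations. -/
theorem comp_rTensor {W₀ : Type*} [AddCommGroup W₀] [Module k W₀]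
    {D : FreeBimod k A W →ₗ[k] FreeBimod k A W} {D₀ : FreeBimod k A W₀ →ₗ[k] FreeBimod k A W₀}
    (hF : IsTwistedBimodMap ι y D F) (g : FreeBimod k A W₀ →ₗ[Env k A] FreeBimod k A W)
    (hg : ∀ z, g (D₀ z) = D (g z)) :
    IsTwistedBimodMap ι y D₀
      (F ∘ₗ (g.restrictScalars k).rTensor (FreeBimod k (Poly k) W')) where
  smul_left a m n := by
    rw [LinearMap.comp_apply, LinearMap.comp_apply, LinearMap.rTensor_tmul,
      LinearMap.rTensor_tmul, map_sandwich, hF.smul_left]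
  left m n := by
    rw [LinearMap.comp_apply, LinearMap.comp_apply, LinearMap.comp_apply, LinearMap.rTensor_tmul,
      LinearMap.rTensor_tmul, LinearMap.rTensor_tmul, hF.left]
    exact congrArg (fun z => _ - F (z ⊗ₜ n)) (hg m).symm
  right m n := by
    rw [LinearMap.comp_apply, LinearMap.comp_apply, LinearMap.rTensor_tmul,
      LinearMap.rTensor_tmul, hF.right]
  smul_right a m w := by
    rw [LinearMap.comp_apply, LinearMap.comp_apply, LinearMap.rTensor_tmul,
      LinearMap.rTensor_tmul, map_sandwich, hF.smul_right]

/-- Only the right action of A needs care, because `g` does not send generators to generators. For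
values of the form X w' - w' X, the term with δ(a) from D(m a) cancels against the one from y a = a
y + δ(a). -/
theorem comp_lTensor {W₀ : Type*} [AddCommGroup W₀] [Module k W₀] {E : W →ₗ[k] W}
    (hδ : ∀ r s : A, δ (r * s) = δ r * s + r * δ s)
    (hy : ∀ r : A, y * ι r = ι r * y + ι (δ r))
    (hF : IsTwistedBimodMap ι y (bimodDer δ E) F)
    (g : FreeBimod k (Poly k) W₀ →ₗ[Env k (Poly k)] FreeBimod k (Poly k) W')
    (hg : ∀ w, ∃ w', g (inner k (Poly k) w) =
      leftX k _ (inner k (Poly k) w') - rightX k _ (inner k (Poly k) w')) :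
    IsTwistedBimodMap ι y (bimodDer δ E)
      (F ∘ₗ (g.restrictScalars k).lTensor (FreeBimod k A W)) where
  smul_left a m n := by
    rw [LinearMap.comp_apply, LinearMap.comp_apply, LinearMap.lTensor_tmul,
      LinearMap.lTensor_tmul, hF.smul_left]
  left m n := by
    rw [LinearMap.comp_apply, LinearMap.comp_apply, LinearMap.comp_apply, LinearMap.lTensor_tmul,
      LinearMap.lTensor_tmul, LinearMap.lTensor_tmul, map_sandwich, hF.left]
  right m n := by
    rw [LinearMap.comp_apply, LinearMap.comp_apply, LinearMap.lTensor_tmul,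
      LinearMap.lTensor_tmul, map_sandwich, hF.right]
  smul_right a m w := by
    have h1 : δ 1 = 0 := by simpa using hδ 1 1
    have hz : ∀ (a : A) (x : FreeBimod k A W), sandwich k 0 a x = 0 := fun a x => by
      rw [sandwich_apply, zero_tmul_smul]
    obtain ⟨w', hw⟩ := hg w
    rw [LinearMap.comp_apply, LinearMap.comp_apply, LinearMap.lTensor_tmul,
      LinearMap.lTensor_tmul, LinearMap.restrictScalars_apply, hw, TensorProduct.tmul_sub,
      TensorProduct.tmul_sub, map_sub, map_sub, hF.left, hF.left, hF.right, hF.right,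
      bimodDer_sandwich E hδ, h1, hz, TensorProduct.add_tmul, TensorProduct.add_tmul, map_add,
      map_add, TensorProduct.zero_tmul, map_zero, hF.smul_right, hF.smul_right, hF.smul_right,
      map_sub, map_sub]
    simp only [sandwich_sandwich, hy, sandwich_add_right, mul_one, one_mul]
    abel

end IsTwistedBimodMap

end Closure

/-! ### The Koszul differential with and without the last generator -/

section Chain

variable {k : Type u} [Field k] {A T : Type v} [Ring A] [Algebra k A] [Ring T] [Algebra k T]
  {ι : A →ₐ[k] T} {y : T} {δ : A →ₗ[k] A} {m : ℕ}

theorem span_ιMulti_vec (m n : ℕ) :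
    Submodule.span k {w : ⋀[k]^n (Fin m → k) | ∃ l : Fin n → Fin m, StrictMono l ∧
      w = exteriorPower.ιMulti k n (fun p => vec k m (l p))} = ⊤ := by
  rw [eq_top_iff, ← ((Pi.basisFun k (Fin m)).exteriorPower n).span_eq]
  refine Submodule.span_mono ?_
  rintro _ ⟨s, rfl⟩
  refine ⟨_, (Set.powersetCard.ofFinEmbEquiv.symm s).strictMono, ?_⟩
  rw [exteriorPower.basis_apply, exteriorPower.ιMulti_family]
  congr 1
  funext p
  simp [vec]

theorem IsTwistedBimodMap.ext_gen {i j : ℕ}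
    {Z : Type*} [AddCommGroup Z] [Module k Z] [Module (Env k T) Z] [IsScalarTower k (Env k T) Z]
    {D : Kos k A m i →ₗ[k] Kos k A m i} {F G : Kos k A m i ⊗[k] Kos k (Poly k) 1 j →ₗ[k] Z}
    (hF : IsTwistedBimodMap ι y D F) (hG : IsTwistedBimodMap ι y D G)
    (h : ∀ (l : Fin i → Fin m) (l' : Fin j → Fin 1), StrictMono l → StrictMono l' →
      F (gen k A l ⊗ₜ gen k (Poly k) l') = G (gen k A l ⊗ₜ gen k (Poly k) l')) : F = G := by
  refine hF.ext' hG (span_ιMulti_vec m i) (span_ιMulti_vec 1 j) ?_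
  rintro _ ⟨l, hl, rfl⟩ _ ⟨l', hl', rfl⟩
  exact h l l' hl hl'

theorem totComponent_smul_inner (h : IsOreExtension ι y δ) (e : Fin m → (Fin m → k)) (i j : ℕ)
    {n : ℕ} (hn : i + j = n) (a b : A) (w : ⋀[k]^i (Fin m → k)) (w' : ⋀[k]^j (Fin 1 → k)) :
    totComponent h e i j hn (((a ⊗ₜ[k] MulOpposite.op b : Env k A) • inner k A w) ⊗ₜ
      inner k (Poly k) w') =
      (ι a ⊗ₜ[k] MulOpposite.op (ι b) : Env k T) • inner k T (wedgeSnoc k m i j hn (w ⊗ₜ w')) := by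
  rw [totComponent, LinearMap.comp_apply, LinearEquiv.coe_coe, twistedEquiv_inner,
    LinearMap.restrictScalars_apply, map_smul, FreeBimod.mapInner_inner]

theorem totComponent_zero (h : IsOreExtension ι y δ) (e : Fin m → (Fin m → k)) {n : ℕ}
    (hn : n + 0 = n) (a b : A) (v : Fin n → (Fin m → k)) (l' : Fin 0 → Fin 1) :
    totComponent h e n 0 hn (((a ⊗ₜ[k] MulOpposite.op b : Env k A) • wedge k A v) ⊗ₜ
      gen k (Poly k) l') =
      (ι a ⊗ₜ[k] MulOpposite.op (ι b) : Env k T) • wedge k T (fun p => inclInit k m (v p)) := by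
  rw [gen, wedge, wedge, totComponent_smul_inner, wedgeMul_ιMulti, wedge]
  congr 3
  funext p
  rw [show Fin.cast hn.symm p = Fin.castAdd 0 p from rfl, Fin.append_left]

theorem totComponent_one (h : IsOreExtension ι y δ) (e : Fin m → (Fin m → k)) {n : ℕ}
    (hn : n + 1 = n + 1) (a b : A) (v : Fin n → (Fin m → k)) (l' : Fin 1 → Fin 1) :
    totComponent h e n 1 hn (((a ⊗ₜ[k] MulOpposite.op b : Env k A) • wedge k A v) ⊗ₜ
      gen k (Poly k) l') =
      (ι a ⊗ₜ[k] MulOpposite.op (ι b) : Env k T) • wedge k T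
        (Fin.snoc (fun p => inclInit k m (v p)) (vec k (m + 1) (Fin.last m)) :
          Fin (n + 1) → (Fin (m + 1) → k)) := by
  rw [gen, wedge, wedge, totComponent_smul_inner, wedgeMul_ιMulti, wedge]
  congr 3
  funext p
  refine Fin.lastCases ?_ (fun q => ?_) p
  · rw [show Fin.cast hn.symm (Fin.last n) = Fin.natAdd n (0 : Fin 1) from rfl, Fin.append_right,
      Fin.snoc_last, inclLast_vec]
  · rw [show Fin.cast hn.symm q.castSucc = Fin.castAdd 1 q from rfl, Fin.append_left,
      Fin.snoc_castSucc]

theorem appendLast_zero {n : ℕ} (hn : n + 0 = n) (l : Fin n → Fin m) :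
    appendLast hn l = fun p => (l p).castSucc := by
  funext p
  rw [appendLast, show Fin.cast hn.symm p = Fin.castAdd 0 p from rfl, Fin.append_left]

theorem appendLast_one {n : ℕ} (hn : n + 1 = n + 1) (l : Fin n → Fin m) :
    appendLast hn l = (Fin.snoc (fun p => (l p).castSucc) (Fin.last m) :
      Fin (n + 1) → Fin (m + 1)) := by
  funext p
  refine Fin.lastCases ?_ (fun q => ?_) p
  · rw [appendLast, show Fin.cast hn.symm (Fin.last n) = Fin.natAdd n (0 : Fin 1) from rfl,
      Fin.append_right, Fin.snoc_last]
  · rw [appendLast, show Fin.cast hn.symm q.castSucc = Fin.castAdd 1 q from rfl, Fin.append_left,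
      Fin.snoc_castSucc]

theorem strictMono_snoc {n : ℕ} {l : Fin n → Fin m} (hl : StrictMono l) :
    StrictMono (Fin.snoc (fun p => (l p).castSucc) (Fin.last m) : Fin (n + 1) → Fin (m + 1)) := by
  intro p q
  refine Fin.lastCases ?_ (fun q => ?_) q
  · refine Fin.lastCases (fun h => absurd h (lt_irrefl _)) (fun p _ => ?_) p
    rw [Fin.snoc_last, Fin.snoc_castSucc]
    exact Fin.castSucc_lt_last _
  · refine Fin.lastCases (fun h => absurd h (not_lt.2 (Fin.le_last _))) (fun p h => ?_) p
    rw [Fin.snoc_castSucc, Fin.snoc_castSucc]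
    exact Fin.castSucc_lt_castSucc_iff.2 (hl (Fin.castSucc_lt_castSucc_iff.1 h))

variable {x : Fin m → A} {c : Fin m → Fin m → (Fin m → k)} {x' : Fin (m + 1) → T}
  {c' : Fin (m + 1) → Fin (m + 1) → (Fin (m + 1) → k)} {e : Fin m → (Fin m → k)}

/-- The Koszul formula uses only the bimodule operations and wedges, so it can be carried along a
map that is semilinear over ι on wedges. It is applied to the columns j = 0 and j = 1. -/
theorem map_koszulFormula {Z : Type*} [AddCommGroup Z] [Module k Z] [Module (Env k T) Z]
    {n : ℕ} (f : Kos k A m n →ₗ[k] Z) (g : (Fin n → (Fin m → k)) → Z)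
    (hf : ∀ a b v, f ((a ⊗ₜ[k] MulOpposite.op b : Env k A) • wedge k A v) =
      (ι a ⊗ₜ[k] MulOpposite.op (ι b) : Env k T) • g v) (l : Fin (n + 1) → Fin m) :
    f (koszulFormula x c n l) =
      (∑ i : Fin (n + 1), (-1 : k) ^ (i : ℕ) •
        ((ι (x (l i)) ⊗ₜ[k] (1 : Tᵐᵒᵖ) : Env k T) • g (fun p => vec k m (l (i.succAbove p))) -
          ((1 : T) ⊗ₜ[k] MulOpposite.op (ι (x (l i))) : Env k T) •
            g (fun p => vec k m (l (i.succAbove p))))) +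
      ∑ i : Fin (n + 1), ∑ j : Fin (n + 1), if i < j then
        (-1 : k) ^ ((j : ℕ) + 1) • g (fun p =>
          Function.update (fun q => vec k m (l q)) i (c (l j) (l i)) (j.succAbove p))
      else 0 := by
  have hl : ∀ a v, f ((a ⊗ₜ[k] (1 : Aᵐᵒᵖ) : Env k A) • wedge k A v) =
      (ι a ⊗ₜ[k] (1 : Tᵐᵒᵖ) : Env k T) • g v := fun a v => by
    have := hf a 1 v
    rwa [map_one] at this
  have hr : ∀ a v, f (((1 : A) ⊗ₜ[k] MulOpposite.op a : Env k A) • wedge k A v) =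
      ((1 : T) ⊗ₜ[k] MulOpposite.op (ι a) : Env k T) • g v := fun a v => by
    have := hf 1 a v
    rwa [map_one] at this
  have hg : ∀ v, f (wedge k A v) = g v := fun v => by
    have := hf 1 1 v
    rwa [one_tmul_op_one_smul, map_one, one_tmul_op_one_smul] at this
  rw [koszulFormula, map_add, map_sum, map_sum]
  congr 1
  · refine Finset.sum_congr rfl fun i _ => ?_
    rw [map_smul, map_sub, gen, hl, hr]
  · refine Finset.sum_congr rfl fun i _ => ?_
    rw [map_sum]
    refine Finset.sum_congr rfl fun j _ => ?_
    split_ifs with hij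
    · rw [map_smul, hg]
    · rw [map_zero]

theorem koszulFormula_castSucc (h : IsOreExtension ι y δ)
    (hx : ∀ i, x' i.castSucc = ι (x i))
    (hc : ∀ i j, i < j → c' j.castSucc i.castSucc = inclInit k m (c j i)) {n : ℕ}
    (hn : n + 0 = n) (l : Fin (n + 1) → Fin m) (hl : StrictMono l) (l' : Fin 0 → Fin 1) :
    koszulFormula x' c' n (fun p => (l p).castSucc) =
      totComponent h e n 0 hn (koszulFormula x c n l ⊗ₜ gen k (Poly k) l') := by
  have hmap := map_koszulFormula (ι := ι) (x := x) (c := c)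
    (totComponent h e n 0 hn ∘ₗ (TensorProduct.mk k _ _).flip (gen k (Poly k) l'))
    (fun v => wedge k T (fun p => inclInit k m (v p)))
    (fun a b v => totComponent_zero h e hn a b v l') l
  refine Eq.trans ?_ hmap.symm
  rw [koszulFormula]
  congr 1
  · refine Finset.sum_congr rfl fun i _ => ?_
    simp only [gen, hx, inclInit_vec]
  · refine Finset.sum_congr rfl fun i _ => Finset.sum_congr rfl fun j _ => ?_
    split_ifs with hij
    · congr 2
      funext p
      rw [hc _ _ (hl hij)]
      dsimp only
      by_cases hp : j.succAbove p = i
      · rw [hp, Function.update_self, Function.update_self]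
      · rw [Function.update_of_ne hp, Function.update_of_ne hp, inclInit_vec]
    · rfl

theorem snoc_comp_succAbove {n : ℕ} {α : Type*} (f : Fin (n + 1) → α) (a : α) (i : Fin (n + 1)) :
    (fun p => (Fin.snoc f a : Fin (n + 2) → α) (i.castSucc.succAbove p)) =
      (Fin.snoc (fun p => f (i.succAbove p)) a : Fin (n + 1) → α) := by
  funext p
  refine Fin.lastCases ?_ (fun q => ?_) p
  · rw [Fin.snoc_last, Fin.succAbove_of_lt_succ _ _ (by
      rw [Fin.succ_last]; exact Fin.castSucc_lt_last i), Fin.succ_last, Fin.snoc_last]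
  · rw [Fin.snoc_castSucc, Fin.castSucc_succAbove_castSucc, Fin.snoc_castSucc]

/-- The terms of the formula for the differential of `x_{l_1} ∧ ⋯ ∧ x_{l_n} ∧ x_{m+1}` which
involve the last factor. -/
noncomputable def koszulFormulaLast (x' : Fin (m + 1) → T)
    (c' : Fin (m + 1) → Fin (m + 1) → (Fin (m + 1) → k)) (n : ℕ) (l : Fin n → Fin m) :
    Kos k T (m + 1) n :=
  (-1 : k) ^ n • ((x' (Fin.last m) ⊗ₜ[k] (1 : Tᵐᵒᵖ) : Env k T) • gen k T (fun p => (l p).castSucc) -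
    ((1 : T) ⊗ₜ[k] MulOpposite.op (x' (Fin.last m)) : Env k T) •
      gen k T (fun p => (l p).castSucc)) +
  ∑ i, (-1 : k) ^ (n + 1) • wedge k T (Function.update
    (fun q => vec k (m + 1) (l q).castSucc) i (c' (Fin.last m) (l i).castSucc))

theorem koszulFormula_snoc_zero (l : Fin 0 → Fin m) :
    koszulFormula x' c' 0
      (Fin.snoc (fun p => (l p).castSucc) (Fin.last m) : Fin 1 → Fin (m + 1)) =
      koszulFormulaLast x' c' 0 l := by
  have e : ∀ l' : Fin 0 → Fin (m + 1), gen k T l' = gen k T Fin.elim0 := fun l' => by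
    congr 1; exact Subsingleton.elim _ _
  simp [koszulFormula, koszulFormulaLast, e, Fin.snoc]

theorem sum_add_sum_castSucc {M : Type*} [AddCommMonoid M] {n : ℕ} {f g : Fin (n + 1) → M}
    {f' g' g'' : Fin n → M} {a : M} (hf : ∀ i, f i.castSucc = f' i) (ha : f (Fin.last n) = a)
    (hg : ∀ i, g i.castSucc = g' i + g'' i) (hg0 : g (Fin.last n) = 0) :
    ∑ i, f i + ∑ i, g i = (∑ i, f' i + ∑ i, g' i) + (a + ∑ i, g'' i) := by
  rw [Fin.sum_univ_castSucc, Fin.sum_univ_castSucc, ha, hg0, add_zero,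
    Finset.sum_congr rfl fun i _ => hf i, Finset.sum_congr rfl fun i _ => hg i,
    Finset.sum_add_distrib, add_add_add_comm]

/-- Appending x_{m+1} at the end leaves the signs and indices of all terms not involving it
unchanged; these form the differential of A tensored with the last factor. -/
theorem koszulFormula_snoc (h : IsOreExtension ι y δ)
    (hx : ∀ i, x' i.castSucc = ι (x i))
    (hc : ∀ i j, i < j → c' j.castSucc i.castSucc = inclInit k m (c j i)) {n : ℕ}
    (hn : n + 1 = n + 1) (l : Fin (n + 1) → Fin m) (hl : StrictMono l) (l' : Fin 1 → Fin 1) :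
    koszulFormula x' c' (n + 1)
      (Fin.snoc (fun p => (l p).castSucc) (Fin.last m) : Fin (n + 2) → Fin (m + 1)) =
      totComponent h e n 1 hn (koszulFormula x c n l ⊗ₜ gen k (Poly k) l') +
      koszulFormulaLast x' c' (n + 1) l := by
  have hmap := map_koszulFormula (ι := ι) (x := x) (c := c)
    (totComponent h e n 1 hn ∘ₗ (TensorProduct.mk k _ _).flip (gen k (Poly k) l'))
    (fun v => wedge k T
        (Fin.snoc (fun p => inclInit k m (v p)) (vec k (m + 1) (Fin.last m)) :
          Fin (n + 1) → (Fin (m + 1) → k)))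
    (fun a b v => totComponent_one h e hn a b v l') l
  refine Eq.trans ?_ (congrArg (· + koszulFormulaLast x' c' (n + 1) l) hmap.symm)
  have hvec : (fun q => vec k (m + 1) ((Fin.snoc (fun p => (l p).castSucc) (Fin.last m) :
      Fin (n + 2) → Fin (m + 1)) q)) = (Fin.snoc (fun p => vec k (m + 1) (l p).castSucc)
        (vec k (m + 1) (Fin.last m)) : Fin (n + 2) → (Fin (m + 1) → k)) := by
    funext q
    refine Fin.lastCases ?_ (fun q => ?_) q <;> simp
  have hg : ∀ f : Fin n → Fin (m + 1), gen k T (Fin.snoc f (Fin.last m) :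
      Fin (n + 1) → Fin (m + 1)) = wedge k T (Fin.snoc (fun p => vec k (m + 1) (f p))
        (vec k (m + 1) (Fin.last m)) : Fin (n + 1) → (Fin (m + 1) → k)) := fun f => by
    rw [gen]
    congr 1
    funext q
    refine Fin.lastCases ?_ (fun q => ?_) q <;> simp
  have hlast : ∑ j : Fin (n + 2), (if Fin.last (n + 1) < j then (-1 : k) ^ ((j : ℕ) + 1) •
      wedge k T (fun p => Function.update (fun q => vec k (m + 1)
        ((Fin.snoc (fun p => (l p).castSucc) (Fin.last m) : Fin (n + 2) → Fin (m + 1)) q))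
        (Fin.last (n + 1)) (c' ((Fin.snoc (fun p => (l p).castSucc) (Fin.last m) :
          Fin (n + 2) → Fin (m + 1)) j) ((Fin.snoc (fun p => (l p).castSucc) (Fin.last m) :
          Fin (n + 2) → Fin (m + 1)) (Fin.last (n + 1)))) (j.succAbove p)) else 0) = 0 :=
    Finset.sum_eq_zero fun j _ => if_neg (not_lt.2 (Fin.le_last j))
  -- The pairs i < j with j the last index replace x_{l_i} by its image under δ̄_{m+1} and remove
  -- the last factor; the remaining pairs belong to `A`.
  have hsplit : ∀ i : Fin (n + 1), (∑ j : Fin (n + 2), if i.castSucc < j then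
      (-1 : k) ^ ((j : ℕ) + 1) •
      wedge k T (fun p => Function.update (fun q => vec k (m + 1)
        ((Fin.snoc (fun p => (l p).castSucc) (Fin.last m) : Fin (n + 2) → Fin (m + 1)) q))
        i.castSucc (c' ((Fin.snoc (fun p => (l p).castSucc) (Fin.last m) :
          Fin (n + 2) → Fin (m + 1)) j) ((Fin.snoc (fun p => (l p).castSucc) (Fin.last m) :
          Fin (n + 2) → Fin (m + 1)) i.castSucc)) (j.succAbove p)) else 0) =
      (∑ j : Fin (n + 1), if i < j then (-1 : k) ^ ((j : ℕ) + 1) • wedge k T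
        (Fin.snoc (fun p => inclInit k m (Function.update (fun q => vec k m (l q)) i
          (c (l j) (l i)) (j.succAbove p))) (vec k (m + 1) (Fin.last m)) :
          Fin (n + 1) → (Fin (m + 1) → k)) else 0) +
      (-1 : k) ^ (n + 1 + 1) • wedge k T (Function.update
        (fun q => vec k (m + 1) (l q).castSucc) i (c' (Fin.last m) (l i).castSucc)) := by
    intro i
    rw [Fin.sum_univ_castSucc, if_pos (Fin.castSucc_lt_last i), hvec, ]
    congr 1
    · refine Finset.sum_congr rfl fun j _ => ?_
      by_cases hij : i < j
      · rw [if_pos hij, if_pos (Fin.castSucc_lt_castSucc_iff.2 hij), ← Fin.snoc_update,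
          snoc_comp_succAbove, Fin.snoc_castSucc, Fin.snoc_castSucc, hc _ _ (hl hij),
          Fin.val_castSucc]
        congr 3
        funext p
        by_cases hp : j.succAbove p = i
        · rw [hp, Function.update_self, Function.update_self]
        · rw [Function.update_of_ne hp, Function.update_of_ne hp, inclInit_vec]
      · rw [if_neg hij, if_neg (fun h => hij (Fin.castSucc_lt_castSucc_iff.1 h))]
    · rw [← Fin.snoc_update, Fin.snoc_last, Fin.snoc_castSucc]
      congr 2
      funext p
      rw [Fin.succAbove_last, Fin.snoc_castSucc]
  have hfirst : ∀ i : Fin (n + 1), (-1 : k) ^ (i.castSucc : ℕ) •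
      ((x' ((Fin.snoc (fun p => (l p).castSucc) (Fin.last m) : Fin (n + 2) → Fin (m + 1))
          i.castSucc) ⊗ₜ[k] (1 : Tᵐᵒᵖ) : Env k T) •
        gen k T (fun p => (Fin.snoc (fun p => (l p).castSucc) (Fin.last m) :
          Fin (n + 2) → Fin (m + 1)) (i.castSucc.succAbove p)) -
      ((1 : T) ⊗ₜ[k] MulOpposite.op (x' ((Fin.snoc (fun p => (l p).castSucc) (Fin.last m) :
          Fin (n + 2) → Fin (m + 1)) i.castSucc)) : Env k T) •
        gen k T (fun p => (Fin.snoc (fun p => (l p).castSucc) (Fin.last m) :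
          Fin (n + 2) → Fin (m + 1)) (i.castSucc.succAbove p))) =
      (-1 : k) ^ (i : ℕ) •
        ((ι (x (l i)) ⊗ₜ[k] (1 : Tᵐᵒᵖ) : Env k T) • wedge k T
          (Fin.snoc (fun p => inclInit k m (vec k m (l (i.succAbove p))))
            (vec k (m + 1) (Fin.last m)) : Fin (n + 1) → (Fin (m + 1) → k)) -
          ((1 : T) ⊗ₜ[k] MulOpposite.op (ι (x (l i))) : Env k T) • wedge k T
          (Fin.snoc (fun p => inclInit k m (vec k m (l (i.succAbove p))))
            (vec k (m + 1) (Fin.last m)) : Fin (n + 1) → (Fin (m + 1) → k))) := by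
    intro i
    have h1 : gen k T (fun p => (Fin.snoc (fun p => (l p).castSucc) (Fin.last m) :
          Fin (n + 2) → Fin (m + 1)) (i.castSucc.succAbove p)) = wedge k T
          (Fin.snoc (fun p => inclInit k m (vec k m (l (i.succAbove p))))
            (vec k (m + 1) (Fin.last m)) : Fin (n + 1) → (Fin (m + 1) → k)) := by
      rw [snoc_comp_succAbove]
      refine (hg fun p => (l (i.succAbove p)).castSucc).trans ?_
      simp only [inclInit_vec]
    rw [h1, Fin.snoc_castSucc, hx, Fin.val_castSucc]
  rw [koszulFormula, koszulFormulaLast]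
  refine sum_add_sum_castSucc hfirst ?_ hsplit hlast
  rw [Fin.snoc_last, Fin.val_last]
  simp only [Fin.succAbove_last, Fin.snoc_castSucc]

end Chain

/-! ### The isomorphism as a chain map compatible with the augmentations -/

section ChainMap

variable {k : Type u} [Field k] {A T : Type v} [Ring A] [Algebra k A] [Ring T] [Algebra k T]
  {ι : A →ₐ[k] T} {y : T} {δ : A →ₗ[k] A} {m : ℕ}
  {x : Fin m → A} {c : Fin m → Fin m → (Fin m → k)} {x' : Fin (m + 1) → T}
  {c' : Fin (m + 1) → Fin (m + 1) → (Fin (m + 1) → k)} {e : Fin m → (Fin m → k)}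

/-- The data `x'`, `c'` for `T = A[y; 1, δ]` extend the data `x`, `c` for `A` by `y` and `e`. -/
structure IsExtensionData (ι : A →ₐ[k] T) (y : T)
    (x : Fin m → A) (c : Fin m → Fin m → (Fin m → k)) (e : Fin m → (Fin m → k))
    (x' : Fin (m + 1) → T) (c' : Fin (m + 1) → Fin (m + 1) → (Fin (m + 1) → k)) : Prop where
  init : ∀ i, x' i.castSucc = ι (x i)
  last : x' (Fin.last m) = y
  coeff_init : ∀ i j, i < j → c' j.castSucc i.castSucc = inclInit k m (c j i)
  coeff_last : ∀ i, c' (Fin.last m) i.castSucc = inclInit k m (e i)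

theorem polyD_inner (w : ⋀[k]^1 (Fin 1 → k)) : ∃ w', polyD k 0 (inner k (Poly k) w) =
    leftX k _ (inner k (Poly k) w') - rightX k _ (inner k (Poly k) w') := by
  obtain ⟨r, hr⟩ := inner_eq_smul_gen_one w
  have : polyD k 0 (r • gen k (Poly k) (fun _ : Fin 1 => (0 : Fin 1))) = r • polyD k 0 _ :=
    ((polyD k 0).restrictScalars k).map_smul r _
  refine ⟨r • exteriorPower.ιMulti k 0 (fun p : Fin 0 => vec k 1 (p.elim0)), ?_⟩
  have h2 : inner k (Poly k) (r • exteriorPower.ιMulti k 0 (fun p : Fin 0 => vec k 1 (p.elim0))) =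
      r • gen k (Poly k) (Fin.elim0 : Fin 0 → Fin 1) := (innerₗ k (Poly k) _).map_smul _ _
  rw [hr, this, polyD_gen, h2, map_smul, map_smul, smul_sub]

/-- Under the isomorphism, w ⊗ (X ⊗ 1 - 1 ⊗ X) becomes y w - w y minus the derivation of w. For a
wedge w this derivation inserts the e_i, which yields exactly the δ̄_{m+1}-terms, and the minus sign
turns (-1)^n into (-1)^{n+1}. -/
theorem koszulFormulaLast_eq (h : IsOreExtension ι y δ) (hd : IsExtensionData ι y x c e x' c')
    {n : ℕ} (hn : n + 0 = n) (l : Fin n → Fin m) (hl : StrictMono l) (l' : Fin 1 → Fin 1) :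
    koszulFormulaLast x' c' n l =
      (-1 : k) ^ n • totComponent h e n 0 hn (gen k A l ⊗ₜ polyD k 0 (gen k (Poly k) l')) := by
  have h1 : δ 1 = 0 := by simpa using h.leibniz 1 1
  have ht := isTwistedBimodMap_totComponent h e n 0 hn
  have hw : ∀ v : Fin n → (Fin m → k), totComponent h e n 0 hn
      (wedge k A v ⊗ₜ gen k (Poly k) Fin.elim0) = wedge k T (fun p => inclInit k m (v p)) :=
    fun v => by
      have := totComponent_zero h e hn 1 1 v Fin.elim0
      rwa [one_tmul_op_one_smul, map_one, one_tmul_op_one_smul] at this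
  rw [polyD_gen, TensorProduct.tmul_sub, map_sub, ht.left, ht.right, totComponent_gen,
    appendLast_zero, kosDer_gen δ h1 e l hl, TensorProduct.sum_tmul, map_sum,
    Finset.sum_congr rfl fun i _ => hw _, koszulFormulaLast, hd.last, sub_right_comm, smul_sub _ (_ - _) _,
    Finset.smul_sum, sandwich_apply, sandwich_apply, MulOpposite.op_one, sub_eq_add_neg _ (Finset.sum _ _),
    ← Finset.sum_neg_distrib]
  congr 1
  refine Finset.sum_congr rfl fun i _ => ?_
  rw [pow_succ, mul_neg_one, neg_smul]
  congr 3
  funext q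
  by_cases hq : q = i
  · subst hq
    rw [Function.update_self, Function.update_self, hd.coeff_last]
  · rw [Function.update_of_ne hq, Function.update_of_ne hq, inclInit_vec]

variable (h : IsOreExtension ι y δ) (hk : IsKoszulData x c) (he : IsLinearPart δ x e)
  (hd : IsExtensionData ι y x c e x' c')

-- Both sides are twisted bimodule maps, so only generators need to be compared. That the right-hand
-- side is such a map rests on `koszulD_kosDer`.
include hd in
theorem koszulD_totComponent_zero (n : ℕ) (hk : IsKoszulData x c) (he : IsLinearPart δ x e) :
    (koszulD x' c' n).restrictScalars k ∘ₗ totComponent h e (n + 1) 0 rfl =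
      totComponent h e n 0 rfl ∘ₗ ((koszulD x c n).restrictScalars k).rTensor _ := by
  have h1 : δ 1 = 0 := by simpa using h.leibniz 1 1
  refine IsTwistedBimodMap.ext_gen ((isTwistedBimodMap_totComponent h e (n + 1) 0 rfl).comp _)
    ((isTwistedBimodMap_totComponent h e n 0 rfl).comp_rTensor (koszulD x c n) fun z =>
      koszulD_kosDer h.leibniz h1 hk he n z) fun l l' hl _ => ?_
  rw [LinearMap.comp_apply, LinearMap.comp_apply, LinearMap.rTensor_tmul, totComponent_gen,
    LinearMap.restrictScalars_apply, LinearMap.restrictScalars_apply, appendLast_zero,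
    koszulD_gen _ _ _ _ hl, koszulD_gen _ _ _ _ (fun _ _ h => Fin.castSucc_lt_castSucc_iff.2 (hl h)),
    koszulFormula_castSucc h hd.init hd.coeff_init rfl l hl l']

include hd in
theorem koszulD_totComponent_zero_one :
    (koszulD x' c' 0).restrictScalars k ∘ₗ totComponent h e 0 1 rfl =
      totComponent h e 0 0 rfl ∘ₗ ((polyD k 0).restrictScalars k).lTensor _ := by
  refine IsTwistedBimodMap.ext_gen ((isTwistedBimodMap_totComponent h e 0 1 rfl).comp _)
    ((isTwistedBimodMap_totComponent h e 0 0 rfl).comp_lTensor h.leibniz h.commute (polyD k 0)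
      polyD_inner) fun l l' hl _ => ?_
  rw [LinearMap.comp_apply, LinearMap.comp_apply, LinearMap.lTensor_tmul, totComponent_gen,
    LinearMap.restrictScalars_apply, LinearMap.restrictScalars_apply, appendLast_one,
    koszulD_gen _ _ _ _ (strictMono_snoc hl), koszulFormula_snoc_zero,
    koszulFormulaLast_eq h hd rfl l hl l', pow_zero, one_smul]

-- In the column j = 1 both parts of the total differential occur: terms without the last factor
-- give d ⊗ 1, and by `koszulFormulaLast_eq` the others give the signed 1 ⊗ d.
include hd in
theorem koszulD_totComponent_succ_one (n : ℕ) (hk : IsKoszulData x c) (he : IsLinearPart δ x e) :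
    (koszulD x' c' (n + 1)).restrictScalars k ∘ₗ totComponent h e (n + 1) 1 rfl =
      totComponent h e n 1 rfl ∘ₗ ((koszulD x c n).restrictScalars k).rTensor _ +
      (-1 : k) ^ (n + 1) •
        (totComponent h e (n + 1) 0 rfl ∘ₗ ((polyD k 0).restrictScalars k).lTensor _) := by
  have h1 : δ 1 = 0 := by simpa using h.leibniz 1 1
  refine IsTwistedBimodMap.ext_gen ((isTwistedBimodMap_totComponent h e (n + 1) 1 rfl).comp _)
    (((isTwistedBimodMap_totComponent h e n 1 rfl).comp_rTensor (koszulD x c n) fun z =>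
      koszulD_kosDer h.leibniz h1 hk he n z).add
    (((isTwistedBimodMap_totComponent h e (n + 1) 0 rfl).comp_lTensor h.leibniz h.commute
      (polyD k 0) polyD_inner).smul _)) fun l l' hl _ => ?_
  rw [LinearMap.add_apply, LinearMap.smul_apply, LinearMap.comp_apply, LinearMap.comp_apply,
    LinearMap.comp_apply, LinearMap.lTensor_tmul, LinearMap.rTensor_tmul, totComponent_gen,
    LinearMap.restrictScalars_apply, LinearMap.restrictScalars_apply,
    LinearMap.restrictScalars_apply, appendLast_one, koszulD_gen _ _ _ _ (strictMono_snoc hl),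
    koszulD_gen _ _ _ _ hl, koszulFormula_snoc h hd.init hd.coeff_init rfl l hl l',
    koszulFormulaLast_eq h hd rfl l hl l']

theorem totD_totIncl {P : ℕ → Type*} {Q : ℕ → Type*} [∀ i, AddCommGroup (P i)]
    [∀ i, Module k (P i)] [∀ i, AddCommGroup (Q i)] [∀ i, Module k (Q i)]
    (dP : ∀ i, P (i + 1) →ₗ[k] P i) (dQ : ∀ j, Q (j + 1) →ₗ[k] Q j) (n i j : ℕ)
    (hn : i + j = n + 1) (z : P i ⊗[k] Q j) :
    totD dP dQ n (totIncl i j hn z) = totDComponent dP dQ n i j hn z :=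
  DirectSum.toModule_lof k _ _

theorem totDComponent_succ_zero {P : ℕ → Type*} {Q : ℕ → Type*} [∀ i, AddCommGroup (P i)]
    [∀ i, Module k (P i)] [∀ i, AddCommGroup (Q i)] [∀ i, Module k (Q i)]
    (dP : ∀ i, P (i + 1) →ₗ[k] P i) (dQ : ∀ j, Q (j + 1) →ₗ[k] Q j) (n i : ℕ)
    (hn : i + 1 + 0 = n + 1) (hn' : i + 0 = n) (z : P (i + 1) ⊗[k] Q 0) :
    totDComponent dP dQ n (i + 1) 0 hn z = totIncl i 0 hn' ((dP i).rTensor (Q 0) z) := rfl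

theorem totDComponent_zero_succ {P : ℕ → Type*} {Q : ℕ → Type*} [∀ i, AddCommGroup (P i)]
    [∀ i, Module k (P i)] [∀ i, AddCommGroup (Q i)] [∀ i, Module k (Q i)]
    (dP : ∀ i, P (i + 1) →ₗ[k] P i) (dQ : ∀ j, Q (j + 1) →ₗ[k] Q j) (n j : ℕ)
    (hn : 0 + (j + 1) = n + 1) (hn' : 0 + j = n) (z : P 0 ⊗[k] Q (j + 1)) :
    totDComponent dP dQ n 0 (j + 1) hn z = totIncl 0 j hn' ((dQ j).lTensor (P 0) z) := rfl

theorem totDComponent_succ_succ {P : ℕ → Type*} {Q : ℕ → Type*} [∀ i, AddCommGroup (P i)]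
    [∀ i, Module k (P i)] [∀ i, AddCommGroup (Q i)] [∀ i, Module k (Q i)]
    (dP : ∀ i, P (i + 1) →ₗ[k] P i) (dQ : ∀ j, Q (j + 1) →ₗ[k] Q j) (n i j : ℕ)
    (hn : i + 1 + (j + 1) = n + 1) (h₁ : i + (j + 1) = n) (h₂ : i + 1 + j = n)
    (z : P (i + 1) ⊗[k] Q (j + 1)) :
    totDComponent dP dQ n (i + 1) (j + 1) hn z =
      totIncl i (j + 1) h₁ ((dP i).rTensor (Q (j + 1)) z) +
      (-1 : k) ^ (i + 1) • totIncl (i + 1) j h₂ ((dQ j).lTensor (P (i + 1)) z) := rfl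

theorem totIncl_induction {P : ℕ → Type*} {Q : ℕ → Type*} [∀ i, AddCommGroup (P i)]
    [∀ i, Module k (P i)] [∀ i, AddCommGroup (Q i)] [∀ i, Module k (Q i)] {n : ℕ}
    {p : Tot k P Q n → Prop} (z : Tot k P Q n) (zero : p 0)
    (add : ∀ x y, p x → p y → p (x + y))
    (incl : ∀ i j (hn : i + j = n) z, p (totIncl i j hn z)) : p z := by
  induction z using DirectSum.induction_on with
  | zero => exact zero
  | of q z => exact incl q.1.1 q.1.2 q.2 z
  | add x y hx hy => exact add x y hx hy

theorem tensor_subsingleton_right {M N : Type*} [AddCommGroup M] [Module k M] [AddCommGroup N]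
    [Module k N] [Subsingleton N] (z : M ⊗[k] N) : z = 0 := by
  induction z with
  | zero => rfl
  | add x y hx hy => rw [hx, hy, add_zero]
  | tmul m n => rw [Subsingleton.elim n 0, TensorProduct.tmul_zero]

include hk he hd in
theorem totEquiv_totDComponent (i : ℕ) (z : Kos k A m (i + 1) ⊗[k] Kos k (Poly k) 1 1) :
    totEquiv h e (i + 1) (totDComponent (fun i => (koszulD x c i).restrictScalars k)
      (fun j => (polyD k j).restrictScalars k) (i + 1) (i + 1) 1 rfl z) =
      koszulD x' c' (i + 1) (totComponent h e (i + 1) 1 rfl z) := by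
  have e1 := congrArg (totEquiv h e (i + 1)) (totDComponent_succ_succ (P := Kos k A m)
    (Q := Kos k (Poly k) 1) (fun i => (koszulD x c i).restrictScalars k)
    (fun j => (polyD k j).restrictScalars k) (i + 1) i 0 rfl rfl rfl z)
  refine e1.trans ?_
  rw [map_add, map_smul, totEquiv_totIncl, totEquiv_totIncl]
  exact (LinearMap.congr_fun (koszulD_totComponent_succ_one h hd i hk he) z).symm

include hk he hd in
/-- The isomorphism with the twisted product is a chain map. -/
theorem totEquiv_totD (n : ℕ) (z : Tot k (Kos k A m) (Kos k (Poly k) 1) (n + 1)) :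
    totEquiv h e n (totD (fun i => (koszulD x c i).restrictScalars k)
      (fun j => (polyD k j).restrictScalars k) n z) = koszulD x' c' n (totEquiv h e (n + 1) z) := by
  induction z using totIncl_induction with
  | zero => simp only [map_zero]
  | add x y hx hy => simp only [map_add, hx, hy]
  | incl i j hn z =>
  rw [totD_totIncl, totEquiv_totIncl]
  -- The exterior powers of a line vanish from degree two on, so only the columns j = 0 and j = 1
  -- matter.
  rcases j with _ | _ | j
  · rcases i with _ | i
    · omega
    · obtain rfl : n = i := by omega
      rw [totDComponent_succ_zero (P := Kos k A m) (Q := Kos k (Poly k) 1) _ _ n n _ rfl, totEquiv_totIncl]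
      exact (LinearMap.congr_fun (koszulD_totComponent_zero h hd n hk he) z).symm
  · rcases i with _ | i
    · obtain rfl : n = 0 := by omega
      rw [totDComponent_zero_succ (P := Kos k A m) (Q := Kos k (Poly k) 1) _ _ 0 0 _ rfl, totEquiv_totIncl]
      exact (LinearMap.congr_fun (koszulD_totComponent_zero_one h hd) z).symm
    · obtain rfl : n = i + 1 := by omega
      exact totEquiv_totDComponent h hk he hd i z
  · have := polyKos_subsingleton (k := k) j
    rw [tensor_subsingleton_right z]
    simp only [map_zero]

theorem koszulAug_totComponent_gen (h : IsOreExtension ι y δ) (e : Fin m → (Fin m → k))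
    (z : Kos k A m 0) :
    koszulAug k T (m + 1) (totComponent h e 0 0 rfl (z ⊗ₜ gen k (Poly k) Fin.elim0)) =
      ι (koszulAug k A m z) := by
  suffices key : koszulAug k T (m + 1) ∘ₗ totComponent h e 0 0 rfl ∘ₗ
      (TensorProduct.mk k _ _).flip (gen k (Poly k) Fin.elim0) = ι.toLinearMap ∘ₗ
        koszulAug k A m from LinearMap.congr_fun key z
  refine kos_hom_ext fun a b l _ => ?_
  have e1 := totComponent_zero h e (n := 0) rfl a b (fun p => vec k m (l p)) Fin.elim0
  have e2 := koszulAug_smul_wedge (k := k) (ι a) (ι b) (fun p => inclInit k m (vec k m (l p)))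
  have e3 := koszulAug_smul_wedge (k := k) a b (fun p => vec k m (l p))
  refine (congrArg (koszulAug k T (m + 1)) e1).trans (e2.trans ?_)
  refine Eq.trans ?_ (congrArg ι e3).symm
  rw [map_mul]

theorem koszulAug_totComponent_inner (h : IsOreExtension ι y δ) (e : Fin m → (Fin m → k))
    (z : Kos k A m 0) (w' : ⋀[k]^0 (Fin 1 → k)) :
    koszulAug k T (m + 1) (totComponent h e 0 0 rfl (z ⊗ₜ inner k (Poly k) w')) =
      ι (koszulAug k A m z) * Polynomial.aeval y (koszulAug k (Poly k) 1 (inner k (Poly k) w')) := by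
  obtain ⟨r', hr'⟩ := inner_eq_smul_gen_zero (A := Poly k) w'
  have e1 : koszulAug k (Poly k) 1 (gen k (Poly k) Fin.elim0) = 1 := koszulAug_wedge _
  rw [hr', map_smul, e1, map_smul, map_one, mul_smul_comm, mul_one, TensorProduct.tmul_smul,
    map_smul, map_smul]
  exact congrArg (r' • ·) (koszulAug_totComponent_gen h e z)

theorem koszulAug_totComponent (h : IsOreExtension ι y δ) (e : Fin m → (Fin m → k))
    (z : Kos k A m 0) (n : Kos k (Poly k) 1 0) :
    koszulAug k T (m + 1) (totComponent h e 0 0 rfl (z ⊗ₜ n)) =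
      ι (koszulAug k A m z) * Polynomial.aeval y (koszulAug k (Poly k) 1 n) := by
  have h1 : δ 1 = 0 := by simpa using h.leibniz 1 1
  have ht := isTwistedBimodMap_totComponent h e 0 0 rfl
  induction n using polyBimod_induction generalizing z with
  | zero => rw [TensorProduct.tmul_zero, map_zero, map_zero, map_zero, map_zero, mul_zero]
  | add a b ha hb => rw [TensorProduct.tmul_add, map_add, map_add, ha, hb, map_add, map_add, mul_add]
  | smul r a ha =>
    rw [TensorProduct.tmul_smul, map_smul, map_smul, ha, map_smul, map_smul, mul_smul_comm]
  -- The derivation term of the rule for the left action augments to δ(ε(z)), which cancels the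
  -- commutator of y with ε(z).
  | left n hn =>
    rw [koszulAug_smul, ← sandwich_apply, ht.left, map_sub, sandwich_apply, koszulAug_smul, hn, hn,
      koszulAug_kosDer h.leibniz h1, mul_one, mul_one, map_mul, Polynomial.aeval_X, ← mul_assoc y,
      h.commute, add_mul, mul_assoc, add_sub_cancel_right]
  | right n hn =>
    rw [koszulAug_smul, ← sandwich_apply, ht.right, sandwich_apply, koszulAug_smul, hn, one_mul,
      one_mul, map_mul, Polynomial.aeval_X, mul_assoc]
  | inner w' => exact koszulAug_totComponent_inner h e z w'

/-- The isomorphism with the twisted product commutes with the augmentations. -/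
theorem koszulAug_totEquiv (h : IsOreExtension ι y δ) (e : Fin m → (Fin m → k))
    (z : Kos k A m 0 ⊗[k] Kos k (Poly k) 1 0) :
    koszulAug k T (m + 1) (totEquiv h e 0 (totIncl 0 0 rfl z)) =
      evalEquiv h (TensorProduct.map (koszulAug k A m) (koszulAug k (Poly k) 1) z) := by
  rw [totEquiv_totIncl, evalEquiv_apply]
  induction z with
  | zero => simp only [map_zero]
  | add x y hx hy => simp only [map_add, hx, hy]
  | tmul m n => rw [koszulAug_totComponent, TensorProduct.map_tmul, evalRight_tmul]

end ChainMap

/-! ### Exactness of the total complex of two columns -/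

section TwoColumns

variable {k : Type*} [Field k] {P X : ℕ → Type*} [∀ n, AddCommGroup (P n)] [∀ n, Module k (P n)]
  [∀ n, AddCommGroup (X n)] [∀ n, Module k (X n)]
  {A Q₀ Q₁ R S : Type*} [AddCommGroup A] [Module k A] [AddCommGroup Q₀] [Module k Q₀]
  [AddCommGroup Q₁] [Module k Q₁] [AddCommGroup R] [Module k R] [AddCommGroup S] [Module k S]

/-- `X` is the total complex of the tensor product of the complexes `P` and `Q₁ → Q₀`, augmented to
`A ⊗ R ≃ S`. -/
structure IsTwoColumnTotal (dP : ∀ n, P (n + 1) →ₗ[k] P n) (εP : P 0 →ₗ[k] A) (dQ : Q₁ →ₗ[k] Q₀)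
    (εQ : Q₀ →ₗ[k] R) (dX : ∀ n, X (n + 1) →ₗ[k] X n) (εX : X 0 →ₗ[k] S) (μ : A ⊗[k] R ≃ₗ[k] S)
    (I₀ : ∀ n, P n ⊗[k] Q₀ →ₗ[k] X n) (I₁ : ∀ n, P n ⊗[k] Q₁ →ₗ[k] X (n + 1)) : Prop where
  surj_zero : Function.Surjective (I₀ 0)
  inj_zero : Function.Injective (I₀ 0)
  surj_succ : ∀ n (z : X (n + 1)), ∃ a b, I₀ (n + 1) a + I₁ n b = z
  inj_succ : ∀ n a b, I₀ (n + 1) a + I₁ n b = 0 → a = 0 ∧ b = 0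
  d_left : ∀ n a, dX n (I₀ (n + 1) a) = I₀ n ((dP n).rTensor Q₀ a)
  d_right_zero : ∀ b, dX 0 (I₁ 0 b) = I₀ 0 (dQ.lTensor (P 0) b)
  d_right_succ : ∀ n b, dX (n + 1) (I₁ (n + 1) b) = I₁ n ((dP n).rTensor Q₁ b) +
    (-1 : k) ^ (n + 1) • I₀ (n + 1) (dQ.lTensor (P (n + 1)) b)
  aug : ∀ a, εX (I₀ 0 a) = μ (TensorProduct.map εP εQ a)

variable {dP : ∀ n, P (n + 1) →ₗ[k] P n} {εP : P 0 →ₗ[k] A} {dQ : Q₁ →ₗ[k] Q₀}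
    {εQ : Q₀ →ₗ[k] R} {dX : ∀ n, X (n + 1) →ₗ[k] X n} {εX : X 0 →ₗ[k] S} {μ : A ⊗[k] R ≃ₗ[k] S}
    {I₀ : ∀ n, P n ⊗[k] Q₀ →ₗ[k] X n} {I₁ : ∀ n, P n ⊗[k] Q₁ →ₗ[k] X (n + 1)}

namespace IsTwoColumnTotal

theorem rTensor_lTensor {M N M' N' : Type*} [AddCommGroup M] [Module k M] [AddCommGroup N]
    [Module k N] [AddCommGroup M'] [Module k M'] [AddCommGroup N'] [Module k N']
    (f : M →ₗ[k] M') (g : N →ₗ[k] N') (z : M ⊗[k] N) :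
    f.rTensor N' (g.lTensor M z) = g.lTensor M' (f.rTensor N z) := by
  rw [← LinearMap.comp_apply, LinearMap.rTensor_comp_lTensor, ← LinearMap.comp_apply,
    LinearMap.lTensor_comp_rTensor]

variable (h : IsTwoColumnTotal dP εP dQ εQ dX εX μ I₀ I₁)
  (hP : ∀ n, Function.Exact (dP (n + 1)) (dP n)) (hP₀ : Function.Exact (dP 0) εP)
  (hPs : Function.Surjective εP) (hQ : Function.Injective dQ) (hQ₀ : Function.Exact dQ εQ)

-- An element a killed by ε ⊗ ε is sent by ε ⊗ 1 to the image of 1 ⊗ dQ. Subtracting (1 ⊗ dQ)(b),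
-- with b a lift of a preimage, brings a into the kernel of ε ⊗ 1, which is the image of dP ⊗ 1.
-- Exactness survives tensoring because k is a field.
include h hP₀ hPs hQ₀ in
theorem exact_zero : Function.Exact (dX 0) εX := by
  intro z
  constructor
  · intro hz
    obtain ⟨a, rfl⟩ := h.surj_zero z
    rw [h.aug, LinearEquiv.map_eq_zero_iff, ← LinearMap.lTensor_comp_rTensor,
      LinearMap.comp_apply] at hz
    obtain ⟨c, hc⟩ := (Module.Flat.lTensor_exact A hQ₀ _).1 hz
    obtain ⟨b, rfl⟩ := LinearMap.rTensor_surjective Q₁ hPs c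
    rw [← rTensor_lTensor, eq_comm, ← sub_eq_zero, ← map_sub] at hc
    obtain ⟨a', ha'⟩ := (Module.Flat.rTensor_exact Q₀ hP₀ _).1 hc
    refine ⟨I₀ 1 a' + I₁ 0 b, ?_⟩
    rw [map_add, h.d_left, h.d_right_zero, ha', ← map_add, sub_add_cancel]
  · rintro ⟨z, rfl⟩
    obtain ⟨a, b, rfl⟩ := h.surj_succ 0 z
    have h1 : TensorProduct.map εP εQ ((dP 0).rTensor Q₀ a) = 0 := by
      rw [← LinearMap.lTensor_comp_rTensor, LinearMap.comp_apply,
        (Module.Flat.rTensor_exact Q₀ hP₀).apply_apply_eq_zero, map_zero]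
    have h2 : TensorProduct.map εP εQ (dQ.lTensor (P 0) b) = 0 := by
      rw [← LinearMap.rTensor_comp_lTensor, LinearMap.comp_apply,
        (Module.Flat.lTensor_exact (P 0) hQ₀).apply_apply_eq_zero, map_zero]
    rw [map_add, map_add, h.d_left, h.d_right_zero, h.aug, h.aug, h1, h2, map_zero, add_zero]

-- If I₀(a) + I₁(b) is a cycle, then b is a boundary dP(b') in its column. Subtracting the boundary
-- of I₁(b') leaves a cycle in the first column, which is exact there.
include h hP hP₀ hQ in
theorem exact_succ (n : ℕ) : Function.Exact (dX (n + 1)) (dX n) := by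
  have dd : ∀ n (a : P (n + 2) ⊗[k] Q₀), (dP n).rTensor Q₀ ((dP (n + 1)).rTensor Q₀ a) = 0 :=
    fun n a => (Module.Flat.rTensor_exact Q₀ (hP n)).apply_apply_eq_zero a
  have dd' : ∀ n (a : P (n + 2) ⊗[k] Q₁), (dP n).rTensor Q₁ ((dP (n + 1)).rTensor Q₁ a) = 0 :=
    fun n a => (Module.Flat.rTensor_exact Q₁ (hP n)).apply_apply_eq_zero a
  -- The sign is minus the (-1)^{n+1} of the differential of I₁(b'), so that the two
  -- dQ-contributions cancel.
  have key : ∀ (a : P (n + 1) ⊗[k] Q₀) (b' : P (n + 1) ⊗[k] Q₁),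
      (dP n).rTensor Q₀ (a + (-1 : k) ^ n • dQ.lTensor (P (n + 1)) b') = 0 →
      ∃ z, dX (n + 1) z = I₀ (n + 1) a + I₁ n ((dP n).rTensor Q₁ b') := by
    intro a b' hab
    obtain ⟨a', ha'⟩ := (Module.Flat.rTensor_exact Q₀ (hP n) _).1 hab
    refine ⟨I₀ (n + 2) a' + I₁ (n + 1) b', ?_⟩
    rw [map_add, h.d_left, h.d_right_succ, ha', map_add, map_smul, pow_succ, mul_neg_one, neg_smul]
    abel
  intro z
  constructor
  · intro hz
    obtain ⟨a, b, rfl⟩ := h.surj_succ n z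
    rcases n with _ | n
    · rw [map_add, h.d_left, h.d_right_zero, ← map_add] at hz
      have h0 := h.inj_zero (hz.trans (map_zero _).symm)
      -- At the end of the column no component of the differential shows that b is a cycle. Instead
      -- the relation is augmented by ε and the injectivity of dQ is used.
      have h1 : dQ.lTensor A (εP.rTensor Q₁ b) = 0 := by
        have := congrArg (εP.rTensor Q₀) h0
        rwa [map_add, (Module.Flat.rTensor_exact Q₀ hP₀).apply_apply_eq_zero, zero_add,
          rTensor_lTensor, map_zero] at this
      have h2 := Module.Flat.lTensor_preserves_injective_linearMap (M := A) dQ hQ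
        (h1.trans (map_zero _).symm)
      obtain ⟨b', rfl⟩ := (Module.Flat.rTensor_exact Q₁ hP₀ _).1 h2
      refine key a b' ?_
      rw [pow_zero, one_smul, map_add, rTensor_lTensor, h0]
    · rw [map_add, h.d_left, h.d_right_succ, ← map_smul, add_left_comm, ← map_add, add_comm (I₁ n _)] at hz
      obtain ⟨h1, h2⟩ := h.inj_succ n _ _ hz
      obtain ⟨b', rfl⟩ := (Module.Flat.rTensor_exact Q₁ (hP n) _).1 h2
      refine key a b' ?_
      rw [map_add, map_smul, rTensor_lTensor, h1]
  · rintro ⟨z, rfl⟩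
    obtain ⟨a, b, rfl⟩ := h.surj_succ (n + 1) z
    rw [map_add, map_add, h.d_left, h.d_left, dd, map_zero, zero_add, h.d_right_succ, map_add,
      map_smul, h.d_left]
    rcases n with _ | n
    · rw [h.d_right_zero, rTensor_lTensor]
      simp
    · rw [h.d_right_succ, dd', map_zero, zero_add, rTensor_lTensor, ← add_smul, pow_succ _ (n + 1)]
      simp

end IsTwoColumnTotal

end TwoColumns

/-! ### The Koszul resolution of k[X] -/

section PolyExact

variable {k : Type u} [Field k] {A : Type v} [Ring A] [Algebra k A]

theorem exists_eq_smul_of_inner {W : Type*} [AddCommGroup W] [Module k W] {g : FreeBimod k A W}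
    (hg : ∀ w, ∃ r : k, inner k A w = r • g) (z : FreeBimod k A W) : ∃ e : Env k A, z = e • g := by
  induction z using FreeBimod.induction with
  | zero => exact ⟨0, (zero_smul (Env k A) g).symm⟩
  | add x y hx hy =>
    obtain ⟨a, rfl⟩ := hx
    obtain ⟨b, rfl⟩ := hy
    exact ⟨a + b, (add_smul a b g).symm⟩
  | smul_inner a b w =>
    obtain ⟨r, hr⟩ := hg w
    refine ⟨r • (a ⊗ₜ[k] MulOpposite.op b : Env k A), ?_⟩
    rw [hr, smul_assoc]
    exact (sandwich k a b).map_smul r g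

variable (k A) in
/-- The linear map `e • (1 ⊗ 1) ↦ e`. -/
noncomputable def kosZeroToEnv (m : ℕ) : Kos k A m 0 →ₗ[k] Env k A :=
  ((TensorProduct.rid k (Env k A)).toLinearMap ∘ₗ
    (exteriorPower.zeroEquiv k (Fin m → k)).toLinearMap.lTensor (Env k A) :
    Env k A ⊗[k] (⋀[k]^0 (Fin m → k)) →ₗ[k] Env k A)

theorem kosZeroToEnv_smul_gen {m : ℕ} (e : Env k A) (l : Fin 0 → Fin m) :
    kosZeroToEnv k A m (e • gen k A l) = e := by
  rw [gen, wedge, smul_inner]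
  change TensorProduct.rid k (Env k A) (e ⊗ₜ exteriorPower.zeroEquiv k (Fin m → k) _) = e
  simp

theorem smul_gen_zero_injective {m : ℕ} {e : Env k A} {l : Fin 0 → Fin m}
    (h : e • gen k A l = 0) : e = 0 := by
  rw [← kosZeroToEnv_smul_gen e l, h, map_zero]

/-- The enveloping algebra of `k[X]` is a polynomial ring in two variables. -/
noncomputable def polyEnvEquiv (k : Type u) [Field k] :
    Env k (Poly k) ≃ₐ[k] Polynomial (Poly k) :=
  (Algebra.TensorProduct.congr AlgEquiv.refl (AlgEquiv.toOpposite k (Poly k)).symm).trans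
    (polyEquivTensor k (Poly k)).symm

theorem polyEnvEquiv_tmul (p q : Poly k) : polyEnvEquiv k (p ⊗ₜ MulOpposite.op q) =
    Polynomial.C p * q.map Polynomial.C := by
  simp [polyEnvEquiv, polyEquivTensor_symm_apply_tmul_eq_smul, Polynomial.smul_eq_C_mul]

variable (k) in
/-- The element `X ⊗ 1 - 1 ⊗ X`. -/
noncomputable def polyDiff : Env k (Poly k) :=
  (Polynomial.X : Poly k) ⊗ₜ 1 - 1 ⊗ₜ MulOpposite.op (Polynomial.X : Poly k)

theorem polyDiff_ne_zero : polyEnvEquiv k (polyDiff k) ≠ 0 := by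
  have : polyEnvEquiv k (polyDiff k) = Polynomial.C (Polynomial.X) - Polynomial.X := by
    rw [polyDiff, map_sub, ← MulOpposite.op_one, polyEnvEquiv_tmul, polyEnvEquiv_tmul]
    simp
  rw [this, ← neg_sub, neg_ne_zero]
  exact Polynomial.X_sub_C_ne_zero _

theorem eq_zero_of_mul_polyDiff {e : Env k (Poly k)} (h : e * polyDiff k = 0) : e = 0 := by
  have := congrArg (polyEnvEquiv k) h
  rw [map_mul, map_zero, mul_eq_zero, or_iff_left polyDiff_ne_zero,
    EmbeddingLike.map_eq_zero_iff] at this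
  exact this

theorem polyD_smul_gen (e : Env k (Poly k)) :
    polyD k 0 (e • gen k (Poly k) (fun _ : Fin 1 => (0 : Fin 1))) =
      (e * polyDiff k) • gen k (Poly k) Fin.elim0 := by
  rw [(polyD k 0).map_smul, polyD_gen, mul_smul, polyDiff, sub_smul]
  rfl

/-- On free generators the differential is multiplication by X ⊗ 1 - 1 ⊗ X, a nonzero element of the
enveloping algebra of k[X], which is a domain, being a polynomial ring in two variables. -/
theorem polyD_injective : Function.Injective (polyD k 0) := by
  refine (injective_iff_map_eq_zero _).2 fun z hz => ?_
  obtain ⟨e, rfl⟩ := exists_eq_smul_of_inner inner_eq_smul_gen_one z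
  rw [polyD_smul_gen] at hz
  rw [eq_zero_of_mul_polyDiff (smul_gen_zero_injective hz)]
  exact zero_smul (Env k (Poly k)) (gen k (Poly k) (fun _ : Fin 1 => (0 : Fin 1)))

theorem koszulAug_polyD (z : Kos k (Poly k) 1 1) :
    koszulAug k (Poly k) 1 (polyD k 0 z) = 0 := by
  have hz : ∀ p q : Poly k, koszulAug k (Poly k) 1 (polyD k 0
      (sandwich k p q (gen k (Poly k) (fun _ : Fin 1 => (0 : Fin 1))))) = 0 := by
    intro p q
    rw [sandwich_apply, (polyD k 0).map_smul, koszulAug_smul, polyD_gen, map_sub]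
    change p * (koszulAug k (Poly k) 1 (sandwich k _ _ _) -
      koszulAug k (Poly k) 1 (sandwich k _ _ _)) * q = 0
    rw [sandwich_apply, sandwich_apply, koszulAug_smul, koszulAug_smul, gen, koszulAug_wedge]
    ring
  suffices h : koszulAug k (Poly k) 1 ∘ₗ (polyD k 0).restrictScalars k = 0 from
    LinearMap.congr_fun h z
  refine FreeBimod.hom_ext fun a b w => ?_
  obtain ⟨r, hr⟩ := inner_eq_smul_gen_one w
  rw [hr, ← sandwich_apply, map_smul, map_smul, LinearMap.zero_apply]
  exact (congrArg (r • ·) (hz a b)).trans (smul_zero r)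

theorem polyD_sandwich (p q : Poly k) (z : Kos k (Poly k) 1 1) :
    polyD k 0 (sandwich k p q z) = sandwich k p q (polyD k 0 z) :=
  (polyD k 0).map_smul _ z

theorem sandwich_X_telescope {M : Type*} [AddCommGroup M] [Module k M] [Module (Env k (Poly k)) M]
    [IsScalarTower k (Env k (Poly k)) M] (s : Poly k) (z g : M) :
    sandwich k (Polynomial.X : Poly k) 1 (z - sandwich k 1 s g) +
      sandwich k 1 s (leftX k _ g - rightX k _ g) =
    sandwich k (Polynomial.X : Poly k) 1 z - sandwich k 1 (Polynomial.X * s) g := by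
  simp only [map_sub, leftX, rightX, sandwich_sandwich, one_mul, mul_one]
  abel

/-- Modulo the image of the differential the left and right actions of X coincide, so every element
can be moved entirely to the right, where it becomes 1 ⊗ ε(z). Exactness at degree zero follows. -/
theorem sub_koszulAug_mem_range (z : Kos k (Poly k) 1 0) :
    ∃ w, polyD k 0 w = z - sandwich k 1 (koszulAug k (Poly k) 1 z) (gen k (Poly k) Fin.elim0) := by
  induction z using polyBimod_induction with
  | zero => exact ⟨0, by rw [map_zero, map_zero, sandwich_apply, MulOpposite.op_zero, tmul_zero_smul, sub_zero]⟩
  | add x y hx hy =>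
    obtain ⟨a, ha⟩ := hx
    obtain ⟨b, hb⟩ := hy
    refine ⟨a + b, ?_⟩
    rw [map_add, map_add, sandwich_add_right, ha, hb]
    abel
  | smul c x hx =>
    obtain ⟨a, ha⟩ := hx
    refine ⟨c • a, ?_⟩
    have e1 : polyD k 0 (c • a) = c • polyD k 0 a := ((polyD k 0).restrictScalars k).map_smul c a
    rw [e1, ha, map_smul, sandwich_smul_right, smul_sub]
  | inner w =>
    obtain ⟨r, hr⟩ := inner_eq_smul_gen_zero (A := Poly k) w
    refine ⟨0, ?_⟩
    rw [hr, map_smul, sandwich_smul_right, gen, koszulAug_wedge, sandwich_apply,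
      one_tmul_op_one_smul, sub_self, map_zero]
  | left z hz =>
    obtain ⟨a, ha⟩ := hz
    -- The first summand handles z by induction; the second has boundary X ⊗ ε(z) - 1 ⊗ X ε(z),
    -- which moves the new factor X to the right.
    refine ⟨sandwich k (Polynomial.X : Poly k) 1 a + sandwich k 1 (koszulAug k (Poly k) 1 z)
      (gen k (Poly k) (fun _ : Fin 1 => (0 : Fin 1))), ?_⟩
    rw [map_add, polyD_sandwich, polyD_sandwich, ha, polyD_gen, koszulAug_smul, ← sandwich_apply,
      mul_one]
    exact sandwich_X_telescope _ _ _
  | right z hz =>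
    obtain ⟨a, ha⟩ := hz
    refine ⟨sandwich k 1 (Polynomial.X : Poly k) a, ?_⟩
    rw [polyD_sandwich, ha, koszulAug_smul, ← sandwich_apply]
    simp only [map_sub, sandwich_sandwich, one_mul]

theorem koszulAug_surjective {m : ℕ} : Function.Surjective (koszulAug k A m) := fun a =>
  ⟨(a ⊗ₜ MulOpposite.op 1 : Env k A) • wedge k A Fin.elim0, by
    rw [koszulAug_smul_wedge, mul_one]⟩

theorem kos_free (m n : ℕ) : Module.Free (Env k A) (Kos k A m n) :=
  Module.Free.of_basis (kosBasis k A m n)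

variable (k) in
/-- The Koszul resolution of the polynomial ring. -/
theorem isFreeResolution_poly :
    IsFreeResolution (P := Kos k (Poly k) 1) (polyD k) (koszulAug k (Poly k) 1) where
  aug_act a b z := koszulAug_smul a b z
  free n := kos_free 1 n
  exact_succ n z := by
    rcases n with _ | n
    · have := polyKos_subsingleton (k := k) 0
      constructor
      · exact fun h => ⟨0, by rw [map_zero, polyD_injective (h.trans (map_zero _).symm)]⟩
      · rintro ⟨y, rfl⟩
        rw [Subsingleton.elim y 0, map_zero, map_zero]
    · have := polyKos_subsingleton (k := k) n
      have := polyKos_subsingleton (k := k) (n + 1)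
      refine ⟨fun _ => ⟨0, Subsingleton.elim _ _⟩, fun _ => ?_⟩
      rw [Subsingleton.elim z 0, map_zero]
  exact_zero z := by
    constructor
    · intro hz
      obtain ⟨w, hw⟩ := sub_koszulAug_mem_range z
      refine ⟨w, ?_⟩
      rw [hw, hz, sandwich_apply, MulOpposite.op_zero, tmul_zero_smul, sub_zero]
    · rintro ⟨w, rfl⟩
      exact koszulAug_polyD w
  surjective := koszulAug_surjective

end PolyExact

/-! ### Independence of the summands of the total complex -/

section TotalInjective

variable {k : Type u} [Field k] {P : ℕ → Type*} {Q : ℕ → Type*} [∀ i, AddCommGroup (P i)]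
    [∀ i, Module k (P i)] [∀ i, AddCommGroup (Q i)] [∀ i, Module k (Q i)]

theorem totIncl_injective {i j n : ℕ} (h : i + j = n) :
    Function.Injective (totIncl (k := k) (P := P) (Q := Q) i j h) :=
  fun a b hab => by
    have e := DirectSum.component.lof_self (R := k) (ι := {p : ℕ × ℕ // p.1 + p.2 = n})
      (M := fun p => P p.1.1 ⊗[k] Q p.1.2) ⟨(i, j), h⟩
    exact (e a).symm.trans ((congrArg _ hab).trans (e b))

theorem totIncl_add_eq_zero {i j i' j' n : ℕ} (h : i + j = n) (h' : i' + j' = n) (hi : i ≠ i')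
    {a : P i ⊗[k] Q j} {b : P i' ⊗[k] Q j'} (hab : totIncl i j h a + totIncl i' j' h' b = 0) :
    a = 0 ∧ b = 0 := by
  have key : ∀ {i j i' j' : ℕ} (h : i + j = n) (h' : i' + j' = n) (_ : i ≠ i')
      (a : P i ⊗[k] Q j) (b : P i' ⊗[k] Q j'), totIncl i j h a + totIncl i' j' h' b = 0 → a = 0 := by
    intro i j i' j' h h' hi a b hab
    have := congrArg (DirectSum.component k {p : ℕ × ℕ // p.1 + p.2 = n}
      (fun p => P p.1.1 ⊗[k] Q p.1.2) ⟨(i, j), h⟩) hab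
    rw [map_add, map_zero, totIncl, totIncl] at this
    have e1 := DirectSum.component.lof_self (R := k) (ι := {p : ℕ × ℕ // p.1 + p.2 = n})
      (M := fun p => P p.1.1 ⊗[k] Q p.1.2) ⟨(i, j), h⟩ a
    have e2 := DirectSum.component.of (R := k) (ι := {p : ℕ × ℕ // p.1 + p.2 = n})
      (M := fun p => P p.1.1 ⊗[k] Q p.1.2) ⟨(i, j), h⟩ ⟨(i', j'), h'⟩ b
    rw [dif_neg (fun he => hi (congrArg (fun p => p.1.1) he).symm)] at e2
    exact (add_zero a).symm.trans ((congrArg₂ (· + ·) e1 e2).symm.trans this)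
  exact ⟨key h h' hi a b hab, key h' h hi.symm b a ((add_comm _ _).trans hab)⟩

end TotalInjective

/-! ### The inductive step: one Ore extension -/

section Step

variable {k : Type u} [Field k] {A T : Type v} [Ring A] [Algebra k A] [Ring T] [Algebra k T]
  {ι : A →ₐ[k] T} {y : T} {δ : A →ₗ[k] A} {m : ℕ}
  {x : Fin m → A} {c : Fin m → Fin m → (Fin m → k)} {x' : Fin (m + 1) → T}
  {c' : Fin (m + 1) → Fin (m + 1) → (Fin (m + 1) → k)} {e : Fin m → (Fin m → k)}

theorem totComponent_surjective_zero (h : IsOreExtension ι y δ) (e : Fin m → (Fin m → k)) :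
    Function.Surjective (totComponent h e 0 0 rfl) := by
  intro z
  obtain ⟨w, rfl⟩ := (totEquiv h e 0).surjective z
  induction w using totIncl_induction with
  | zero => exact ⟨0, by simp only [map_zero]⟩
  | add x y hx hy =>
    obtain ⟨a, ha⟩ := hx
    obtain ⟨b, hb⟩ := hy
    exact ⟨a + b, by rw [map_add, map_add, ha, hb]⟩
  | incl i j hn z =>
    obtain rfl : i = 0 := by omega
    obtain rfl : j = 0 := by omega
    exact ⟨z, (totEquiv_totIncl h e 0 0 hn z).symm⟩

theorem totComponent_injective (h : IsOreExtension ι y δ) (e : Fin m → (Fin m → k)) {i j n : ℕ}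
    (hn : i + j = n) : Function.Injective (totComponent h e i j hn) := by
  intro a b hab
  rw [← totEquiv_totIncl, ← totEquiv_totIncl] at hab
  exact totIncl_injective hn ((totEquiv h e n).injective hab)

theorem totComponent_eq_zero (h : IsOreExtension ι y δ) (e : Fin m → (Fin m → k)) {i j n : ℕ}
    (hn : i + (j + 2) = n) (z : Kos k A m i ⊗[k] Kos k (Poly k) 1 (j + 2)) :
    totComponent h e i (j + 2) hn z = 0 := by
  have := polyKos_subsingleton (k := k) j
  rw [tensor_subsingleton_right z, map_zero]

theorem exists_totComponent_eq (h : IsOreExtension ι y δ) (e : Fin m → (Fin m → k)) {i j n : ℕ}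
    (hn : i + j = n + 1) (z : Kos k A m i ⊗[k] Kos k (Poly k) 1 j) :
    ∃ a b, totComponent h e (n + 1) 0 rfl a + totComponent h e n 1 rfl b =
      totComponent h e i j hn z := by
  rcases j with _ | _ | j
  · obtain rfl : i = n + 1 := by omega
    exact ⟨z, 0, (congrArg _ (map_zero _)).trans (add_zero _)⟩
  · obtain rfl : i = n := by omega
    exact ⟨0, z, (congrArg (· + _) (map_zero _)).trans (zero_add _)⟩
  · exact ⟨0, 0, (congrArg₂ (· + ·) (map_zero _) (map_zero _)).trans
      ((add_zero _).trans (totComponent_eq_zero h e hn z).symm)⟩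

/-- All columns other than j = 0 and j = 1 vanish, so the total isomorphism already gives a
decomposition into two components. -/
theorem totComponent_surjective_succ (h : IsOreExtension ι y δ) (e : Fin m → (Fin m → k)) (n : ℕ)
    (z : Kos k T (m + 1) (n + 1)) :
    ∃ a b, totComponent h e (n + 1) 0 rfl a + totComponent h e n 1 rfl b = z := by
  obtain ⟨w, rfl⟩ := (totEquiv h e (n + 1)).surjective z
  induction w using totIncl_induction with
  | zero => exact ⟨0, 0, by simp only [map_zero, add_zero]⟩
  | add x y hx hy =>
    obtain ⟨a, b, h1⟩ := hx
    obtain ⟨a', b', h2⟩ := hy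
    exact ⟨a + a', b + b', by rw [map_add, map_add, map_add, ← h1, ← h2, add_add_add_comm]⟩
  | incl i j hn z =>
    obtain ⟨a, b, hab⟩ := exists_totComponent_eq h e hn z
    exact ⟨a, b, hab.trans (totEquiv_totIncl h e i j hn z).symm⟩

theorem totComponent_add_eq_zero (h : IsOreExtension ι y δ) (e : Fin m → (Fin m → k)) (n : ℕ)
    (a : Kos k A m (n + 1) ⊗[k] Kos k (Poly k) 1 0) (b : Kos k A m n ⊗[k] Kos k (Poly k) 1 1)
    (hab : totComponent h e (n + 1) 0 rfl a + totComponent h e n 1 rfl b = 0) :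
    a = 0 ∧ b = 0 := by
  rw [← totEquiv_totIncl, ← totEquiv_totIncl, ← map_add, LinearEquiv.map_eq_zero_iff] at hab
  exact totIncl_add_eq_zero _ _ (by omega) hab

theorem isTwoColumnTotal_kos (h : IsOreExtension ι y δ) (hk : IsKoszulData x c)
    (he : IsLinearPart δ x e) (hd : IsExtensionData ι y x c e x' c') :
    IsTwoColumnTotal (P := Kos k A m) (X := Kos k T (m + 1))
      (fun n => (koszulD x c n).restrictScalars k) (koszulAug k A m)
      ((polyD k 0).restrictScalars k) (koszulAug k (Poly k) 1)
      (fun n => (koszulD x' c' n).restrictScalars k) (koszulAug k T (m + 1)) (evalEquiv h)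
      (fun n => totComponent h e n 0 rfl) (fun n => totComponent h e n 1 rfl) where
  surj_zero := totComponent_surjective_zero h e
  inj_zero := totComponent_injective h e rfl
  surj_succ := totComponent_surjective_succ h e
  inj_succ := totComponent_add_eq_zero h e
  d_left n := LinearMap.congr_fun (koszulD_totComponent_zero h hd n hk he)
  d_right_zero := LinearMap.congr_fun (koszulD_totComponent_zero_one h hd)
  d_right_succ n := LinearMap.congr_fun (koszulD_totComponent_succ_one h hd n hk he)
  aug a := (congrArg _ (totEquiv_totIncl h e 0 0 rfl a).symm).trans (koszulAug_totEquiv h e a)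

/-- The complex of an Ore extension is a free resolution if that of the base ring is one. -/
theorem isFreeResolution_oreExtension (h : IsOreExtension ι y δ) (hk : IsKoszulData x c)
    (he : IsLinearPart δ x e) (hd : IsExtensionData ι y x c e x' c')
    (hr : IsFreeResolution (P := Kos k A m) (koszulD x c) (koszulAug k A m)) :
    IsFreeResolution (P := Kos k T (m + 1)) (koszulD x' c') (koszulAug k T (m + 1)) where
  aug_act a b z := koszulAug_smul a b z
  free n := kos_free (m + 1) n
  exact_succ n := (isTwoColumnTotal_kos h hk he hd).exact_succ hr.exact_succ hr.exact_zero
    polyD_injective n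
  exact_zero := (isTwoColumnTotal_kos h hk he hd).exact_zero hr.exact_zero hr.surjective
    (isFreeResolution_poly k).exact_zero
  surjective := koszulAug_surjective

theorem isTwistedProductIso_totEquiv (h : IsOreExtension ι y δ) (hk : IsKoszulData x c)
    (he : IsLinearPart δ x e) (hd : IsExtensionData ι y x c e x' c') :
    IsTwistedProductIso (P := Kos k A m) (Q := Kos k (Poly k) 1) (X := Kos k T (m + 1)) (twist δ)
      (evalEquiv h) (koszulD x c) (koszulAug k A m) (polyD k) (koszulAug k (Poly k) 1)
      (koszulD x' c') (koszulAug k T (m + 1)) (fun n => twist (kosDer δ e n)) (fun _ => rtwist δ)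
      (totEquiv h e) where
  map_mul := evalEquiv_twistMul h
  map_one := by rw [evalEquiv_apply, evalRight_tmul, map_one, map_one, one_mul]
  act i j n hn u v z := by
    rw [totEquiv_totIncl, totEquiv_totIncl]
    exact (isTwistedBimodMap_totComponent h e i j hn).twistedAct h u v z
  chain := totEquiv_totD h hk he hd
  aug := koszulAug_totEquiv h e

/-- The complex of an Ore extension is a twisted product. -/
theorem isTwistedProductStep_oreExtension (h : IsOreExtension ι y δ) (hk : IsKoszulData x c)
    (he : IsLinearPart δ x e) (hd : IsExtensionData ι y x c e x' c')
    (hr : IsFreeResolution (P := Kos k A m) (koszulD x c) (koszulAug k A m)) :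
    IsTwistedProductStep ι δ x c x' c' := by
  have h1 : δ 1 = 0 := by simpa using h.leibniz 1 1
  obtain ⟨f, hf1, hf⟩ := hk.coord
  refine ⟨hr, isFreeResolution_poly k, twist δ, evalEquiv h, symmetrize x,
    fun n => twist (rbarDer δ h1 n), fun n => twist (kosDer δ e n), fun _ => rtwist δ,
    totEquiv h e, isTwistingMap_twist δ h.leibniz, twist_X δ, fun a p => ?_,
    isSymmetrizationEmbedding_symmetrize hk.comm f hf1 hf, fun n => ?_, fun n => ?_,
    isCompatibleResolutionLeft_kosDer h.leibniz h1 hk he,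
    isCompatibleResolutionRight_rtwist h.leibniz, fun n w a => rtwist_inner δ w a,
    isTwistedProductIso_totEquiv h hk he hd, fun i j n hn l l' => ?_⟩
  · rw [evalEquiv_apply, evalRight_tmul, hd.last]
  · rw [twistPow_twist]
    exact twist_natural _ (LinearMap.ext fun z => (rbarDer_toRBar δ h1 n z).symm)
  -- The embedding intertwines the derivations of the Koszul complex and of the reduced bar
  -- resolution, so the twisting of the latter restricts to the former.
  · exact (twist_natural _ (LinearMap.ext fun z =>
      symmetrize_kosDer h.leibniz h1 he n z)).symm
  · rw [totEquiv_totIncl, totComponent_gen]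
    rfl

end Step

/-! ### Extension of the inductive data along an Ore extension, and the base case -/

section KoszulData

variable {k : Type u} [Field k] {A T : Type v} [Ring A] [Algebra k A] [Ring T] [Algebra k T]
  {ι : A →ₐ[k] T} {y : T} {δ : A →ₗ[k] A} {m : ℕ}
  {x : Fin m → A} {c : Fin m → Fin m → (Fin m → k)} {x' : Fin (m + 1) → T}
  {c' : Fin (m + 1) → Fin (m + 1) → (Fin (m + 1) → k)} {e : Fin m → (Fin m → k)}

/-- Coordinate functionals extend along an Ore extension. -/
theorem exists_coord_oreExtension [Nontrivial A] (h : IsOreExtension ι y δ)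
    (hinit : ∀ i, x' i.castSucc = ι (x i)) (hlast : x' (Fin.last m) = y)
    (hx : ∃ f : A →ₗ[k] (Fin m → k), f 1 = 0 ∧ ∀ i, f (x i) = vec k m i) :
    ∃ f : T →ₗ[k] (Fin (m + 1) → k), f 1 = 0 ∧ ∀ i, f (x' i) = vec k (m + 1) i := by
  obtain ⟨f, hf1, hf⟩ := hx
  -- A functional with value 1 at the unit exists because `A` is nontrivial; it is needed to
  -- normalize the coefficient of y.
  obtain ⟨g, hg⟩ := LinearMap.exists_leftInverse_of_injective (Algebra.linearMap k A)
    (LinearMap.ker_eq_bot.2 (FaithfulSMul.algebraMap_injective k A))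
  have hg1 : g 1 = 1 := by simpa using LinearMap.congr_fun hg 1
  -- In terms of left coefficients of powers of y, the first m coordinates are read from y^0 by `f`
  -- and the last one from y^1 by `g`.
  let G : A ⊗[k] Poly k →ₗ[k] (Fin (m + 1) → k) :=
    inclInit k m ∘ₗ f ∘ₗ (TensorProduct.rid k A).toLinearMap ∘ₗ (Polynomial.lcoeff k 0).lTensor A +
      LinearMap.toSpanSingleton k _ (vec k (m + 1) (Fin.last m)) ∘ₗ LinearMap.mul' k k ∘ₗ
        TensorProduct.map g (Polynomial.lcoeff k 1)
  have hG : ∀ a p, G (a ⊗ₜ p) = inclInit k m (f (p.coeff 0 • a)) +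
      (g a * p.coeff 1) • vec k (m + 1) (Fin.last m) := fun a p => by simp [G]
  have hι : ∀ a, (evalEquiv h).symm (ι a) = a ⊗ₜ 1 := fun a => by
    rw [LinearEquiv.symm_apply_eq, evalEquiv_apply, evalRight_tmul, map_one, mul_one]
  have hy : (evalEquiv h).symm y = 1 ⊗ₜ Polynomial.X := by
    rw [LinearEquiv.symm_apply_eq, evalEquiv_apply, evalRight_tmul, map_one, one_mul,
      Polynomial.aeval_X]
  have hGι : ∀ a, (G ∘ₗ (evalEquiv h).symm.toLinearMap) (ι a) = inclInit k m (f a) := fun a => by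
    rw [LinearMap.comp_apply, LinearEquiv.coe_coe, hι, hG]
    simp [Polynomial.coeff_one]
  refine ⟨G ∘ₗ (evalEquiv h).symm.toLinearMap, ?_, fun i => ?_⟩
  · rw [← map_one ι, hGι, hf1, map_zero]
  · induction i using Fin.lastCases with
    | last =>
      rw [hlast, LinearMap.comp_apply, LinearEquiv.coe_coe, hy, hG]
      simp [hg1]
    | cast i => rw [hinit, hGι, hf, inclInit_vec]

theorem linearCombination_inclInit (hinit : ∀ i, x' i.castSucc = ι (x i)) (v : Fin m → k) :
    Fintype.linearCombination k x' (inclInit k m v) = ι (Fintype.linearCombination k x v) := by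
  suffices h : Fintype.linearCombination k x' ∘ₗ inclInit k m =
      ι.toLinearMap ∘ₗ Fintype.linearCombination k x from LinearMap.congr_fun h v
  refine (Pi.basisFun k (Fin m)).ext fun i => ?_
  have hi : Pi.basisFun k (Fin m) i = vec k m i := by rw [Pi.basisFun_apply, vec]
  rw [hi, LinearMap.comp_apply, LinearMap.comp_apply, inclInit_vec, linearCombination_vec,
    linearCombination_vec, hinit]
  rfl

theorem inclInit_castSucc (v : Fin m → k) (i : Fin m) : inclInit k m v i.castSucc = v i := by
  simp [inclInit, Fintype.linearCombination_apply, vec, Pi.single_apply]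

theorem inclInit_last (v : Fin m → k) : inclInit k m v (Fin.last m) = 0 := by
  simp [inclInit, Fintype.linearCombination_apply, vec, (Fin.castSucc_lt_last _).ne']

theorem map_mem_span_one {s : A} (hs : s ∈ Submodule.span k {(1 : A)}) :
    ι s ∈ Submodule.span k {(1 : T)} := by
  obtain ⟨r, rfl⟩ := Submodule.mem_span_singleton.1 hs
  exact Submodule.mem_span_singleton.2 ⟨r, by rw [map_smul, map_one]⟩

/-- The only new commutators are those of y with the x_i, and by the Ore relation these are δ(x_i),
whose linear parts are the e_i. -/
theorem isKoszulData_oreExtension [Nontrivial A] (h : IsOreExtension ι y δ) (hk : IsKoszulData x c)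
    (he : IsLinearPart δ x e) (hd : IsExtensionData ι y x c e x' c') : IsKoszulData x' c' where
  comm i j hij := by
    induction i using Fin.lastCases with
    | last => exact absurd hij (Fin.not_lt.2 (Fin.le_last j))
    | cast i =>
    induction j using Fin.lastCases with
    | last =>
      rw [hd.coeff_last, linearCombination_inclInit hd.init, hd.init, hd.last, h.commute,
        add_sub_cancel_left, ← map_sub]
      exact map_mem_span_one (he i)
    | cast j =>
      have hij' : i < j := Fin.castSucc_lt_castSucc_iff.1 hij
      rw [hd.coeff_init i j hij', linearCombination_inclInit hd.init, hd.init, hd.init, ← map_mul,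
        ← map_mul, ← map_sub, ← map_sub]
      exact map_mem_span_one (hk.comm i j hij')
  coord := exists_coord_oreExtension h hd.init hd.last hk.coord

theorem isOreExtension_equiv {T' : Type v} [Ring T'] [Algebra k T'] (h : IsOreExtension ι y δ)
    (f : T ≃ₐ[k] T') : IsOreExtension (f.toAlgHom.comp ι) (f y) δ where
  leibniz := h.leibniz
  commute r := by
    have := congrArg f (h.commute r)
    rwa [map_mul, map_add, map_mul] at this
  basis := by
    convert f.bijective.comp h.basis using 1
    funext g
    simp [Finsupp.sum, map_sum]

theorem isExtensionData_equiv {T' : Type v} [Ring T'] [Algebra k T']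
    (hd : IsExtensionData ι y x c e x' c') (f : T ≃ₐ[k] T') :
    IsExtensionData (f.toAlgHom.comp ι) (f y) x c e (f ∘ x') c' where
  init i := congrArg f (hd.init i)
  last := congrArg f hd.last
  coeff_init := hd.coeff_init
  coeff_last := hd.coeff_last

theorem isKoszulData_zero (x : Fin 0 → A) (c : Fin 0 → Fin 0 → (Fin 0 → k)) : IsKoszulData x c where
  comm i := i.elim0
  coord := ⟨0, rfl, fun i => i.elim0⟩

/-- Here A is k itself. The complex is concentrated in degree zero, where it is one-dimensional and
is mapped isomorphically onto k by the augmentation. -/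
theorem isFreeResolution_zero [Nontrivial A] (hA : Function.Surjective (algebraMap k A))
    (x : Fin 0 → A) (c : Fin 0 → Fin 0 → (Fin 0 → k)) :
    IsFreeResolution (P := Kos k A 0) (koszulD x c) (koszulAug k A 0) := by
  have hs : ∀ n, Subsingleton (Kos k A 0 (n + 1)) := fun n => by
    have := subsingleton_exteriorPower_of_lt (k := k) (Nat.succ_pos n)
    exact FreeBimod.subsingleton
  have hz : ∀ z : Kos k A 0 0, ∃ r : k, z = r • gen k A Fin.elim0 := by
    intro z
    induction z using FreeBimod.induction with
    | zero => exact ⟨0, by rw [zero_smul]⟩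
    | add x y hx hy =>
      obtain ⟨a, rfl⟩ := hx
      obtain ⟨b, rfl⟩ := hy
      exact ⟨a + b, by rw [add_smul]⟩
    | smul_inner a b w =>
      obtain ⟨r, hr⟩ := inner_eq_smul_gen_zero (A := A) w
      obtain ⟨a, rfl⟩ := hA a
      obtain ⟨b, rfl⟩ := hA b
      refine ⟨a • b • r, ?_⟩
      rw [← sandwich_apply, Algebra.algebraMap_eq_smul_one, Algebra.algebraMap_eq_smul_one,
        sandwich_smul_left, sandwich_smul_right, sandwich_apply, one_tmul_op_one_smul, hr,
        smul_assoc, smul_assoc]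
  refine ⟨koszulAug_smul, kos_free 0, fun n z => ?_, fun z => ?_, koszulAug_surjective⟩
  · exact ⟨fun _ => ⟨0, Subsingleton.elim _ _⟩, fun _ => by
      rw [Subsingleton.elim z 0, map_zero]⟩
  · constructor
    · intro h
      obtain ⟨r, rfl⟩ := hz z
      rw [map_smul, gen, koszulAug_wedge, smul_eq_zero, or_iff_left one_ne_zero] at h
      exact ⟨0, by rw [h, zero_smul, map_zero]⟩
    · rintro ⟨z, rfl⟩
      rw [Subsingleton.elim z 0, map_zero, map_zero]

end KoszulData

/-! ### Induction along the stages of an iterated Ore extension -/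

namespace IteratedOreExtension

variable {k : Type u} [Field k] {S : Type v} [Ring S] [Algebra k S] {t : ℕ}
  (O : IteratedOreExtension k S t)

theorem isOreExtension_stage {m : ℕ} (hm : m < t) : IsOreExtension
    (Subalgebra.inclusion (stage_mono O.x (Nat.le_succ m)) : stage k O.x m →ₐ[k] stage k O.x (m + 1))
    (O.stageX (Nat.succ_le_of_lt hm) (Fin.last m)) (O.δ ⟨m, hm⟩) :=
  O.isOre ⟨m, hm⟩

/-- The identification of the last stage with the whole algebra. -/
noncomputable def topEquiv : stage k O.x t ≃ₐ[k] S :=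
  (Subalgebra.equivOfEq _ _ O.top).trans Subalgebra.topEquiv

theorem algebraMap_stage_zero_surjective : Function.Surjective (algebraMap k (stage k O.x 0)) := by
  rintro ⟨s, hs⟩
  have : stage k O.x 0 = ⊥ := by simp [stage]
  rw [this, Algebra.mem_bot] at hs
  obtain ⟨r, rfl⟩ := hs
  exact ⟨r, rfl⟩

/-- This expresses that the generators are linearly independent modulo constants. It does not use
the filtration hypothesis and can therefore serve to identify the linear parts. -/
theorem exists_coord_stage [Nontrivial S] (m : ℕ) (hm : m ≤ t) : ∃ f : stage k O.x m →ₗ[k] (Fin m → k),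
    f 1 = 0 ∧ ∀ i, f (O.stageX hm i) = vec k m i := by
  induction m with
  | zero => exact ⟨0, rfl, fun i => i.elim0⟩
  | succ m ih =>
    exact exists_coord_oreExtension (O.isOreExtension_stage hm) (fun _ => rfl) rfl
      (ih (Nat.le_of_succ_le hm))

theorem exists_coord [Nontrivial S] : ∃ f : S →ₗ[k] (Fin t → k), f 1 = 0 ∧ ∀ i, f (O.x i) = vec k t i := by
  obtain ⟨f, hf1, hf⟩ := O.exists_coord_stage t le_rfl
  refine ⟨f ∘ₗ O.topEquiv.symm.toLinearMap, ?_, fun i => ?_⟩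
  · rw [LinearMap.comp_apply, AlgEquiv.toLinearMap_apply, map_one, hf1]
  · have : O.topEquiv.symm (O.x i) = O.stageX le_rfl i := by
      rw [AlgEquiv.symm_apply_eq]; rfl
    rw [LinearMap.comp_apply, AlgEquiv.toLinearMap_apply, this, hf]

variable {O} (hO : O.IsFiltered)
include hO

theorem exists_linearPart {j i : Fin t} (h : i < j) : ∃ v : Fin t → k,
    O.deltaX j i h - ∑ l, v l • O.x l ∈ Submodule.span k {(1 : S)} := by
  obtain ⟨a, ha, b, hb, hab⟩ := Submodule.mem_sup.1 (hO j i h)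
  have hb' : b ∈ Submodule.span k (Set.range O.x) :=
    Submodule.span_mono (Set.image_subset_range _ _) hb
  obtain ⟨v, hv⟩ := (Submodule.mem_span_range_iff_exists_fun k).1 hb'
  exact ⟨v, by rwa [hv, ← hab, add_sub_cancel_right]⟩

theorem deltaX_sub_mem {j i : Fin t} (h : i < j) :
    O.deltaX j i h - ∑ l, O.deltaBar j i l • O.x l ∈ Submodule.span k {(1 : S)} := by
  have := exists_linearPart hO h
  rw [deltaBar, dif_pos h, linearPart, dif_pos this]
  exact this.choose_spec

variable [Nontrivial S]

/-- The linear part is defined by a choice of coefficients on all t generators. The coordinate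
functional shows that these coefficients are unique, and the filtration hypothesis makes those from
x_j on vanish. -/
theorem deltaBar_eq_zero {j i l : Fin t} (h : i < j) (hl : j ≤ l) : O.deltaBar j i l = 0 := by
  obtain ⟨f, hf1, hf⟩ := O.exists_coord
  have h1 : Submodule.span k {(1 : S)} ≤ LinearMap.ker f :=
    Submodule.span_le.2 (by rintro _ rfl; exact hf1)
  have h2 : f (O.deltaX j i h) = O.deltaBar j i := by
    have := h1 (deltaX_sub_mem hO h)
    rw [LinearMap.mem_ker, map_sub, sub_eq_zero] at this
    rw [this, map_sum]
    funext l
    simp [hf, vec, Pi.single_apply]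
  have h3 : Submodule.span k {(1 : S)} ⊔ Submodule.span k (O.x '' {l | l < j}) ≤
      LinearMap.ker (LinearMap.proj l ∘ₗ f) := by
    refine sup_le (h1.trans fun s hs => ?_) (Submodule.span_le.2 ?_)
    · rw [LinearMap.mem_ker] at hs ⊢
      rw [LinearMap.comp_apply, hs, map_zero]
    · rintro _ ⟨p, hp, rfl⟩
      have : l ≠ p := (lt_of_lt_of_le hp hl).ne'
      simp [hf, vec, this]
  rw [← h2]
  exact h3 (hO j i h)

theorem isLinearPart_stage {m : ℕ} (hm : m < t) :
    IsLinearPart (O.δ ⟨m, hm⟩) (O.stageX hm.le)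
      (fun i l => O.deltaBar ⟨m, hm⟩ (Fin.castLE hm.le i) (Fin.castLE hm.le l)) := by
  intro i
  have hi : Fin.castLE hm.le i < ⟨m, hm⟩ := i.isLt
  obtain ⟨r, hr⟩ := Submodule.mem_span_singleton.1 (deltaX_sub_mem hO hi)
  refine Submodule.mem_span_singleton.2 ⟨r, Subtype.ext (hr.trans ?_)⟩
  -- Restricting the sum to the first m generators loses nothing, since the remaining coefficients
  -- vanish.
  have hsum : ∑ l : Fin m, O.deltaBar ⟨m, hm⟩ (Fin.castLE hm.le i) (Fin.castLE hm.le l) •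
      O.x (Fin.castLE hm.le l) = ∑ l, O.deltaBar ⟨m, hm⟩ (Fin.castLE hm.le i) l • O.x l := by
    refine Fintype.sum_of_injective (Fin.castLE hm.le) (Fin.castLE_injective _) _ _
      (fun l hl => ?_) fun _ => rfl
    rw [deltaBar_eq_zero hO hi, zero_smul]
    refine not_lt.1 fun h => hl ⟨⟨l, h⟩, rfl⟩
  rw [← hsum]
  change _ = O.deltaX _ _ hi - ((∑ l, _ : stage k O.x m) : S)
  rw [AddSubmonoidClass.coe_finsetSum]
  rfl

/-- The vectors δ̄ at stage m + 1 arise from those at stage m by appending a coordinate, which is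
zero by `deltaBar_eq_zero`. -/
theorem isExtensionData_stage {m : ℕ} (hm : m < t) :
    IsExtensionData (Subalgebra.inclusion (stage_mono O.x (Nat.le_succ m)) :
        stage k O.x m →ₐ[k] stage k O.x (m + 1))
      (O.stageX (Nat.succ_le_of_lt hm) (Fin.last m)) (O.stageX hm.le) (O.stageDeltaBar hm.le)
      (fun i l => O.deltaBar ⟨m, hm⟩ (Fin.castLE hm.le i) (Fin.castLE hm.le l))
      (O.stageX (Nat.succ_le_of_lt hm)) (O.stageDeltaBar (Nat.succ_le_of_lt hm)) where
  init _ := rfl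
  last := rfl
  coeff_init i j hij := by
    funext l
    induction l using Fin.lastCases with
    | last =>
      refine (deltaBar_eq_zero hO ?_ ?_).trans ?_
      · exact hij
      · exact j.isLt.le
      · rw [inclInit_last]
    | cast l => rw [inclInit_castSucc]; rfl
  coeff_last i := by
    funext l
    induction l using Fin.lastCases with
    | last =>
      refine (deltaBar_eq_zero hO ?_ ?_).trans ?_
      · exact i.isLt
      · exact le_rfl
      · rw [inclInit_last]
    | cast l => rw [inclInit_castSucc]; rfl

theorem isKoszulData_stage (m : ℕ) (hm : m ≤ t) :
    IsKoszulData (O.stageX hm) (O.stageDeltaBar hm) := by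
  induction m with
  | zero => exact isKoszulData_zero _ _
  | succ m ih =>
    exact isKoszulData_oreExtension (O.isOreExtension_stage hm) (ih (Nat.le_of_succ_le hm))
      (isLinearPart_stage hO hm) (isExtensionData_stage hO hm)

theorem isFreeResolution_stage (m : ℕ) (hm : m ≤ t) :
    IsFreeResolution (P := Kos k (stage k O.x m) m) (koszulD (O.stageX hm) (O.stageDeltaBar hm))
      (koszulAug k (stage k O.x m) m) := by
  induction m with
  | zero => exact isFreeResolution_zero O.algebraMap_stage_zero_surjective _ _
  | succ m ih =>
    exact isFreeResolution_oreExtension (O.isOreExtension_stage hm)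
      (isKoszulData_stage hO m (Nat.le_of_succ_le hm)) (isLinearPart_stage hO hm)
      (isExtensionData_stage hO hm) (ih (Nat.le_of_succ_le hm))

/-- The last stage is a subalgebra equal to the whole of S but not literally S. To avoid
transporting a resolution, only the last Ore extension is transported to S and the inductive step is
applied to it; t = 0 has no last extension and is treated apart. -/
theorem isKoszulData_and_isFreeResolution : IsKoszulData O.x O.deltaBar ∧
    IsFreeResolution (P := Kos k S t) (koszulD O.x O.deltaBar) (koszulAug k S t) := by
  rcases t with _ | m
  · refine ⟨isKoszulData_zero _ _, isFreeResolution_zero (fun s => ?_) _ _⟩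
    obtain ⟨r, hr⟩ := O.algebraMap_stage_zero_surjective (O.topEquiv.symm s)
    refine ⟨r, ?_⟩
    rw [← O.topEquiv.apply_symm_apply s, ← hr, AlgEquiv.commutes]
  · have h := isOreExtension_equiv (O.isOreExtension_stage (Nat.lt_succ_self m)) O.topEquiv
    have hk := isKoszulData_stage hO m (Nat.le_succ m)
    have he := isLinearPart_stage hO (Nat.lt_succ_self m)
    have hd := isExtensionData_equiv (isExtensionData_stage hO (Nat.lt_succ_self m)) O.topEquiv
    exact ⟨isKoszulData_oreExtension h hk he hd,
      isFreeResolution_oreExtension h hk he hd (isFreeResolution_stage hO m (Nat.le_succ m))⟩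

end IteratedOreExtension

end TwistedOre

/-! ### The resolution, its embedding and the iterated twisted product structure -/

theorem mainTheorem2 {k : Type*} [Field k] {S : Type*} [Ring S] [Nontrivial S] [Algebra k S]
    {t : ℕ} (O : IteratedOreExtension k S t) (hO : O.IsFiltered) :
    -- `K_n = S ⊗ ⋀ⁿ V ⊗ S` with the stated differential is a free bimodule resolution of `S`
    IsFreeResolution (P := Kos k S t) (koszulD O.x O.deltaBar) (koszulAug k S t) ∧
    (∀ (n : ℕ) (l : Fin (n + 1) → Fin t), StrictMono l →
      koszulD O.x O.deltaBar n (gen k S l) = koszulFormula O.x O.deltaBar n l) ∧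
    -- it embeds into the reduced bar resolution by symmetrization
    (∃ φ : ∀ n, Kos k S t n →ₗ[k] Bar k S n, IsSymmetrizationEmbedding O.x O.deltaBar φ) ∧
    -- it is an iterated twisted product: for `1 ≤ m + 1 ≤ t`, the complex of
    -- `S_{m+1} = k[x₁, …, x_{m+1}; δ₂, …, δ_{m+1}]` is the twisted product of that of `S_m` and the
    -- Koszul resolution of `k[x_{m+1}]`
    ∀ (m : ℕ) (hm : m < t),
      IsTwistedProductStep
        (Subalgebra.inclusion (stage_mono O.x (Nat.le_succ m)) :
          stage k O.x m →ₐ[k] stage k O.x (m + 1))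
        (O.δ ⟨m, hm⟩)
        (O.stageX hm.le) (O.stageDeltaBar hm.le)
        (O.stageX (Nat.succ_le_of_lt hm)) (O.stageDeltaBar (Nat.succ_le_of_lt hm)) := by
  obtain ⟨hk, hr⟩ := IteratedOreExtension.isKoszulData_and_isFreeResolution hO
  obtain ⟨f, hf1, hf⟩ := hk.coord
  exact ⟨hr, koszulD_gen O.x O.deltaBar,
    ⟨symmetrize O.x, isSymmetrizationEmbedding_symmetrize hk.comm f hf1 hf⟩,
    fun m hm => isTwistedProductStep_oreExtension (O.isOreExtension_stage hm)
      (IteratedOreExtension.isKoszulData_stage hO m hm.le)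
      (IteratedOreExtension.isLinearPart_stage hO hm)
      (IteratedOreExtension.isExtensionData_stage hO hm)
      (IteratedOreExtension.isFreeResolution_stage hO m hm.le)⟩
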